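/- For $p\in[1,\infty)$ let $W^{1,p}=W^{1,p}((0,1);\mathbb R^2)$ be the Sobolev space of $u\in L^p((0,1);\mathbb R^2)$ with weak derivative $u'\in L^p((0,1);\mathbb R^2)$, normed by $(\|u\|_{L^p}^p+\|u'\|_{L^p}^p)^{1/p}$. Elements of $W^{1,p}$ are identified with their continuous representatives on $(0,1)$. A homeomorphism means a homeomorphism of $(0,1)$ onto its image in $\mathbb R^2$ (with the subspace topology), and piecewise affine means continuous on $(0,1)$ and affine on each interval of some finite partition of $(0,1)$. (A) Let $p\in(1,\infty)$ and $y\in W^{1,p}$. The following are equivalent: 1. $y$ is non-interpenetrative, i.e. there is a sequence of homeomorphisms $y_k\in W^{1,p}$, bounded in $W^{1,p}$, with $y_k\to y$ uniformly on $(0,1)$. 2. There is a sequence of homeomorphisms $y_k\in W^{1,p}$, bounded in $W^{1,p}$, with $y_k\rightharpoonup y$ weakly in $W^{1,p}$. 3. There is a sequence of homeomorphisms $y_k\in W^{1,p}$, bounded in $W^{1,p}$, with $y_k\to y$ strongly in $W^{1,p}$. Moreover, if these hold, the sequence in 3 can be chosen such that every $y_k$ is piecewise affine. (B) Let $p\in[1,\infty)$,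 let $y\in W^{1,p}$, and let $\mathcal F_p$ be the set of $\varphi\in W^{1,p}$ that are one-to-one (and continuous) on $(0,1)$. The following are equivalent: 1. There are $\varphi_k\in\mathcal F_p$ with $\varphi_k\to y$ strongly in $W^{1,p}$. 2. There are $\varphi_k\in\mathcal F_p$ with $\varphi_k\rightharpoonup y$ weakly in $W^{1,p}$. 3. There are uniformly equicontinuous $\varphi_k\in\mathcal F_p$ with $\varphi_k\to y$ uniformly on $(0,1)$. Moreover, condition 1 is equivalent to the same condition with all $\varphi_k$ in addition piecewise affine. -/

import Mathlib

open MeasureTheory Set Filter Topology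
open scoped ENNReal ContDiff

noncomputable section

namespace PlanarRod

/-- The plane `ℝ²` with its Euclidean norm. -/
abbrev Plane : Type := EuclideanSpace ℝ (Fin 2)

/-- Lebesgue measure on the interval `(0,1)`. -/
abbrev μ01 : Measure ℝ := volume.restrict (Ioo (0 : ℝ) 1)

/-- Smooth real-valued test functions with compact support contained in `(0,1)`. -/
structure IsTestFunction (φ : ℝ → ℝ) : Prop where
  smooth : ContDiff ℝ ∞ φ
  compact : HasCompactSupport φ
  support : tsupport φ ⊆ Ioo (0 : ℝ) 1

/-- `v` is the weak (distributional) derivative of `u` on `(0,1)`. -/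
def HasWeakDeriv (u v : ℝ → Plane) : Prop :=
  ∀ φ : ℝ → ℝ, IsTestFunction φ →
    ∫ x, deriv φ x • u x ∂μ01 = - ∫ x, φ x • v x ∂μ01

theorem integrable_smul_test {p : ℝ≥0∞} [Fact (1 ≤ p)] {ψ : ℝ → ℝ}
    (hc : Continuous ψ) (hs : HasCompactSupport ψ) (u : Lp Plane p μ01) :
    Integrable (fun x => ψ x • u x) μ01 := by
  have hu : Integrable (fun x => u x) μ01 := (Lp.memLp u).integrable Fact.out
  obtain ⟨C, hC⟩ := hs.exists_bound_of_continuous hc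
  exact hu.bdd_smul C hc.aestronglyMeasurable (Filter.Eventually.of_forall hC)

theorem IsTestFunction.continuous_deriv {φ : ℝ → ℝ} (h : IsTestFunction φ) :
    Continuous (deriv φ) :=
  h.smooth.continuous_deriv (by simp)

/-- The Sobolev space `W^{1,p}((0,1); ℝ²)`, as the space of pairs `(u, u')` in `L^p × L^p` in which
`u'` is the weak derivative of `u`, with the norm inherited from the `ℓ^p`-product, that is
`(‖u‖_p ^ p + ‖u'‖_p ^ p) ^ (1/p)` for finite `p`. -/
def W1p (p : ℝ≥0∞) [Fact (1 ≤ p)] :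
    Submodule ℝ (WithLp p (Lp Plane p μ01 × Lp Plane p μ01)) where
  carrier := {f | HasWeakDeriv f.fst f.snd}
  zero_mem' := by
    intro φ _
    have h0 : (⇑(0 : Lp Plane p μ01) : ℝ → Plane) =ᵐ[μ01] 0 := Lp.coeFn_zero _ _ _
    have h1 : ∀ ψ : ℝ → ℝ, ∫ x, ψ x • (0 : Lp Plane p μ01) x ∂μ01 = 0 := by
      intro ψ
      rw [← integral_zero ℝ Plane (μ := μ01)]
      refine integral_congr_ae ?_
      filter_upwards [h0] with x hx
      rw [hx, Pi.zero_apply, smul_zero]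
    change ∫ x, deriv φ x • (0 : Lp Plane p μ01) x ∂μ01
      = - ∫ x, φ x • (0 : Lp Plane p μ01) x ∂μ01
    rw [h1, h1, neg_zero]
  add_mem' := by
    intro f g hf hg φ hφ
    have key : ∀ (ψ : ℝ → ℝ), Continuous ψ → HasCompactSupport ψ → ∀ a b : Lp Plane p μ01,
        ∫ x, ψ x • (a + b) x ∂μ01 = (∫ x, ψ x • a x ∂μ01) + ∫ x, ψ x • b x ∂μ01 := by
      intro ψ hc hs a b
      rw [← integral_add (integrable_smul_test hc hs a) (integrable_smul_test hc hs b)]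
      refine integral_congr_ae ?_
      filter_upwards [Lp.coeFn_add a b] with x hx
      rw [hx, Pi.add_apply, smul_add]
    change ∫ x, deriv φ x • (f.fst + g.fst) x ∂μ01 = - ∫ x, φ x • (f.snd + g.snd) x ∂μ01
    rw [key _ hφ.continuous_deriv hφ.compact.deriv, key _ hφ.smooth.continuous hφ.compact,
      hf φ hφ, hg φ hφ]
    abel
  smul_mem' := by
    intro c f hf φ hφ
    have key : ∀ (ψ : ℝ → ℝ) (a : Lp Plane p μ01),
        ∫ x, ψ x • (c • a) x ∂μ01 = c • ∫ x, ψ x • a x ∂μ01 := by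
      intro ψ a
      rw [← integral_smul]
      refine integral_congr_ae ?_
      filter_upwards [Lp.coeFn_smul c a] with x hx
      rw [hx, Pi.smul_apply, smul_comm]
    change ∫ x, deriv φ x • (c • f.fst) x ∂μ01 = - ∫ x, φ x • (c • f.snd) x ∂μ01
    rw [key, key, hf φ hφ, smul_neg]

section

variable {p : ℝ≥0∞} [Fact (1 ≤ p)]

/-- `u` is a continuous representative on `(0,1)` of the Sobolev function `y`
(its values outside `(0,1)` are irrelevant). -/
def IsContRep (y : W1p p) (u : ℝ → Plane) : Prop :=
  ContinuousOn u (Ioo (0 : ℝ) 1) ∧ u =ᵐ[μ01] y.1.fst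

/-- `y` is (represented by) a homeomorphism of `(0,1)` onto its image. -/
def IsHomeoOntoImage (y : W1p p) : Prop :=
  ∃ u : ℝ → Plane, IsContRep y u ∧ IsEmbedding ((Ioo (0 : ℝ) 1).domRestrict u)

/-- `y` is (represented by) a continuous one-to-one map on `(0,1)`. -/
def IsContInjective (y : W1p p) : Prop :=
  ∃ u : ℝ → Plane, IsContRep y u ∧ InjOn u (Ioo (0 : ℝ) 1)

/-- `y` is (represented by) a continuous map that is affine on each interval of some finite
partition `0 = t 0 < t 1 < ⋯ < t n = 1`. -/
def IsPiecewiseAffine (y : W1p p) : Prop :=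
  ∃ u : ℝ → Plane, IsContRep y u ∧
    ∃ (n : ℕ) (t : ℕ → ℝ), t 0 = 0 ∧ t n = 1 ∧ (∀ i < n, t i < t (i + 1)) ∧
      ∀ i < n, ∃ a b : Plane, ∀ x ∈ Ioo (t i) (t (i + 1)), u x = a + x • b

/-- Convergence in `C⁰((0,1); ℝ²)`: the continuous representatives converge uniformly. -/
def TendstoC0 (yk : ℕ → W1p p) (y : W1p p) : Prop :=
  ∃ (uk : ℕ → ℝ → Plane) (u : ℝ → Plane), (∀ k, IsContRep (yk k) (uk k)) ∧ IsContRep y u ∧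
    TendstoUniformlyOn uk u atTop (Ioo (0 : ℝ) 1)

/-- The continuous representatives of the sequence are (uniformly) equicontinuous on `(0,1)`. -/
def IsEquicont (yk : ℕ → W1p p) : Prop :=
  ∃ uk : ℕ → ℝ → Plane, (∀ k, IsContRep (yk k) (uk k)) ∧
    UniformEquicontinuousOn uk (Ioo (0 : ℝ) 1)

/-- Strong convergence: convergence in the norm of `W^{1,p}`. -/
def TendstoStrong (yk : ℕ → W1p p) (y : W1p p) : Prop :=
  Tendsto yk atTop (𝓝 y)

/-- Weak convergence: convergence in the weak topology of the normed space `W^{1,p}`. -/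
def TendstoWeak (yk : ℕ → W1p p) (y : W1p p) : Prop :=
  Tendsto (fun k => toWeakSpace ℝ (W1p p) (yk k)) atTop (𝓝 (toWeakSpace ℝ (W1p p) y))

/-- The sequence is bounded in `W^{1,p}`. -/
def IsBoundedSeq (yk : ℕ → W1p p) : Prop :=
  ∃ C : ℝ, ∀ k, ‖yk k‖ ≤ C

/-- `y` is non-interpenetrative: it is a `C⁰`-limit of a `W^{1,p}`-bounded sequence of
homeomorphisms onto their images. -/
def NonInterpenetrative (y : W1p p) : Prop :=
  ∃ yk : ℕ → W1p p, IsBoundedSeq yk ∧ (∀ k, IsHomeoOntoImage (yk k)) ∧ TendstoC0 yk y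

end

end PlanarRod

end

/-! Two implications carry the theorem: weak convergence in W^{1,p} forces uniform convergence of
equicontinuous representatives, and a uniform limit of injective Sobolev curves is a strong limit of
piecewise affine homeomorphisms. The remaining ones (strong implies weak, convergent implies
bounded, embedding implies injective) are formal.

The first, `TendstoWeak.tendstoC0_and_isEquicont`, must include p = 1, where a norm bound on the
derivatives gives no equicontinuity. Testing the derivatives against bounded functions gives
equi-integrability by a Vitali–Hahn–Saks argument (`exists_forall_norm_setIntegral_le`), hence
equicontinuity of the primitives; convergence of increments and of means then yields uniform
convergence.

The second, `TendstoC0.exists_piecewiseAffine`, rests on planar topology. Call an open set round if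
it contains the open chords of its closure. An injective curve stays injective when its excursions
into disjoint round sets are replaced by chords (`exists_straightening`), because disjoint arcs in
the closure of a round set, with endpoints outside the set, have disjoint chords; this is a degree
argument (`IsRound.disjoint_chords`). Fix a grid of mesh η whose lines the limit y meets at a finite
set T of times, never at a lattice vertex; almost every translate of the grid will do, by Banach's
indicatrix. An injective curve close to y is straightened twice: in tiny balls around the points
y(T), after which it passes between grid squares along straight segments only, and in round cells
nearly filling the squares, after which it runs along one chord between consecutive passages. The
result is a simple polygon with pairs of vertices close to y(σ k), for times σ k in T between which
y oscillates by a multiple of η (`exists_polygonalModel_of_limit`).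

For strong convergence the polygon is reparametrized: its short sides occupy small windows around
the σ k, and its long sides get slopes close to the difference quotients of y between successive σ
k. These quotients are averages of y', so by Jensen their norm is at most that of y'. They converge
to y' almost everywhere as η tends to 0: on short intervals by differentiability, on long ones
because y hardly moves there and y' must be small. Almost everywhere convergence with this norm
bound gives convergence in L^p, also for p = 1. -/

namespace PlanarRod

/-! ### A degree argument and chords of round sets -/

/-- A nonvanishing planar map on a convex body around the origin points, at some boundary point,
in the direction opposite to that point. -/
theorem exists_frontier_eq_neg_mul {K : Set ℂ} (hK : Convex ℝ K) (hK0 : K ∈ 𝓝 0)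
    (hKc : IsClosed K) (hKb : Bornology.IsBounded K) {f : ℂ → ℂ} (hf : ContinuousOn f K)
    (hf0 : ∀ z ∈ K, f z ≠ 0) :
    ∃ z ∈ frontier K, ∃ r : ℝ, 0 < r ∧ f z = -(r : ℂ) * z := by
  by_contra! hcon
  have hgc : Continuous (gauge K) := continuous_gauge hK hK0
  have hgpos : ∀ z : ℂ, z ≠ 0 → 0 < gauge K z := fun z hz =>
    (gauge_pos (absorbent_nhds_zero hK0)
      ((NormedSpace.isVonNBounded_iff ℝ).2 hKb)).2 hz
  -- Radial retraction onto K by the gauge. Composing f with it gives a zero-free map on the whole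
  -- plane, which has a continuous logarithm k.
  let ret : ℂ → ℂ := fun z => ((max 1 (gauge K z))⁻¹ : ℝ) • z
  have hmax : ∀ z, (0 : ℝ) < max 1 (gauge K z) := fun z => lt_max_of_lt_left one_pos
  have hret : Continuous ret :=
    ((continuous_const.max hgc).inv₀ fun z => (hmax z).ne').smul continuous_id
  have hretK : ∀ z, ret z ∈ K := by
    intro z
    rw [← hKc.closure_eq, ← gauge_le_one_iff_mem_closure hK hK0, gauge_smul_of_nonneg
      (inv_nonneg.2 (hmax z).le), smul_eq_mul, inv_mul_le_iff₀ (hmax z), mul_one]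
    exact le_max_right _ _
  have huniv : IsSimplyConnected (univ : Set ℂ) := by
    have := (convex_univ (𝕜 := ℝ) (E := ℂ)).contractibleSpace univ_nonempty
    exact (inferInstance : SimplyConnectedSpace (univ : Set ℂ))
  obtain ⟨k, hkc, hk⟩ := Complex.exists_continuousOn_eqOn_exp_comp (X := ℂ) (U := univ)
    huniv isOpen_univ
    (g := f ∘ ret) (hf.comp hret.continuousOn fun z _ => hretK z)
    (by rintro ⟨z, -, hz⟩; exact hf0 _ (hretK z) hz)
  rw [continuousOn_univ] at hkc
  let e : ℝ → ℂ := fun θ => Complex.exp (θ * Complex.I)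
  have hec : Continuous e := by fun_prop
  have he0 : ∀ θ, e θ ≠ 0 := fun θ => Complex.exp_ne_zero _
  let b : ℝ → ℂ := fun θ => ((gauge K (e θ))⁻¹ : ℝ) • e θ
  have hbc : Continuous b :=
    ((hgc.comp hec).inv₀ fun θ => (hgpos _ (he0 θ)).ne').smul hec
  have hbg : ∀ θ, gauge K (b θ) = 1 := fun θ => by
    rw [gauge_smul_of_nonneg (inv_nonneg.2 (hgpos _ (he0 θ)).le), smul_eq_mul,
      inv_mul_cancel₀ (hgpos _ (he0 θ)).ne']
  have hbfr : ∀ θ, b θ ∈ frontier K := fun θ =>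
    (gauge_eq_one_iff_mem_frontier hK hK0).1 (hbg θ)
  have hbK : ∀ θ, b θ ∈ K := fun θ => hKc.frontier_subset (hbfr θ)
  have hkb : ∀ θ, Complex.exp (k (b θ)) = f (b θ) := fun θ => by
    have := hk (mem_univ (b θ))
    simpa [ret, hbg θ] using this
  let q : ℝ → ℂ := fun θ => f (b θ) / e θ
  have hqc : Continuous q :=
    (hf.comp_continuous hbc hbK).div hec he0
  -- A value of q on the closed negative half-line is nonzero, so it means f (b θ) = -r b θ with r >
  -- 0, which is excluded. Hence the principal logarithm of q is continuous.
  have hq : ∀ θ, q θ ∈ Complex.slitPlane := by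
    intro θ
    by_contra hn
    rw [Complex.mem_slitPlane_iff_not_le_zero, not_not, Complex.le_def] at hn
    simp only [Complex.zero_re, Complex.zero_im] at hn
    have hqr : q θ = ((q θ).re : ℂ) := Complex.ext (by simp) (by simp [hn.2])
    have hfq : f (b θ) = q θ * e θ := (div_mul_cancel₀ _ (he0 θ)).symm
    have hne : (q θ).re ≠ 0 := by
      intro h0
      rw [h0] at hqr
      exact hf0 _ (hbK θ) (by rw [hfq, hqr]; simp)
    refine hcon (b θ) (hbfr θ) (-(q θ).re * gauge K (e θ))
      (mul_pos (neg_pos.2 (lt_of_le_of_ne hn.1 hne)) (hgpos _ (he0 θ))) ?_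
    have hg := (hgpos _ (he0 θ)).ne'
    rw [hfq, hqr]
    simp only [b, Complex.real_smul]
    push_cast
    have hg' : (gauge K (e θ) : ℂ) ≠ 0 := by exact_mod_cast hg
    field_simp
    rw [Complex.ofReal_re, mul_comm]
  -- Both k (b θ) and iθ + log (q θ) are logarithms of f (b θ), so h takes values in 2πiℤ. Its
  -- imaginary part drops by 2π over one turn, and the intermediate value theorem yields a forbidden
  -- value halfway.
  let h : ℝ → ℂ := fun θ => k (b θ) - θ * Complex.I - Complex.log (q θ)
  have hhc : Continuous h :=
    ((hkc.comp hbc).sub (by fun_prop)).sub (hqc.clog hq)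
  have hh : ∀ θ, ∃ n : ℤ, h θ = n * (2 * Real.pi * Complex.I) := by
    intro θ
    rw [← Complex.exp_eq_one_iff]
    simp only [h]
    rw [Complex.exp_sub, Complex.exp_sub, hkb, Complex.exp_log (Complex.slitPlane_ne_zero (hq θ))]
    exact div_self (div_ne_zero (hf0 _ (hbK θ)) (he0 θ))
  have he2 : e (2 * Real.pi) = e 0 := by simp [e]
  have hdiff : (h (2 * Real.pi)).im = (h 0).im - 2 * Real.pi := by
    simp [h, q, b, he2]; ring
  obtain ⟨n, hn⟩ := hh 0
  have hn' : (h 0).im = n * (2 * Real.pi) := by rw [hn]; simp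
  have hmem : (n : ℝ) * (2 * Real.pi) - Real.pi ∈ Icc ((h (2 * Real.pi)).im) ((h 0).im) := by
    rw [hdiff, hn']; constructor <;> linarith [Real.pi_pos]
  obtain ⟨θ, -, hθ⟩ := intermediate_value_Icc' Real.two_pi_pos.le
    (Complex.continuous_im.comp hhc).continuousOn hmem
  obtain ⟨m, hm⟩ := hh θ
  have hm' : (h θ).im = m * (2 * Real.pi) := by rw [hm]; simp
  simp only [Function.comp_apply] at hθ
  rw [hm'] at hθ
  have : (2 * (n - m) : ℝ) = 1 := by
    have hp := Real.pi_pos.ne'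
    have : Real.pi * (2 * (n - m) : ℝ) = Real.pi * 1 := by linarith
    exact mul_left_cancel₀ hp this
  have h2 : (2 * (n - m) : ℤ) = 1 := by exact_mod_cast this
  omega

/-- An open set such that the open chords of its closure lie in the set. -/
structure IsRound (C : Set Plane) : Prop where
  isOpen : IsOpen C
  openSegment_subset : ∀ ⦃a b : Plane⦄, a ∈ closure C → b ∈ closure C → a ≠ b →
    openSegment ℝ a b ⊆ C

/-- Of three collinear points of closure C \ C, the middle one would lie on the open chord between
the others, hence in C. So a line meets closure C \ C at most twice. -/
theorem IsRound.aligned_of_mem {C : Set Plane} (hC : IsRound C) {z u : Plane} {s s' t t' : ℝ}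
    (hs : 0 < s) (hs' : 0 < s') (ht : 0 < t) (ht' : 0 < t') (hu : u ≠ 0)
    (ha₁ : z - s • u ∈ closure C \ C) (hb₁ : z + s' • u ∈ closure C \ C)
    (ha₂ : z - t • u ∈ closure C \ C) (hb₂ : z + t' • u ∈ closure C \ C) :
    s = t ∧ s' = t' := by
  have key : ∀ p q r : ℝ, p < q → q < r → z + p • u ∈ closure C \ C → z + q • u ∈ closure C \ C →
      z + r • u ∈ closure C \ C → False := by
    intro p q r hpq hqr hp hq hr
    have hne : z + p • u ≠ z + r • u := by
      intro h
      have h2 : (p - r) • u = 0 := by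
        rw [sub_smul, sub_eq_zero]; exact add_left_cancel h
      rcases smul_eq_zero.1 h2 with h3 | h3
      · linarith
      · exact hu h3
    refine hq.2 (hC.openSegment_subset hp.1 hr.1 hne ?_)
    refine ⟨(r - q) / (r - p), (q - p) / (r - p), by apply div_pos <;> linarith,
      by apply div_pos <;> linarith, ?_, ?_⟩
    · field_simp [(by linarith : r - p ≠ 0)]; ring
    · have h1 : (r - q) / (r - p) + (q - p) / (r - p) = 1 := by
        have : r - p ≠ 0 := by linarith
        field_simp; ring
      have h2 : (r - q) / (r - p) * p + (q - p) / (r - p) * r = q := by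
        have : r - p ≠ 0 := by linarith
        field_simp; ring
      calc _ = ((r - q) / (r - p) + (q - p) / (r - p)) • z
            + ((r - q) / (r - p) * p + (q - p) / (r - p) * r) • u := by module
        _ = _ := by rw [h1, h2, one_smul]
  have e1 : z - s • u = z + (-s) • u := by module
  have e2 : z - t • u = z + (-t) • u := by module
  rw [e1] at ha₁
  rw [e2] at ha₂
  constructor
  · rcases lt_trichotomy s t with h | h | h
    · exact (key (-t) (-s) s' (by linarith) (by linarith) ha₂ ha₁ hb₁).elim
    · exact h
    · exact (key (-s) (-t) s' (by linarith) (by linarith) ha₁ ha₂ hb₁).elim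
  · rcases lt_trichotomy s' t' with h | h | h
    · exact (key (-s) s' t' (by linarith) (by linarith) ha₁ hb₁ hb₂).elim
    · exact h
    · exact (key (-s) t' s' (by linarith) (by linarith) ha₁ hb₂ hb₁).elim

/-- Crossing chords of a round set are transversal unless they have the same endpoints. -/
theorem IsRound.not_parallel {C : Set Plane} (hC : IsRound C) {a₁ b₁ a₂ b₂ z : Plane}
    (ha₁ : a₁ ∈ closure C \ C) (hb₁ : b₁ ∈ closure C \ C)
    (ha₂ : a₂ ∈ closure C \ C) (hb₂ : b₂ ∈ closure C \ C)
    (h₁ : a₁ ≠ b₁) (h₂ : a₂ ≠ b₂) (ha : a₁ ≠ a₂) (hb : a₁ ≠ b₂)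
    (hz₁ : z ∈ openSegment ℝ a₁ b₁) (hz₂ : z ∈ openSegment ℝ a₂ b₂) (c : ℝ) :
    b₂ - a₂ ≠ c • (b₁ - a₁) := by
  intro hc
  obtain ⟨p, q, hp, hq, hpq, rfl⟩ := hz₁
  obtain ⟨p', q', hp', hq', hpq', hz⟩ := hz₂
  set z := p • a₁ + q • b₁ with hzdef
  have hu : b₁ - a₁ ≠ 0 := sub_ne_zero.2 h₁.symm
  have hc0 : c ≠ 0 := by
    rintro rfl
    rw [zero_smul, sub_eq_zero] at hc
    exact h₂ hc.symm
  obtain rfl : p = 1 - q := by linarith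
  obtain rfl : p' = 1 - q' := by linarith
  have e1 : a₁ = z - q • (b₁ - a₁) := by rw [hzdef]; module
  have e2 : b₁ = z + (1 - q) • (b₁ - a₁) := by rw [hzdef]; module
  have e3 : a₂ = z - (q' * c) • (b₁ - a₁) := by
    rw [mul_smul, ← hc, ← hz]; module
  have e4 : b₂ = z + ((1 - q') * c) • (b₁ - a₁) := by
    rw [mul_smul, ← hc, ← hz]; module
  -- Parallel chords through z lie on one line and have the same two endpoints: a₁ = b₂ if the
  -- directions are opposite, a₁ = a₂ if they agree.
  rcases lt_or_gt_of_ne hc0 with hneg | hpos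
  · have := hC.aligned_of_mem (z := z) (u := b₁ - a₁) (s := q) (s' := 1 - q)
      (t := (1 - q') * (-c)) (t' := q' * (-c)) hq hp (by nlinarith) (by nlinarith) hu
      (by rwa [← e1]) (by rwa [← e2])
      (by convert hb₂ using 1; rw [e4]; module) (by convert ha₂ using 1; rw [e3]; module)
    apply hb
    rw [e1, e4, this.1]; module
  · have := hC.aligned_of_mem (z := z) (u := b₁ - a₁) (s := q) (s' := 1 - q)
      (t := q' * c) (t' := (1 - q') * c) hq hp (by positivity) (by positivity) hu
      (by rwa [← e1]) (by rwa [← e2]) (by rwa [← e3]) (by rwa [← e4])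
    apply ha
    rw [e1, e3, this.1]

/-- Dividing by 1 + r would put a on the open chord from x to y, hence in C; for x = y it would give
a = x. This is the contradiction on the sides of the rectangle in `IsRound.disjoint_chords`. -/
theorem IsRound.ne_convex_comb {C : Set Plane} (hC : IsRound C) {a x y : Plane}
    (ha : a ∉ C) (hx : x ∈ closure C) (hy : y ∈ closure C) (hne : a ≠ x) {r : ℝ} (hr : 0 < r) :
    (1 + r) • a ≠ x + r • y := by
  intro h
  have hr1 : (1 + r) ≠ 0 := by positivity
  have h2 : a = (1 / (1 + r)) • x + (r / (1 + r)) • y := by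
    have : a = (1 + r)⁻¹ • ((1 + r) • a) := by rw [smul_smul, inv_mul_cancel₀ hr1, one_smul]
    rw [this, h, smul_add, smul_smul]
    congr 2 <;> field_simp
  by_cases hxy : x = y
  · subst hxy
    apply hne
    rw [h2, ← add_smul, ← add_div, div_self hr1, one_smul]
  · exact ha (hC.openSegment_subset hx hy hxy
      ⟨_, _, by positivity, by positivity, by field_simp, h2.symm⟩)

theorem IsRound.lineMap_mem_closure {C : Set Plane} (hC : IsRound C) {a b : Plane}
    (ha : a ∈ closure C) (hb : b ∈ closure C) {t : ℝ} (ht : t ∈ Icc (0 : ℝ) 1) :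
    AffineMap.lineMap a b t ∈ closure C := by
  by_cases hab : a = b
  · subst hab; simpa using ha
  rcases eq_or_lt_of_le ht.1 with h | h
  · subst h; simpa using ha
  rcases eq_or_lt_of_le ht.2 with h' | h'
  · subst h'; simpa using hb
  apply subset_closure
  apply hC.openSegment_subset ha hb hab
  rw [openSegment_eq_image_lineMap]
  exact ⟨t, ⟨h, h'⟩, rfl⟩

/-- Disjoint arcs in a round set have disjoint chords. -/
theorem IsRound.disjoint_chords {C : Set Plane} (hC : IsRound C) {γ₁ γ₂ : ℝ → Plane}
    {α₁ β₁ α₂ β₂ : ℝ} (h₁ : α₁ < β₁) (h₂ : α₂ < β₂)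
    (hc₁ : ContinuousOn γ₁ (Icc α₁ β₁)) (hc₂ : ContinuousOn γ₂ (Icc α₂ β₂))
    (hm₁ : ∀ t ∈ Icc α₁ β₁, γ₁ t ∈ closure C) (hm₂ : ∀ t ∈ Icc α₂ β₂, γ₂ t ∈ closure C)
    (ha₁ : γ₁ α₁ ∉ C) (hb₁ : γ₁ β₁ ∉ C) (ha₂ : γ₂ α₂ ∉ C) (hb₂ : γ₂ β₂ ∉ C)
    (hab₁ : γ₁ α₁ ≠ γ₁ β₁) (hab₂ : γ₂ α₂ ≠ γ₂ β₂)
    (hne : ∀ s ∈ Icc α₁ β₁, ∀ t ∈ Icc α₂ β₂, γ₁ s ≠ γ₂ t) :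
    Disjoint (openSegment ℝ (γ₁ α₁) (γ₁ β₁)) (openSegment ℝ (γ₂ α₂) (γ₂ β₂)) := by
  rw [Set.disjoint_left]
  intro z hz₁ hz₂
  have l₁ : α₁ ∈ Icc α₁ β₁ := left_mem_Icc.2 h₁.le
  have r₁ : β₁ ∈ Icc α₁ β₁ := right_mem_Icc.2 h₁.le
  have l₂ : α₂ ∈ Icc α₂ β₂ := left_mem_Icc.2 h₂.le
  have r₂ : β₂ ∈ Icc α₂ β₂ := right_mem_Icc.2 h₂.le
  have hpar := hC.not_parallel ⟨hm₁ _ l₁, ha₁⟩ ⟨hm₁ _ r₁, hb₁⟩ ⟨hm₂ _ l₂, ha₂⟩ ⟨hm₂ _ r₂, hb₂⟩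
    hab₁ hab₂ (hne _ l₁ _ l₂) (hne _ l₁ _ r₂) hz₁ hz₂
  rw [openSegment_eq_image_lineMap] at hz₁ hz₂
  obtain ⟨p, hp, hpz⟩ := hz₁
  obtain ⟨q, hq, hqz⟩ := hz₂
  set u := γ₁ β₁ - γ₁ α₁ with hu
  set v := γ₂ β₂ - γ₂ α₂ with hv
  have hd₁ : 0 < β₁ - α₁ := sub_pos.2 h₁
  have hd₂ : 0 < β₂ - α₂ := sub_pos.2 h₂
  -- affine parametrizations of the chords, centred at the crossing point
  let c₁ : ℝ → Plane := fun s => AffineMap.lineMap (γ₁ α₁) (γ₁ β₁) (p + s)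
  let c₂ : ℝ → Plane := fun s => AffineMap.lineMap (γ₂ α₂) (γ₂ β₂) (q + s)
  have hu0 : u ≠ 0 := sub_ne_zero.2 hab₁.symm
  -- A sends s + it to c₁ s - c₂ t. It is invertible because crossing chords are transversal, and
  -- through it the zero-free difference of the two curves becomes a map f on the parameter
  -- rectangle K to be compared with the identity.
  let A : ℂ →ₗ[ℝ] Plane :=
    Complex.reLm.smulRight u - Complex.imLm.smulRight v
  have hA : ∀ z : ℂ, A z = z.re • u - z.im • v := fun z => rfl
  have hAc : ∀ z : ℂ, A z = c₁ z.re - c₂ z.im := by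
    intro w
    have e₁ : c₁ w.re = z + w.re • u := by
      rw [← hpz]; simp only [c₁, AffineMap.lineMap_apply, vsub_eq_sub, vadd_eq_add]; rw [← hu]
      module
    have e₂ : c₂ w.im = z + w.im • v := by
      rw [← hqz]; simp only [c₂, AffineMap.lineMap_apply, vsub_eq_sub, vadd_eq_add]; rw [← hv]
      module
    rw [hA, e₁, e₂]; module
  have hAinj : Function.Injective A := by
    rw [← LinearMap.ker_eq_bot, LinearMap.ker_eq_bot']
    intro w hw
    rw [hA, sub_eq_zero] at hw
    have him : w.im = 0 := by
      by_contra h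
      apply hpar (w.re / w.im)
      rw [div_eq_inv_mul, mul_smul, hw, smul_smul, inv_mul_cancel₀ h, one_smul]
    have hre : w.re = 0 := by
      rw [him, zero_smul] at hw
      exact (smul_eq_zero.1 hw).resolve_right hu0
    exact Complex.ext hre him
  let e : ℂ ≃ₗ[ℝ] Plane := LinearEquiv.ofInjectiveOfFinrankEq A hAinj (by simp)
  have he : ∀ z, e z = A z := fun z => rfl
  let T₁ : ℝ → ℝ := fun s => α₁ + (p + s) * (β₁ - α₁)
  let T₂ : ℝ → ℝ := fun s => α₂ + (q + s) * (β₂ - α₂)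
  let K : Set ℂ := Icc (-p) (1 - p) ×ℂ Icc (-q) (1 - q)
  have hT₁ : ∀ z ∈ K, T₁ z.re ∈ Icc α₁ β₁ := by
    rintro w ⟨⟨hw1, hw2⟩, -⟩
    change _ ≤ w.re at hw1
    change w.re ≤ _ at hw2
    constructor <;> simp only [T₁] <;> nlinarith
  have hT₂ : ∀ z ∈ K, T₂ z.im ∈ Icc α₂ β₂ := by
    rintro w ⟨-, ⟨hw1, hw2⟩⟩
    change _ ≤ w.im at hw1
    change w.im ≤ _ at hw2
    constructor <;> simp only [T₂] <;> nlinarith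
  let f : ℂ → ℂ := fun w => e.symm (γ₁ (T₁ w.re) - γ₂ (T₂ w.im))
  have hfc : ContinuousOn f K := by
    have hcs : Continuous e.symm := e.symm.toLinearMap.continuous_of_finiteDimensional
    refine hcs.comp_continuousOn (ContinuousOn.sub ?_ ?_)
    · exact hc₁.comp (by fun_prop) hT₁
    · exact hc₂.comp (by fun_prop) hT₂
  have hf0 : ∀ w ∈ K, f w ≠ 0 := by
    intro w hw h0
    simp only [f, LinearEquiv.map_eq_zero_iff, sub_eq_zero] at h0
    exact hne _ (hT₁ w hw) _ (hT₂ w hw) h0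
  have hKint : Ioo (-p) (1 - p) ×ℂ Ioo (-q) (1 - q) ⊆ interior K := by
    exact interior_maximal (fun w hw => ⟨Ioo_subset_Icc_self hw.1, Ioo_subset_Icc_self hw.2⟩)
      (isOpen_Ioo.reProdIm isOpen_Ioo)
  have hK0 : K ∈ 𝓝 0 := mem_interior_iff_mem_nhds.1 (hKint (by
    refine ⟨⟨?_, ?_⟩, ⟨?_, ?_⟩⟩ <;> simp [hp.1, hp.2, hq.1, hq.2]))
  -- At this boundary point γ₁ - γ₂ = -r (c₁ - c₂), that is, γ₁ + r c₁ = γ₂ + r c₂. On each side of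
  -- K one curve and its chord sit at a common endpoint a outside C, so (1 + r) a = x + r y with x
  -- and y in closure C.
  obtain ⟨w, hwfr, r, hr, hfw⟩ := exists_frontier_eq_neg_mul
    (((convex_Icc _ _).linear_preimage Complex.reLm).inter
      ((convex_Icc _ _).linear_preimage Complex.imLm)) hK0 (isClosed_Icc.reProdIm isClosed_Icc)
    (Bornology.IsBounded.reProdIm (Metric.isBounded_Icc _ _) (Metric.isBounded_Icc _ _)) hfc hf0
  have hwK : w ∈ K := (isClosed_Icc.reProdIm isClosed_Icc).frontier_subset hwfr
  have hwni : w ∉ interior K := hwfr.2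
  have hFw : γ₁ (T₁ w.re) - γ₂ (T₂ w.im) = -(r • (c₁ w.re - c₂ w.im)) := by
    have : e (f w) = e (-(r : ℂ) * w) := by rw [hfw]
    simp only [f, LinearEquiv.apply_symm_apply] at this
    rw [this, ← hAc, ← he, ← map_smul, ← map_neg]
    congr 1
    simp
  have hFw' : γ₁ (T₁ w.re) + r • c₁ w.re = γ₂ (T₂ w.im) + r • c₂ w.im := by
    rw [smul_sub] at hFw
    rw [sub_eq_iff_eq_add] at hFw
    rw [hFw]; abel
  have hw1 : w.re ∈ Icc (-p) (1 - p) := hwK.1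
  have hw2 : w.im ∈ Icc (-q) (1 - q) := hwK.2
  have hcl₁ : c₁ w.re ∈ closure C := hC.lineMap_mem_closure (hm₁ _ l₁) (hm₁ _ r₁)
    ⟨by linarith [hw1.1], by linarith [hw1.2]⟩
  have hcl₂ : c₂ w.im ∈ closure C := hC.lineMap_mem_closure (hm₂ _ l₂) (hm₂ _ r₂)
    ⟨by linarith [hw2.1], by linarith [hw2.2]⟩
  have hor : (w.re = -p ∨ w.re = 1 - p) ∨ (w.im = -q ∨ w.im = 1 - q) := by
    by_contra! hcon
    exact hwni (hKint ⟨⟨lt_of_le_of_ne hw1.1 hcon.1.1.symm, lt_of_le_of_ne hw1.2 hcon.1.2⟩,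
      ⟨lt_of_le_of_ne hw2.1 hcon.2.1.symm, lt_of_le_of_ne hw2.2 hcon.2.2⟩⟩)
  have hn := hne _ (hT₁ w hwK) _ (hT₂ w hwK)
  have side : ∀ a x y : Plane, a ∉ C → x ∈ closure C → y ∈ closure C → a ≠ x →
      a + r • a = x + r • y → False := fun a x y h1 h2 h3 h4 h5 =>
    hC.ne_convex_comb h1 h2 h3 h4 hr (by rw [← h5, add_smul, one_smul])
  rcases hor with (h | h) | (h | h)
  · have hT : T₁ w.re = α₁ := by simp [T₁, h]
    have hc : c₁ w.re = γ₁ α₁ := by simp [c₁, h]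
    rw [hT, hc] at hFw'
    rw [hT] at hn
    exact side _ _ _ ha₁ (hm₂ _ (hT₂ w hwK)) hcl₂ hn hFw'
  · have hT : T₁ w.re = β₁ := by simp [T₁, h]
    have hc : c₁ w.re = γ₁ β₁ := by simp [c₁, h]
    rw [hT, hc] at hFw'
    rw [hT] at hn
    exact side _ _ _ hb₁ (hm₂ _ (hT₂ w hwK)) hcl₂ hn hFw'
  · have hT : T₂ w.im = α₂ := by simp [T₂, h]
    have hc : c₂ w.im = γ₂ α₂ := by simp [c₂, h]
    rw [hT, hc] at hFw'
    rw [hT] at hn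
    exact side _ _ _ ha₂ (hm₁ _ (hT₁ w hwK)) hcl₁ hn.symm hFw'.symm
  · have hT : T₂ w.im = β₂ := by simp [T₂, h]
    have hc : c₂ w.im = γ₂ β₂ := by simp [c₂, h]
    rw [hT, hc] at hFw'
    rw [hT] at hn
    exact side _ _ _ hb₂ (hm₁ _ (hT₁ w hwK)) hcl₁ hn.symm hFw'.symm

end PlanarRod

/-! ### Straightening an injective curve by chords -/

namespace PlanarRod

theorem _root_.IsPreconnected.exists_subset_of_iUnion {X ι : Type*} [TopologicalSpace X]
    {s : Set X} (hs : IsPreconnected s) (hne : s.Nonempty) {C : ι → Set X}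
    (ho : ∀ i, IsOpen (C i)) (hd : Pairwise (Function.onFun Disjoint C)) (hsub : s ⊆ ⋃ i, C i) :
    ∃ i, s ⊆ C i := by
  obtain ⟨x, hx⟩ := hne
  obtain ⟨i, hi⟩ := mem_iUnion.1 (hsub hx)
  refine ⟨i, hs.subset_left_of_subset_union (ho i)
    (isOpen_iUnion fun j => isOpen_iUnion fun (_ : j ≠ i) => ho j)
    (v := ⋃ j, ⋃ (_ : j ≠ i), C j) ?_ ?_ ⟨x, hx, hi⟩⟩
  · exact disjoint_iUnion_right.2 fun j => disjoint_iUnion_right.2 fun hj => hd hj.symm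
  · intro y hy
    obtain ⟨j, hj⟩ := mem_iUnion.1 (hsub hy)
    by_cases hji : j = i
    · left; rwa [← hji]
    · right; exact mem_iUnion.2 ⟨j, mem_iUnion.2 ⟨hji, hj⟩⟩

/-- A curve running in a disjoint union of open sets stays in the closure of one of them. -/
theorem exists_forall_mem_closure {X ι : Type*} [TopologicalSpace X] {C : ι → Set X}
    (ho : ∀ i, IsOpen (C i)) (hd : Pairwise (Function.onFun Disjoint C)) {φ : ℝ → X} {α β : ℝ}
    (hαβ : α < β) (hφ : ContinuousOn φ (Icc α β)) (h : ∀ s ∈ Ioo α β, φ s ∈ ⋃ i, C i) :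
    ∃ i, ∀ s ∈ Icc α β, φ s ∈ closure (C i) := by
  obtain ⟨i, hi⟩ := (isPreconnected_Ioo.image φ (hφ.mono Ioo_subset_Icc_self)
    ).exists_subset_of_iUnion ((nonempty_Ioo.2 hαβ).image φ) ho hd (image_subset_iff.2 h)
  refine ⟨i, fun s hs => closure_mono hi ?_⟩
  have hmem : s ∈ closure (Ioo α β) := by rwa [closure_Ioo hαβ.ne]
  exact ((hφ s hs).mono Ioo_subset_Icc_self).mem_closure_image hmem

/-- The gap around t runs from the last point of N before t to the first point of N after it. -/
theorem exists_gap {N : Set ℝ} (hN : IsClosed N) {a b t : ℝ} (ha : a ∈ N) (hb : b ∈ N)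
    (hat : a ≤ t) (htb : t ≤ b) (ht : t ∉ N) :
    ∃ α ∈ N, ∃ β ∈ N, α < t ∧ t < β ∧ a ≤ α ∧ β ≤ b ∧ ∀ s ∈ Ioo α β, s ∉ N := by
  have h1 : IsGreatest (N ∩ Iic t) (sSup (N ∩ Iic t)) :=
    ⟨(hN.inter isClosed_Iic).csSup_mem ⟨a, ha, hat⟩ ⟨t, fun x hx => hx.2⟩,
      fun x hx => le_csSup ⟨t, fun x hx => hx.2⟩ hx⟩
  have h2 : IsLeast (N ∩ Ici t) (sInf (N ∩ Ici t)) :=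
    ⟨(hN.inter isClosed_Ici).csInf_mem ⟨b, hb, htb⟩ ⟨t, fun x hx => hx.2⟩,
      fun x hx => csInf_le ⟨t, fun x hx => hx.2⟩ hx⟩
  set α := sSup (N ∩ Iic t)
  set β := sInf (N ∩ Ici t)
  refine ⟨α, h1.1.1, β, h2.1.1, lt_of_le_of_ne h1.1.2 ?_, lt_of_le_of_ne h2.1.2 ?_,
    h1.2 ⟨ha, hat⟩, h2.2 ⟨hb, htb⟩, ?_⟩
  · intro h; exact ht (h ▸ h1.1.1)
  · intro h; exact ht (h ▸ h2.1.1)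
  · intro s hs hsN
    rcases le_total s t with h | h
    · exact absurd (h1.2 ⟨hsN, h⟩) (not_le.2 hs.1)
    · exact absurd (h2.2 ⟨hsN, h⟩) (not_le.2 hs.2)

/-- `ψ` agrees with `φ` on `N` and is affine on the gaps of `N`. -/
structure IsChordal {E : Type*} [NormedAddCommGroup E] [NormedSpace ℝ E]
    (N : Set ℝ) (φ ψ : ℝ → E) : Prop where
  eq_on : ∀ t ∈ N, ψ t = φ t
  gap : ∀ α ∈ N, ∀ β ∈ N, α < β → (∀ s ∈ Ioo α β, s ∉ N) → ∀ t ∈ Icc α β,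
    ψ t = AffineMap.lineMap (φ α) (φ β) ((t - α) / (β - α))

section Chordal

variable {E : Type*} [NormedAddCommGroup E] [NormedSpace ℝ E] {N : Set ℝ} {φ ψ : ℝ → E}

theorem IsChordal.comp_neg (h : IsChordal N φ ψ) :
    IsChordal (Neg.neg ⁻¹' N) (fun t => φ (-t)) (fun t => ψ (-t)) where
  eq_on t ht := h.eq_on _ ht
  gap α hα β hβ hlt hgap t ht := by
    rw [h.gap (-β) hβ (-α) hα (neg_lt_neg hlt)
      (fun s hs hsN => hgap (-s) ⟨by linarith [hs.2], by linarith [hs.1]⟩ (by simpa using hsN))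
      (-t) ⟨by linarith [ht.2], by linarith [ht.1]⟩, ← AffineMap.lineMap_apply_one_sub]
    congr 1
    have : β - α ≠ 0 := by linarith
    have h2 : -α - -β ≠ 0 := by linarith
    rw [show -α - -β = β - α by ring]
    field_simp
    ring

theorem exists_isChordal (N : Set ℝ) (φ : ℝ → E) : ∃ ψ, IsChordal N φ ψ := by
  classical
  let α : ℝ → ℝ := fun t => sSup (N ∩ Iic t)
  let β : ℝ → ℝ := fun t => sInf (N ∩ Ici t)
  have key : ∀ t ∈ N, α t = t := fun t ht =>
    IsGreatest.csSup_eq ⟨⟨ht, mem_Iic.2 le_rfl⟩, fun x hx => hx.2⟩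
  have key' : ∀ t ∈ N, β t = t := fun t ht =>
    IsLeast.csInf_eq ⟨⟨ht, mem_Ici.2 le_rfl⟩, fun x hx => hx.2⟩
  -- On N both α t and β t equal t, so the parameter is 0 / 0 = 0 and the value is φ t.
  let ψ : ℝ → E := fun t => AffineMap.lineMap (φ (α t)) (φ (β t)) ((t - α t) / (β t - α t))
  have h0 : ∀ t ∈ N, ψ t = φ t := fun t ht => by simp [ψ, key t ht]
  refine ⟨ψ, h0, fun a ha b hb hab hgap t ht => ?_⟩
  rcases eq_or_lt_of_le ht.1 with rfl | h1
  · simp [h0 _ ha]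
  rcases eq_or_lt_of_le ht.2 with rfl | h2
  · rw [h0 _ hb, div_self (by linarith)]; simp
  have e1 : α t = a := IsGreatest.csSup_eq ⟨⟨ha, h1.le⟩, fun x hx => by
    by_contra h
    exact hgap x ⟨not_le.1 h, lt_of_le_of_lt hx.2 h2⟩ hx.1⟩
  have e2 : β t = b := IsLeast.csInf_eq ⟨⟨hb, h2.le⟩, fun x hx => by
    by_contra h
    exact hgap x ⟨lt_of_lt_of_le h1 hx.2, not_le.1 h⟩ hx.1⟩
  simp only [ψ, e1, e2]

theorem lineMap_mem_of_mem_Icc {S : Set E} (hS : Convex ℝ S) {x y : E} (hx : x ∈ S) (hy : y ∈ S)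
    {α β t : ℝ} (h : t ∈ Icc α β) : AffineMap.lineMap x y ((t - α) / (β - α)) ∈ S := by
  apply hS.segment_subset hx hy
  rw [segment_eq_image_lineMap]
  exact ⟨_, ⟨div_nonneg (by linarith [h.1]) (by linarith [h.1, h.2]),
    div_le_one_of_le₀ (by linarith [h.2]) (by linarith [h.1, h.2])⟩, rfl⟩

theorem continuous_lineMap_div (x y : E) (α β : ℝ) :
    Continuous fun t : ℝ => AffineMap.lineMap (k := ℝ) x y ((t - α) / (β - α)) := by
  simp only [AffineMap.lineMap_apply, vsub_eq_sub, vadd_eq_add]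
  fun_prop

/-- If N has points just to the right of t₀, then up to such a point ψ takes values and convex
combinations of values of φ close to φ t₀, and balls are convex. Otherwise t₀ is the left end of a
gap, on which ψ is affine. -/
theorem IsChordal.continuousWithinAt_right (h : IsChordal N φ ψ) (hN : IsClosed N) {a b : ℝ}
    (hb : b ∈ N) (hφ : ContinuousOn φ (Icc a b)) {t₀ : ℝ} (ht₀ : t₀ ∈ N)
    (hat : a ≤ t₀) (htb : t₀ ≤ b) : ContinuousWithinAt ψ (Icc t₀ b) t₀ := by
  rcases eq_or_lt_of_le htb with rfl | htb'
  · rw [Icc_self]; exact continuousWithinAt_singleton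
  rw [Metric.continuousWithinAt_iff]
  intro ε hε
  obtain ⟨δ, hδ, hφδ⟩ := Metric.continuousWithinAt_iff.1 (hφ t₀ ⟨hat, htb⟩) ε hε
  by_cases hex : ∃ t₁ ∈ N, t₀ < t₁ ∧ t₁ < t₀ + δ ∧ t₁ ≤ b
  · obtain ⟨t₁, ht₁N, h01, h1δ, h1b⟩ := hex
    refine ⟨t₁ - t₀, by linarith, fun t ht htd => ?_⟩
    rw [h.eq_on _ ht₀]
    have hnear : ∀ s, t₀ ≤ s → s ≤ t₁ → dist (φ s) (φ t₀) < ε := fun s h1 h2 =>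
      hφδ ⟨hat.trans h1, h2.trans h1b⟩ (by rw [Real.dist_eq, abs_lt]; constructor <;> linarith)
    have htt : t ≤ t₁ := by rw [Real.dist_eq, abs_lt] at htd; linarith [htd.2]
    by_cases htN : t ∈ N
    · rw [h.eq_on _ htN]; exact hnear t ht.1 htt
    · obtain ⟨α, hα, β, hβ, h1, h2, h3, h4, h5⟩ := exists_gap hN ht₀ ht₁N ht.1 htt htN
      rw [h.gap α hα β hβ (h1.trans h2) h5 t ⟨h1.le, h2.le⟩]
      exact lineMap_mem_of_mem_Icc (convex_ball (φ t₀) ε)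
        (hnear α h3 (by linarith)) (hnear β (by linarith) h4) ⟨h1.le, h2.le⟩
  · push Not at hex
    have hdb : t₀ + δ ≤ b := by
      by_contra hcon
      exact absurd (hex b hb htb' (not_le.1 hcon)) (lt_irrefl b)
    have hno : t₀ + δ / 2 ∉ N := fun hm => by
      have := hex _ hm (by linarith) (by linarith); linarith
    obtain ⟨α, hα, β, hβ, h1, h2, h3, h4, h5⟩ :=
      exists_gap hN ht₀ hb (t := t₀ + δ / 2) (by linarith) (by linarith) hno
    obtain rfl : t₀ = α := by
      by_contra hne
      have := hex α hα (lt_of_le_of_ne h3 hne) (by linarith)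
      linarith
    have hc : ContinuousWithinAt ψ (Icc t₀ β) t₀ := by
      refine (continuous_lineMap_div (φ t₀) (φ β) t₀ β).continuousWithinAt.congr
        (fun s hs => h.gap t₀ hα β hβ (by linarith) h5 s hs)
        (h.gap t₀ hα β hβ (by linarith) h5 t₀ ⟨le_rfl, by linarith⟩)
    obtain ⟨δ', hδ', hcδ⟩ := Metric.continuousWithinAt_iff.1 hc ε hε
    refine ⟨min δ' (β - t₀), lt_min hδ' (by linarith), fun t ht htd => ?_⟩
    refine hcδ ⟨ht.1, ?_⟩ (lt_of_lt_of_le htd (min_le_left _ _))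
    have := lt_of_lt_of_le htd (min_le_right _ _)
    rw [Real.dist_eq, abs_lt] at this
    linarith [this.2]

theorem IsChordal.continuousOn (h : IsChordal N φ ψ) (hN : IsClosed N) {a b : ℝ}
    (ha : a ∈ N) (hb : b ∈ N) (hφ : ContinuousOn φ (Icc a b)) : ContinuousOn ψ (Icc a b) := by
  intro t ht
  by_cases htN : t ∈ N
  · have hr := h.continuousWithinAt_right hN hb hφ htN ht.1 ht.2
    -- Left continuity is right continuity of the reflected curve.
    have hl := h.comp_neg.continuousWithinAt_right (hN.preimage continuous_neg) (a := -b) (b := -a)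
      (by simpa using ha) (hφ.comp (by fun_prop) fun s hs =>
        ⟨by linarith [hs.2], by linarith [hs.1]⟩) (t₀ := -t) (by simpa using htN)
        (by linarith [ht.2]) (by linarith [ht.1])
    have hl' : ContinuousWithinAt ψ (Icc a t) t := by
      have hl2 : ContinuousWithinAt (fun s => ψ (-s)) (Icc (-t) (-a)) (-t) := hl
      have := ContinuousWithinAt.comp (f := fun s : ℝ => -s) (g := fun s => ψ (-s)) (x := t)
        (s := Icc a t) (t := Icc (-t) (-a)) hl2 (by fun_prop)
        (fun s hs => ⟨by simp [hs.2], by simp [hs.1]⟩)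
      simpa [Function.comp_def] using this
    have := hl'.union hr
    rwa [Icc_union_Icc_eq_Icc ht.1 ht.2] at this
  · obtain ⟨α, hα, β, hβ, h1, h2, h3, h4, h5⟩ := exists_gap hN ha hb ht.1 ht.2 htN
    refine ContinuousAt.continuousWithinAt ?_
    refine (continuous_lineMap_div (φ α) (φ β) α β).continuousAt.congr ?_
    filter_upwards [Ioo_mem_nhds h1 h2] with s hs
    exact (h.gap α hα β hβ (h1.trans h2) h5 s ⟨hs.1.le, hs.2.le⟩).symm

end Chordal

/-- Replacing the excursions of an injective curve into pairwise disjoint round sets by chords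
keeps it continuous and injective. -/
theorem exists_straightening {ι : Type*} {C : ι → Set Plane} (hC : ∀ i, IsRound (C i))
    (hd : Pairwise (Function.onFun Disjoint C)) {φ : ℝ → Plane} {a b : ℝ} (hab : a ≤ b)
    (hφ : ContinuousOn φ (Icc a b)) (hinj : InjOn φ (Icc a b))
    (ha : φ a ∉ ⋃ i, C i) (hb : φ b ∉ ⋃ i, C i) :
    ∃ ψ : ℝ → Plane, ContinuousOn ψ (Icc a b) ∧ InjOn ψ (Icc a b) ∧
      IsChordal {t ∈ Icc a b | φ t ∉ ⋃ i, C i} φ ψ ∧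
      IsClosed {t ∈ Icc a b | φ t ∉ ⋃ i, C i} := by
  set U := ⋃ i, C i with hU
  have hUo : IsOpen U := isOpen_iUnion fun i => (hC i).isOpen
  set N := {t ∈ Icc a b | φ t ∉ U} with hNdef
  have hN : IsClosed N := hφ.preimage_isClosed_of_isClosed isClosed_Icc hUo.isClosed_compl
  have haN : a ∈ N := ⟨left_mem_Icc.2 hab, ha⟩
  have hbN : b ∈ N := ⟨right_mem_Icc.2 hab, hb⟩
  obtain ⟨ψ, hψ⟩ := exists_isChordal N φ
  refine ⟨ψ, hψ.continuousOn hN haN hbN hφ, ?_, hψ, hN⟩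
  -- description of a gap
  have gapdesc : ∀ t ∈ Icc a b, t ∉ N → ∃ α ∈ N, ∃ β ∈ N, α < t ∧ t < β ∧
      (∀ s ∈ Ioo α β, s ∉ N) ∧ ∃ i, (∀ s ∈ Icc α β, φ s ∈ closure (C i)) ∧
        (∀ s ∈ Ioo α β, ψ s ∈ openSegment ℝ (φ α) (φ β)) ∧
        openSegment ℝ (φ α) (φ β) ⊆ C i := by
    intro t ht htN
    obtain ⟨α, hα, β, hβ, h1, h2, h3, h4, h5⟩ := exists_gap hN haN hbN ht.1 ht.2 htN
    have hsub : Icc α β ⊆ Icc a b := Icc_subset_Icc hα.1.1 hβ.1.2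
    obtain ⟨i, hcl⟩ := exists_forall_mem_closure (fun i => (hC i).isOpen) hd (h1.trans h2)
      (hφ.mono hsub) fun s hs => by
        by_contra hcon
        exact h5 s hs ⟨hsub (Ioo_subset_Icc_self hs), hcon⟩
    have hne : φ α ≠ φ β := fun h => (h1.trans h2).ne (hinj hα.1 hβ.1 h)
    refine ⟨α, hα, β, hβ, h1, h2, h5, i, hcl, ?_, ?_⟩
    · intro s hs
      rw [hψ.gap α hα β hβ (h1.trans h2) h5 s (Ioo_subset_Icc_self hs),
        openSegment_eq_image_lineMap]
      refine ⟨_, ⟨div_pos (by linarith [hs.1]) (by linarith [hs.1, hs.2]), ?_⟩, rfl⟩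
      rw [div_lt_one (by linarith [hs.1, hs.2])]
      linarith [hs.2]
    · exact (hC i).openSegment_subset (hcl α ⟨le_rfl, (h1.trans h2).le⟩)
        (hcl β ⟨(h1.trans h2).le, le_rfl⟩) hne
  -- On N the curve avoids every C i, whereas the chord of a gap runs inside one of them.
  have mixed : ∀ s ∈ N, ∀ t ∈ Icc a b, t ∉ N → ψ s ≠ ψ t := by
    intro s hs t ht htN h
    obtain ⟨α, hα, β, hβ, h1, h2, h5, i, hcl, hseg, hsub⟩ := gapdesc t ht htN
    rw [hψ.eq_on s hs] at h
    exact hs.2 (h ▸ mem_iUnion.2 ⟨i, hsub (hseg t ⟨h1, h2⟩)⟩)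
  intro s hs t ht hst
  by_cases hsN : s ∈ N
  · by_cases htN : t ∈ N
    · rw [hψ.eq_on s hsN, hψ.eq_on t htN] at hst
      exact hinj hs ht hst
    · exact (mixed s hsN t ht htN hst).elim
  by_cases htN : t ∈ N
  · exact (mixed t htN s hs hsN hst.symm).elim
  obtain ⟨α, hα, β, hβ, h1, h2, h5, i, hcl, hseg, hsub⟩ := gapdesc s hs hsN
  obtain ⟨α', hα', β', hβ', h1', h2', h5', j, hcl', hseg', hsub'⟩ := gapdesc t ht htN
  have hne : φ α ≠ φ β := fun h => (h1.trans h2).ne (hinj hα.1 hβ.1 h)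
  have hne' : φ α' ≠ φ β' := fun h => (h1'.trans h2').ne (hinj hα'.1 hβ'.1 h)
  have hnotmem : ∀ x ∈ N, ∀ k, φ x ∉ C k := fun x hx k hk => hx.2 (mem_iUnion.2 ⟨k, hk⟩)
  -- two gaps are equal or ordered
  have horder : (α = α' ∧ β = β') ∨ β ≤ α' ∨ β' ≤ α := by
    by_contra! hcon
    obtain ⟨hc1, hc2, hc3⟩ := hcon
    have e1 : α = α' := by
      rcases lt_trichotomy α α' with h | h | h
      · exact (h5 α' ⟨h, hc2⟩ hα').elim
      · exact h
      · exact (h5' α ⟨h, hc3⟩ hα).elim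
    apply hc1 e1
    rcases lt_trichotomy β β' with h | h | h
    · exact (h5' β ⟨by linarith, h⟩ hβ).elim
    · exact h
    · exact (h5 β' ⟨by linarith, h⟩ hβ').elim
  have hij : i = j := by
    by_contra hij
    exact Set.disjoint_left.1 (hd hij) (hsub (hseg s ⟨h1, h2⟩))
      (hst ▸ hsub' (hseg' t ⟨h1', h2'⟩))
  subst hij
  -- the chords of two different gaps do not meet
  have hdisj : ∀ α ∈ N, ∀ β ∈ N, ∀ α' ∈ N, ∀ β' ∈ N, α < β → α' < β' → β ≤ α' →
      (∀ s ∈ Icc α β, φ s ∈ closure (C i)) → (∀ s ∈ Icc α' β', φ s ∈ closure (C i)) →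
      Disjoint (openSegment ℝ (φ α) (φ β)) (openSegment ℝ (φ α') (φ β')) := by
    intro α hα β hβ α' hα' β' hβ' h1 h2 h3 hcl hcl'
    have m : ∀ x ∈ N, ∀ y ∈ N, x < y → φ x ≠ φ y := fun x hx y hy hxy h =>
      hxy.ne (hinj hx.1 hy.1 h)
    -- Adjacent gaps share the vertex φ β, so their arcs are not disjoint and
    -- `IsRound.disjoint_chords` does not apply. But two chords from a common endpoint whose
    -- interiors meet are parallel, against `IsRound.not_parallel`.
    rcases eq_or_lt_of_le h3 with rfl | h3
    · rw [Set.disjoint_left]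
      intro z hz hz'
      have hp := (hC i).not_parallel (z := z) ⟨hcl α ⟨le_rfl, h1.le⟩, hnotmem α hα i⟩
        ⟨hcl β ⟨h1.le, le_rfl⟩, hnotmem β hβ i⟩ ⟨hcl β ⟨h1.le, le_rfl⟩, hnotmem β hβ i⟩
        ⟨hcl' β' ⟨h2.le, le_rfl⟩, hnotmem β' hβ' i⟩ (m _ hα _ hβ h1) (m _ hβ _ hβ' h2)
        (m _ hα _ hβ h1) (m _ hα _ hβ' (h1.trans h2)) hz hz'
      obtain ⟨p, q, hp0, hq0, hpq, hz1⟩ := hz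
      obtain ⟨p', q', hp0', hq0', hpq', hz2⟩ := hz'
      obtain rfl : q = 1 - p := by linarith
      obtain rfl : p' = 1 - q' := by linarith
      apply hp (-(p / q'))
      have hq : q' • (φ β' - φ β) = (-p) • (φ β - φ α) := by
        have : p • φ α + (1 - p) • φ β = (1 - q') • φ β + q' • φ β' := hz1.trans hz2.symm
        calc q' • (φ β' - φ β) = ((1 - q') • φ β + q' • φ β') - φ β := by module
          _ = _ := by rw [← this]; module
      calc φ β' - φ β = q'⁻¹ • (q' • (φ β' - φ β)) := by
            rw [smul_smul, inv_mul_cancel₀ hq0'.ne', one_smul]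
        _ = _ := by rw [hq, smul_smul]; congr 1; field_simp
    · have hs1 : Icc α β ⊆ Icc a b := Icc_subset_Icc hα.1.1 hβ.1.2
      have hs2 : Icc α' β' ⊆ Icc a b := Icc_subset_Icc hα'.1.1 hβ'.1.2
      refine (hC i).disjoint_chords h1 h2 (hφ.mono hs1) (hφ.mono hs2) hcl hcl'
        (hnotmem α hα i) (hnotmem β hβ i) (hnotmem α' hα' i) (hnotmem β' hβ' i)
        (m _ hα _ hβ h1) (m _ hα' _ hβ' h2) ?_
      intro x hx y hy hxy
      have := hinj (hs1 hx) (hs2 hy) hxy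
      linarith [hx.2, hy.1]
  have hs' := hseg s ⟨h1, h2⟩
  have ht' := hseg' t ⟨h1', h2'⟩
  rw [hst] at hs'
  rcases horder with ⟨rfl, rfl⟩ | h | h
  · rw [hψ.gap α hα β hβ (h1.trans h2) h5 s ⟨h1.le, h2.le⟩,
      hψ.gap α hα β hβ (h1.trans h2) h5 t ⟨h1'.le, h2'.le⟩] at hst
    have := AffineMap.lineMap_injective ℝ hne hst
    have hd : β - α ≠ 0 := by linarith
    field_simp at this
    linarith
  · exact (Set.disjoint_left.1 (hdisj α hα β hβ α' hα' β' hβ' (h1.trans h2) (h1'.trans h2') h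
      hcl hcl') hs' ht').elim
  · exact (Set.disjoint_left.1 (hdisj α' hα' β' hβ' α hα β hβ (h1'.trans h2') (h1.trans h2) h
      hcl' hcl) ht' hs').elim

end PlanarRod

/-! ### Round cells and polygonal models -/

namespace PlanarRod

theorem isRound_ball (x : Plane) {r : ℝ} (hr : 0 < r) : IsRound (Metric.ball x r) where
  isOpen := Metric.isOpen_ball
  openSegment_subset a b ha hb hab := by
    have := (strictConvex_closedBall ℝ x r).openSegment_subset
      (Metric.closure_ball_subset_closedBall ha) (Metric.closure_ball_subset_closedBall hb) hab
    rwa [interior_closedBall x hr.ne'] at this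

theorem IsRound.inter {C D : Set Plane} (hC : IsRound C) (hD : IsRound D) : IsRound (C ∩ D) where
  isOpen := hC.isOpen.inter hD.isOpen
  openSegment_subset _ _ ha hb hab := subset_inter
    (hC.openSegment_subset (closure_mono inter_subset_left ha)
      (closure_mono inter_subset_left hb) hab)
    (hD.openSegment_subset (closure_mono inter_subset_right ha)
      (closure_mono inter_subset_right hb) hab)

theorem abs_coord_sub_le (x y : Plane) (i : Fin 2) : |x i - y i| ≤ dist x y := by
  rw [dist_eq_norm]
  exact PiLp.norm_apply_le (x - y) i

theorem mem_ball_iff_sq {x z : Plane} {r : ℝ} (hr : 0 < r) :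
    z ∈ Metric.ball x r ↔ (z 0 - x 0) ^ 2 + (z 1 - x 1) ^ 2 < r ^ 2 := by
  rw [Metric.mem_ball, EuclideanSpace.dist_eq, Real.sqrt_lt' hr, Fin.sum_univ_two,
    Real.dist_eq, Real.dist_eq, sq_abs, sq_abs]

/-- Disjoint round sets, one in each cell of the unit grid, nearly filling the cells. -/
theorem exists_cells {a b : ℝ} (hb : 0 < b) (hba : b < a) (ha : a < 1 / 2) :
    ∃ D : (Fin 2 → ℤ) → Set Plane, (∀ n, IsRound (D n)) ∧
      Pairwise (Function.onFun Disjoint D) ∧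
      (∀ (n : Fin 2 → ℤ) (z : Plane), (∀ i, |z i - ((n i : ℝ) + 1 / 2)| ≤ b) → z ∈ D n) ∧
      ∀ n, ∀ z ∈ D n, ∀ i, |z i - ((n i : ℝ) + 1 / 2)| < a := by
  -- Each cell is the intersection of four balls of radius R + a whose centres are the centre of the
  -- square shifted by R along the axes. They confine it to half-width a; the inequality says that R
  -- is large enough, hence the spheres flat enough, for the square of half-width b to fit inside.
  obtain ⟨R, hR0, hR⟩ : ∃ R : ℝ, 0 < R ∧ (R + b) ^ 2 + b ^ 2 < (R + a) ^ 2 := by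
    refine ⟨b ^ 2 / (a - b), by have := sub_pos.2 hba; positivity, ?_⟩
    have h1 : b ^ 2 / (a - b) * (a - b) = b ^ 2 := div_mul_cancel₀ _ (sub_pos.2 hba).ne'
    nlinarith
  have hRa : 0 < R + a := by linarith
  let D : (Fin 2 → ℤ) → Set Plane := fun n =>
    (Metric.ball !₂[(n 0 + 1 / 2 : ℝ) + R, n 1 + 1 / 2] (R + a) ∩
      Metric.ball !₂[(n 0 + 1 / 2 : ℝ) - R, n 1 + 1 / 2] (R + a)) ∩
    (Metric.ball !₂[(n 0 + 1 / 2 : ℝ), n 1 + 1 / 2 + R] (R + a) ∩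
      Metric.ball !₂[(n 0 + 1 / 2 : ℝ), n 1 + 1 / 2 - R] (R + a))
  have hD : ∀ n, ∀ z ∈ D n, ∀ i, |z i - ((n i : ℝ) + 1 / 2)| < a := by
    rintro n z ⟨⟨h1, h2⟩, h3, h4⟩
    rw [mem_ball_iff_sq hRa] at h1 h2 h3 h4
    simp only [Matrix.cons_val_zero, Matrix.cons_val_one] at h1 h2 h3 h4
    rw [Fin.forall_fin_two]
    constructor <;> rw [abs_lt] <;> constructor <;> by_contra! hcon <;> nlinarith
  refine ⟨D, fun n => ((isRound_ball _ hRa).inter (isRound_ball _ hRa)).inter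
    ((isRound_ball _ hRa).inter (isRound_ball _ hRa)), ?_, ?_, hD⟩
  · intro n m hnm
    rw [Function.onFun, Set.disjoint_left]
    intro z hz hz'
    apply hnm
    funext i
    have h1 := abs_lt.1 (hD n z hz i)
    have h2 := abs_lt.1 (hD m z hz' i)
    have h3 : (n i : ℝ) < m i + 1 := by linarith
    have h4 : (m i : ℝ) < n i + 1 := by linarith
    have h3' : n i < m i + 1 := by exact_mod_cast h3
    have h4' : m i < n i + 1 := by exact_mod_cast h4
    omega
  · intro n z hz
    have h0 := abs_le.1 (hz 0)
    have h1 := abs_le.1 (hz 1)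
    have q0 : (z 0 - (n 0 + 1 / 2)) ^ 2 ≤ b ^ 2 := by nlinarith
    have q1 : (z 1 - (n 1 + 1 / 2)) ^ 2 ≤ b ^ 2 := by nlinarith
    refine ⟨⟨?_, ?_⟩, ?_, ?_⟩ <;> rw [mem_ball_iff_sq hRa] <;>
      simp only [Matrix.cons_val_zero, Matrix.cons_val_one] <;> nlinarith

/-- An excursion of `φ` between consecutive points `α`, `β` of `N`, through a set of diameter
at most `2ρ` and along a segment, that leaves the cells `D` and contains a time of `T`. -/
structure IsCrossing (N : Set ℝ) (T : Finset ℝ) (U : Set Plane) (φ : ℝ → Plane) (ρ α β : ℝ) :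
    Prop where
  left_mem : α ∈ N
  right_mem : β ∈ N
  lt : α < β
  gap : ∀ s ∈ Ioo α β, s ∉ N
  affine : ∀ t ∈ Icc α β, φ t = AffineMap.lineMap (φ α) (φ β) ((t - α) / (β - α))
  dist_le : ∀ s ∈ Icc α β, ∀ t ∈ Icc α β, dist (φ s) (φ t) ≤ 2 * ρ
  exists_time : ∃ s ∈ T, s ∈ Ioo α β
  exists_outside : ∃ x y, α < x ∧ x < y ∧ y < β ∧ φ x ∉ U ∧ φ y ∉ U

theorem gap_eq_or_le {N : Set ℝ} {α β α' β' : ℝ} (hα : α ∈ N) (hβ : β ∈ N) (hα' : α' ∈ N)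
    (hβ' : β' ∈ N) (h₅ : ∀ s ∈ Ioo α β, s ∉ N)
    (h₅' : ∀ s ∈ Ioo α' β', s ∉ N) : (α = α' ∧ β = β') ∨ β ≤ α' ∨ β' ≤ α := by
  by_contra! hcon
  obtain ⟨hc1, hc2, hc3⟩ := hcon
  have e1 : α = α' := by
    rcases lt_trichotomy α α' with h | h | h
    · exact (h₅ α' ⟨h, hc2⟩ hα').elim
    · exact h
    · exact (h₅' α ⟨h, hc3⟩ hα).elim
  apply hc1 e1
  rcases lt_trichotomy β β' with h | h | h
  · exact (h₅' β ⟨by linarith, h⟩ hβ).elim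
  · exact h
  · exact (h₅ β' ⟨by linarith, h⟩ hβ').elim

theorem exists_enum (T : Finset ℝ) (hT : T.Nonempty) : ∃ (m : ℕ) (σ : ℕ → ℝ),
    (∀ k ≤ m, σ k ∈ T) ∧ (∀ k < m, σ k < σ (k + 1)) ∧ ∀ s ∈ T, ∃ k ≤ m, σ k = s := by
  obtain ⟨m, hm⟩ : ∃ m, T.card = m + 1 := ⟨T.card - 1, by have := hT.card_pos; omega⟩
  let e := T.orderEmbOfFin hm
  refine ⟨m, fun k => e (Fin.ofNat (m + 1) k), fun k _ => T.orderEmbOfFin_mem hm _, ?_, ?_⟩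
  · intro k hk
    apply e.strictMono
    rw [Fin.lt_def, Fin.val_ofNat, Fin.val_ofNat, Nat.mod_eq_of_lt (by omega),
      Nat.mod_eq_of_lt (by omega)]
    omega
  · intro s hs
    have : s ∈ Set.range e := by rw [T.range_orderEmbOfFin hm]; exact hs
    obtain ⟨i, hi⟩ := this
    exact ⟨i, by omega, by rw [← hi]; exact congrArg e (Fin.ext (by simp))⟩

/-- A simple polygonal line with `2 (m + 1)` vertices `χ (l k), χ (r k)`, `k ≤ m`, the vertices
number `k` being `ρ`-close to `w (σ k)`, while `w` oscillates by at most `η` between consecutive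
times `σ k`. -/
structure PolygonalModel (w : ℝ → Plane) (T : Finset ℝ) (ρ η : ℝ) where
  m : ℕ
  σ : ℕ → ℝ
  l : ℕ → ℝ
  r : ℕ → ℝ
  χ : ℝ → Plane
  mem : ∀ k ≤ m, σ k ∈ T
  lt : ∀ k < m, σ k < σ (k + 1)
  l_lt : ∀ k ≤ m, l k < r k
  r_lt : ∀ k < m, r k < l (k + 1)
  inj : InjOn χ (Icc (l 0) (r m))
  affine_l : ∀ k ≤ m, ∀ t ∈ Icc (l k) (r k),
    χ t = AffineMap.lineMap (χ (l k)) (χ (r k)) ((t - l k) / (r k - l k))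
  affine_r : ∀ k < m, ∀ t ∈ Icc (r k) (l (k + 1)),
    χ t = AffineMap.lineMap (χ (r k)) (χ (l (k + 1))) ((t - r k) / (l (k + 1) - r k))
  near_l : ∀ k ≤ m, dist (χ (l k)) (w (σ k)) ≤ ρ
  near_r : ∀ k ≤ m, dist (χ (r k)) (w (σ k)) ≤ ρ
  osc : ∀ k < m, ∀ s ∈ Icc (σ k) (σ (k + 1)), ∀ t ∈ Icc (σ k) (σ (k + 1)), dist (w s) (w t) ≤ η
  osc_left : ∀ s ∈ Icc 0 (σ 0), ∀ t ∈ Icc 0 (σ 0), dist (w s) (w t) ≤ η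
  osc_right : ∀ s ∈ Icc (σ m) 1, ∀ t ∈ Icc (σ m) 1, dist (w s) (w t) ≤ η

theorem lineMap_div_lineMap_div {E : Type*} [NormedAddCommGroup E] [NormedSpace ℝ E] (x y : E)
    {α β p q t : ℝ} (hαβ : α < β) (hpq : p < q) :
    AffineMap.lineMap (k := ℝ) (AffineMap.lineMap (k := ℝ) x y ((p - α) / (β - α)))
      (AffineMap.lineMap x y ((q - α) / (β - α))) ((t - p) / (q - p)) =
    AffineMap.lineMap (k := ℝ) x y ((t - α) / (β - α)) := by
  have h1 : β - α ≠ 0 := by linarith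
  have h2 : q - p ≠ 0 := by linarith
  have h3 : (t - α) / (β - α) = (p - α) / (β - α) +
      (t - p) / (q - p) * ((q - α) / (β - α) - (p - α) / (β - α)) := by
    field_simp; ring
  rw [h3]
  simp only [AffineMap.lineMap_apply, vsub_eq_sub, vadd_eq_add]
  module

/-- Each selected crossing contributes a short side, from its first to its last exit from the cells;
φ is affine there, so straightening leaves it alone. From the last exit of one crossing to the first
exit of the next, φ stays in the closure of a single cell and becomes one chord, and w oscillates
little because cells are small. Without any crossing, w stays near one cell, which is the first
alternative. -/
theorem exists_polygonalModel {ι : Type*} {D : ι → Set Plane} (hD : ∀ i, IsRound (D i))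
    (hd : Pairwise (Function.onFun Disjoint D)) (hdiam : ∀ i, ∀ x ∈ D i, ∀ y ∈ D i,
      dist x y ≤ 3 / 2) {φ w : ℝ → Plane} (hφ : ContinuousOn φ (Icc 0 1))
    (hinj : InjOn φ (Icc 0 1)) {N : Set ℝ} (hN : N ⊆ Icc 0 1)
    (hND : ∀ t ∈ N, φ t ∈ ⋃ i, D i) {T : Finset ℝ} {ρ : ℝ} (hρ0 : 0 < ρ) (hρ : ρ ≤ 1 / 16)
    (hw : ∀ t ∈ Icc (0 : ℝ) 1, dist (φ t) (w t) ≤ 3 * ρ)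
    (hE : ∀ t ∈ Icc (0 : ℝ) 1, φ t ∉ ⋃ i, D i → ∃ α β, t ∈ Ioo α β ∧
      IsCrossing N T (⋃ i, D i) φ ρ α β) :
    (∀ s ∈ Icc (0 : ℝ) 1, ∀ t ∈ Icc (0 : ℝ) 1, dist (w s) (w t) ≤ 4) ∨
      Nonempty (PolygonalModel w T (5 * ρ) 4) := by
  classical
  set U := ⋃ i, D i with hU
  have hUo : IsOpen U := isOpen_iUnion fun i => (hD i).isOpen
  -- `φ` stays in a single cell between two consecutive exits
  have stay : ∀ p q, 0 ≤ p → p < q → q ≤ 1 → (∀ t ∈ Ioo p q, φ t ∈ U) →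
      ∀ s ∈ Icc p q, ∀ t ∈ Icc p q, dist (φ s) (φ t) ≤ 3 / 2 := by
    intro p q hp hpq hq hsub
    have hsI : Icc p q ⊆ Icc 0 1 := Icc_subset_Icc hp hq
    obtain ⟨i, hcl⟩ := exists_forall_mem_closure (fun i => (hD i).isOpen) hd hpq (hφ.mono hsI) hsub
    intro s hs t ht
    have hb : Metric.diam (D i) ≤ 3 / 2 :=
      Metric.diam_le_of_forall_dist_le (by norm_num) (hdiam i)
    have hbd : Bornology.IsBounded (D i) := Metric.isBounded_iff.2 ⟨3 / 2, fun x hx y hy =>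
      hdiam i x hx y hy⟩
    rw [← Metric.diam_closure] at hb
    exact (Metric.dist_le_diam_of_mem hbd.closure (hcl s hs) (hcl t ht)).trans hb
  -- Several times of T may lie in one gap; keeping the first selects a single time per crossing.
  let Q : ℝ → Prop := fun s => ∃ α β, s ∈ Ioo α β ∧ IsCrossing N T U φ ρ α β ∧
    ∀ s' ∈ T, s' ∈ Ioo α β → s ≤ s'
  set T' := T.filter Q with hT'
  have hEQ : ∀ t ∈ Icc (0 : ℝ) 1, φ t ∉ U → ∃ s ∈ T', ∃ α β, s ∈ Ioo α β ∧ t ∈ Ioo α β ∧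
      IsCrossing N T U φ ρ α β := by
    intro t ht htU
    obtain ⟨α, β, htαβ, hc⟩ := hE t ht htU
    have hne : (T.filter (· ∈ Ioo α β)).Nonempty := by
      obtain ⟨s, hs, hs'⟩ := hc.exists_time
      exact ⟨s, Finset.mem_filter.2 ⟨hs, hs'⟩⟩
    have hmin := Finset.min'_mem _ hne
    rw [Finset.mem_filter] at hmin
    refine ⟨_, Finset.mem_filter.2 ⟨hmin.1, α, β, hmin.2, hc, fun s' hs' hs'' => ?_⟩, α, β,
      hmin.2, htαβ, hc⟩
    exact Finset.min'_le _ _ (Finset.mem_filter.2 ⟨hs', hs''⟩)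
  rcases T'.eq_empty_or_nonempty with hemp | hne
  · left
    have hall : ∀ t ∈ Ioo (0 : ℝ) 1, φ t ∈ U := by
      intro t ht
      by_contra hcon
      obtain ⟨s, hs, -⟩ := hEQ t (Ioo_subset_Icc_self ht) hcon
      rw [hemp] at hs
      exact absurd hs (Finset.notMem_empty s)
    intro s hs t ht
    have := stay 0 1 le_rfl one_pos le_rfl hall s hs t ht
    have a1 := hw s hs
    have a2 := hw t ht
    have := dist_triangle4 (w s) (φ s) (φ t) (w t)
    rw [dist_comm (w s) (φ s)] at this
    linarith
  right
  obtain ⟨m, σ, hσT, hσlt, hσsurj⟩ := exists_enum T' hne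
  have hσT' : ∀ k ≤ m, Q (σ k) := fun k hk => (Finset.mem_filter.1 (hσT k hk)).2
  choose! α β hαβ hcr hmin using hσT'
  have hαN := fun k hk => (hcr k hk).left_mem
  have hβN := fun k hk => (hcr k hk).right_mem
  have hσ01 : ∀ k ≤ m, σ k ∈ Icc (0 : ℝ) 1 := fun k hk =>
    ⟨(hN (hαN k hk)).1.trans (hαβ k hk).1.le, (hαβ k hk).2.le.trans (hN (hβN k hk)).2⟩
  have hsucc : ∀ k < m, β k ≤ α (k + 1) := by
    intro k hk
    have c1 := hcr k hk.le
    have c2 := hcr (k + 1) hk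
    have s1 := hαβ k hk.le
    have s2 := hαβ (k + 1) hk
    have hlt := hσlt k hk
    rcases gap_eq_or_le c1.left_mem c1.right_mem c2.left_mem c2.right_mem c1.gap
      c2.gap with ⟨e1, e2⟩ | h | h
    · have := hmin (k + 1) hk (σ k) (Finset.mem_filter.1 (hσT k hk.le)).1
        (by rw [← e1, ← e2]; exact s1)
      linarith
    · exact h
    · linarith [s1.1, s2.2]
  have hαβI : ∀ k ≤ m, Icc (α k) (β k) ⊆ Icc 0 1 := fun k hk =>
    Icc_subset_Icc (hN (hαN k hk)).1 (hN (hβN k hk)).2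
  let F : ℕ → Set ℝ := fun k => {t ∈ Icc (α k) (β k) | φ t ∉ U}
  have hFc : ∀ k ≤ m, IsCompact (F k) := fun k hk =>
    isCompact_Icc.of_isClosed_subset ((hφ.mono (hαβI k hk)).preimage_isClosed_of_isClosed
      isClosed_Icc hUo.isClosed_compl) fun t ht => ht.1
  have hFne : ∀ k ≤ m, (F k).Nonempty := by
    intro k hk
    obtain ⟨x, y, h1, h2, h3, h4, h5⟩ := (hcr k hk).exists_outside
    exact ⟨x, ⟨h1.le, by linarith⟩, h4⟩
  let l : ℕ → ℝ := fun k => sInf (F k)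
  let r : ℕ → ℝ := fun k => sSup (F k)
  have hl : ∀ k ≤ m, l k ∈ F k := fun k hk => (hFc k hk).sInf_mem (hFne k hk)
  have hr : ∀ k ≤ m, r k ∈ F k := fun k hk => (hFc k hk).sSup_mem (hFne k hk)
  have hle_l : ∀ k ≤ m, ∀ t ∈ F k, l k ≤ t := fun k hk t ht => csInf_le (hFc k hk).bddBelow ht
  have hle_r : ∀ k ≤ m, ∀ t ∈ F k, t ≤ r k := fun k hk t ht => le_csSup (hFc k hk).bddAbove ht
  have hlr : ∀ k ≤ m, l k < r k := by
    intro k hk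
    obtain ⟨x, y, h1, h2, h3, h4, h5⟩ := (hcr k hk).exists_outside
    have := hle_l k hk x ⟨⟨h1.le, by linarith⟩, h4⟩
    have := hle_r k hk y ⟨⟨by linarith, h3.le⟩, h5⟩
    linarith
  -- The ends of a gap belong to N and so are mapped into the cells. Exits are therefore strictly
  -- inside the gap, which separates r k from l (k + 1) even when two gaps are adjacent.
  have hαl : ∀ k ≤ m, α k < l k := fun k hk => lt_of_le_of_ne (hl k hk).1.1 fun h =>
    (hl k hk).2 (h ▸ hND _ (hαN k hk))
  have hrβ : ∀ k ≤ m, r k < β k := fun k hk => lt_of_le_of_ne (hr k hk).1.2 fun h =>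
    (hr k hk).2 (h ▸ hND _ (hβN k hk))
  have hrl : ∀ k < m, r k < l (k + 1) := fun k hk =>
    (hrβ k hk.le).trans_le ((hsucc k hk).trans (hαl (k + 1) hk).le)
  -- every exit lies in one of the intervals `[l k, r k]`
  have hcover : ∀ t ∈ Icc (0 : ℝ) 1, φ t ∉ U → ∃ k ≤ m, t ∈ Icc (l k) (r k) := by
    intro t ht htU
    obtain ⟨s, hs, a, b, hsab, htab, hc⟩ := hEQ t ht htU
    obtain ⟨k, hk, rfl⟩ := hσsurj s hs
    have c1 := hcr k hk
    have hs' := hαβ k hk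
    rcases gap_eq_or_le c1.left_mem c1.right_mem hc.left_mem hc.right_mem c1.gap
      hc.gap with ⟨rfl, rfl⟩ | h | h
    · have : t ∈ F k := ⟨Ioo_subset_Icc_self htab, htU⟩
      exact ⟨k, hk, hle_l k hk t this, hle_r k hk t this⟩
    · linarith [hs'.2, hsab.1]
    · linarith [hs'.1, hsab.2]
  have hlmono : ∀ j k, j ≤ k → k ≤ m → l j ≤ l k := by
    intro j k hjk
    induction k, hjk using Nat.le_induction with
    | base => intro; exact le_rfl
    | succ k hjk ih => intro hk; linarith [ih (by omega), hrl k hk, hlr k (by omega)]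
  have hrmono : ∀ j k, j ≤ k → k ≤ m → r j ≤ r k := by
    intro j k hjk
    induction k, hjk using Nat.le_induction with
    | base => intro; exact le_rfl
    | succ k hjk ih => intro hk; linarith [ih (by omega), hrl k hk, hlr (k + 1) hk]
  have hl0 : ∀ k ≤ m, 0 ≤ l k := fun k hk => (hαβI k hk (hl k hk).1).1
  have hr1 : ∀ k ≤ m, r k ≤ 1 := fun k hk => (hαβI k hk (hr k hk).1).2
  -- no exits between `r k` and `l (k + 1)`
  have hbetween : ∀ k < m, ∀ t ∈ Ioo (r k) (l (k + 1)), φ t ∈ U := by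
    intro k hk t ht
    by_contra hcon
    obtain ⟨j, hj, htj⟩ := hcover t ⟨by linarith [hl0 k hk.le, hlr k hk.le, ht.1],
      by linarith [hr1 (k + 1) hk, hlr (k + 1) hk, ht.2]⟩ hcon
    rcases Nat.lt_or_ge k j with h | h
    · linarith [hlmono (k + 1) j h hj, htj.1, ht.2]
    · linarith [hrmono j k h hk.le, htj.2, ht.1]
  have hbefore : ∀ t ∈ Ioo 0 (l 0), φ t ∈ U := by
    intro t ht
    by_contra hcon
    obtain ⟨j, hj, htj⟩ := hcover t ⟨ht.1.le, by
      linarith [hr1 0 (Nat.zero_le m), hlr 0 (Nat.zero_le m), ht.2]⟩ hcon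
    linarith [hlmono 0 j (Nat.zero_le j) hj, htj.1, ht.2]
  have hafter : ∀ t ∈ Ioo (r m) 1, φ t ∈ U := by
    intro t ht
    by_contra hcon
    obtain ⟨j, hj, htj⟩ := hcover t ⟨by linarith [hl0 m le_rfl, hlr m le_rfl, ht.1], ht.2.le⟩ hcon
    linarith [hrmono j m hj le_rfl, htj.2, ht.1]
  have hl0pos : 0 < l 0 := lt_of_le_of_lt (hN (hαN 0 (Nat.zero_le m))).1 (hαl 0 (Nat.zero_le m))
  have hrm1 : r m < 1 := (hrβ m le_rfl).trans_le (hN (hβN m le_rfl)).2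
  have hl0rm : l 0 ≤ r m := by linarith [hlmono 0 m (Nat.zero_le m) le_rfl, hlr m le_rfl]
  have hsubI : Icc (l 0) (r m) ⊆ Icc 0 1 := Icc_subset_Icc hl0pos.le hrm1.le
  obtain ⟨χ, hχc, hχi, hχ, -⟩ := exists_straightening hD hd hl0rm (hφ.mono hsubI)
    (hinj.mono hsubI) (hl 0 (Nat.zero_le m)).2 (hr m le_rfl).2
  have hlI : ∀ k ≤ m, l k ∈ Icc (l 0) (r m) := fun k hk =>
    ⟨hlmono 0 k (Nat.zero_le k) hk, (hlr k hk).le.trans (hrmono k m hk le_rfl)⟩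
  have hrI : ∀ k ≤ m, r k ∈ Icc (l 0) (r m) := fun k hk =>
    ⟨(hlmono 0 k (Nat.zero_le k) hk).trans (hlr k hk).le, hrmono k m hk le_rfl⟩
  have hlN : ∀ k ≤ m, l k ∈ {t ∈ Icc (l 0) (r m) | φ t ∉ U} := fun k hk =>
    ⟨hlI k hk, (hl k hk).2⟩
  have hrN : ∀ k ≤ m, r k ∈ {t ∈ Icc (l 0) (r m) | φ t ∉ U} := fun k hk =>
    ⟨hrI k hk, (hr k hk).2⟩
  have hNcl : IsClosed {t ∈ Icc (l 0) (r m) | φ t ∉ U} :=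
    (hφ.mono hsubI).preimage_isClosed_of_isClosed isClosed_Icc hUo.isClosed_compl
  -- on `[l k, r k]` the new curve agrees with `φ`
  have hχφ : ∀ k ≤ m, ∀ t ∈ Icc (l k) (r k), χ t = φ t := by
    intro k hk t ht
    by_cases htU : φ t ∈ U
    · have htN : t ∉ {t ∈ Icc (l 0) (r m) | φ t ∉ U} := fun h => h.2 htU
      obtain ⟨a, ha, b, hb, g1, g2, g3, g4, g5⟩ :=
        exists_gap hNcl (hlN k hk) (hrN k hk) ht.1 ht.2 htN
      have hlk := (hl k hk).1
      have hrk := (hr k hk).1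
      have ca := (hcr k hk).affine a ⟨by linarith [hlk.1], by linarith [hrk.2]⟩
      have cb := (hcr k hk).affine b ⟨by linarith [hlk.1], by linarith [hrk.2]⟩
      have ct := (hcr k hk).affine t ⟨by linarith [hlk.1], by linarith [hrk.2]⟩
      rw [hχ.gap a ha b hb (g1.trans g2) g5 t ⟨g1.le, g2.le⟩, ca, cb, ct]
      exact lineMap_div_lineMap_div _ _ (hcr k hk).lt (g1.trans g2)
    · exact hχ.eq_on t ⟨⟨(hlI k hk).1.trans ht.1, ht.2.trans (hrI k hk).2⟩, htU⟩
  have hχl : ∀ k ≤ m, χ (l k) = φ (l k) := fun k hk => hχ.eq_on _ (hlN k hk)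
  have hχr : ∀ k ≤ m, χ (r k) = φ (r k) := fun k hk => hχ.eq_on _ (hrN k hk)
  -- distances
  have near : ∀ k ≤ m, ∀ t ∈ Icc (α k) (β k), ∀ s ∈ Icc (α k) (β k),
      dist (φ t) (w s) ≤ 5 * ρ := by
    intro k hk t ht s hs
    have a1 := (hcr k hk).dist_le t ht s hs
    have a2 := hw s (hαβI k hk hs)
    linarith [dist_triangle (φ t) (φ s) (w s)]
  -- On each stretch w stays within 3/2 + 5ρ ≤ 2 of one vertex (cell diameter plus errors), whence
  -- the oscillation bound 4.
  have pair : ∀ {c : Plane} {s t : ℝ}, dist c (w s) ≤ 2 → dist c (w t) ≤ 2 →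
      dist (w s) (w t) ≤ 4 := by
    intro c s t h1 h2
    linarith [dist_triangle_left (w s) (w t) c]
  refine ⟨⟨m, σ, l, r, χ, fun k hk => (Finset.mem_filter.1 (hσT k hk)).1, hσlt, hlr, hrl, hχi,
    ?_, ?_, ?_, ?_, ?_, ?_, ?_⟩⟩
  · intro k hk t ht
    have hlk := (hl k hk).1
    have hrk := (hr k hk).1
    rw [hχφ k hk t ht, hχl k hk, hχr k hk, (hcr k hk).affine _ hlk, (hcr k hk).affine _ hrk,
      (hcr k hk).affine t ⟨by linarith [hlk.1, ht.1], by linarith [hrk.2, ht.2]⟩]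
    exact (lineMap_div_lineMap_div _ _ (hcr k hk).lt (hlr k hk)).symm
  · intro k hk t ht
    rw [hχl (k + 1) hk, hχr k hk.le]
    exact hχ.gap _ (hrN k hk.le) _ (hlN (k + 1) hk) (hrl k hk)
      (fun s hs h => h.2 (hbetween k hk s hs)) t ht
  · intro k hk
    rw [hχl k hk]
    exact near k hk _ (hl k hk).1 _ (Ioo_subset_Icc_self (hαβ k hk))
  · intro k hk
    rw [hχr k hk]
    exact near k hk _ (hr k hk).1 _ (Ioo_subset_Icc_self (hαβ k hk))
  · intro k hk
    have hst := stay (r k) (l (k + 1)) (by linarith [hl0 k hk.le, hlr k hk.le]) (hrl k hk)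
      (by linarith [hr1 (k + 1) hk, hlr (k + 1) hk]) (hbetween k hk)
    have hc : ∀ t ∈ Icc (σ k) (σ (k + 1)), dist (φ (r k)) (w t) ≤ 2 := by
      intro t ht
      have b1 := (hαβ k hk.le).1
      have b2 := (hαβ (k + 1) hk).2
      rcases le_total t (r k) with h | h
      · linarith [near k hk.le (r k) (hr k hk.le).1 t ⟨by linarith [ht.1],
          by linarith [hrβ k hk.le]⟩]
      rcases le_total t (l (k + 1)) with h' | h'
      · have d1 := hst (r k) ⟨le_rfl, (hrl k hk).le⟩ t ⟨h, h'⟩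
        have d2 := hw t ⟨(hσ01 k hk.le).1.trans ht.1, ht.2.trans (hσ01 (k + 1) hk).2⟩
        linarith [dist_triangle (φ (r k)) (φ t) (w t)]
      · have d1 := hst (r k) ⟨le_rfl, (hrl k hk).le⟩ (l (k + 1)) ⟨(hrl k hk).le, le_rfl⟩
        have d2 := near (k + 1) hk (l (k + 1)) (hl (k + 1) hk).1 t
          ⟨by linarith [hαl (k + 1) hk], by linarith [ht.2]⟩
        linarith [dist_triangle (φ (r k)) (φ (l (k + 1))) (w t)]
    exact fun s hs t ht => pair (hc s hs) (hc t ht)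
  · have hm0 := Nat.zero_le m
    have hst := stay 0 (l 0) le_rfl hl0pos (by linarith) hbefore
    have hc : ∀ t ∈ Icc 0 (σ 0), dist (φ (l 0)) (w t) ≤ 2 := by
      intro t ht
      rcases le_total t (l 0) with h | h
      · have d1 := hst (l 0) ⟨hl0pos.le, le_rfl⟩ t ⟨ht.1, h⟩
        have d2 := hw t ⟨ht.1, ht.2.trans (hσ01 0 hm0).2⟩
        linarith [dist_triangle (φ (l 0)) (φ t) (w t)]
      · linarith [near 0 hm0 (l 0) (hl 0 hm0).1 t ⟨by linarith [hαl 0 hm0],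
          ht.2.trans (hαβ 0 hm0).2.le⟩]
    exact fun s hs t ht => pair (hc s hs) (hc t ht)
  · have hst := stay (r m) 1 (by linarith) hrm1 le_rfl hafter
    have hc : ∀ t ∈ Icc (σ m) 1, dist (φ (r m)) (w t) ≤ 2 := by
      intro t ht
      rcases le_total (r m) t with h | h
      · have d1 := hst (r m) ⟨le_rfl, hrm1.le⟩ t ⟨h, ht.2⟩
        have d2 := hw t ⟨(hσ01 m le_rfl).1.trans ht.1, ht.2⟩
        linarith [dist_triangle (φ (r m)) (φ t) (w t)]
      · linarith [near m le_rfl (r m) (hr m le_rfl).1 t ⟨(hαβ m le_rfl).1.le.trans ht.1,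
          by linarith [hrβ m le_rfl]⟩]
    exact fun s hs t ht => pair (hc s hs) (hc t ht)

end PlanarRod

/-! ### Straightening on the unit grid -/

namespace PlanarRod

/-- The number ρ serves as radius of balls around the finitely many points of w(T). It is chosen so
that 2ρ is below the distances between distinct points, from them to w 0 and w 1, and from their
non-integer coordinates to ℤ. Then m comes from compactness: away from the balls of half that
radius, w keeps a positive distance from the grid. -/
theorem exists_grid_constants {w : ℝ → Plane} (hw : ContinuousOn w (Icc 0 1)) {T : Finset ℝ}
    (h0 : (0 : ℝ) ∉ T) (h1 : (1 : ℝ) ∉ T)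
    (hT : ∀ t ∈ Icc (0 : ℝ) 1, t ∈ T ↔ ∃ i, ∃ k : ℤ, w t i = k) (hT' : ∀ t ∈ T, t ∈ Icc (0 : ℝ) 1)
    {ρ₀ : ℝ} (hρ₀ : 0 < ρ₀) :
    ∃ ρ m : ℝ, 0 < m ∧ m ≤ ρ ∧ ρ ≤ ρ₀ ∧
      (∀ s ∈ T, ∀ t ∈ T, w s ≠ w t → 2 * ρ ≤ dist (w s) (w t)) ∧
      (∀ s ∈ T, ∀ i, (∃ k : ℤ, w s i = k) ∨ ∀ k : ℤ, 2 * ρ ≤ |w s i - k|) ∧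
      (∀ s ∈ T, 2 * ρ ≤ dist (w 0) (w s) ∧ 2 * ρ ≤ dist (w 1) (w s)) ∧
      ∀ t ∈ Icc (0 : ℝ) 1, (∀ s ∈ T, ρ / 2 ≤ dist (w t) (w s)) → ∀ i, ∀ k : ℤ, m ≤ |w t i - k| := by
  have hev : ∀ c : ℝ, 0 < c → ∀ᶠ r in 𝓝[>] (0 : ℝ), 2 * r ≤ c := fun c hc => by
    filter_upwards [Ioo_mem_nhdsGT (half_pos hc)] with r hr
    linarith [hr.2]
  let Z : Set ℝ := range ((↑) : ℤ → ℝ)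
  have hZ : IsClosed Z := Int.isClosedEmbedding_coe_real.isClosed_range
  have hZne : Z.Nonempty := range_nonempty _
  have hZle : ∀ (x : ℝ) (k : ℤ), Metric.infDist x Z ≤ |x - k| := fun x k =>
    Metric.infDist_le_dist_of_mem (mem_range_self k)
  have hZpos : ∀ x : ℝ, (¬ ∃ k : ℤ, x = k) → 0 < Metric.infDist x Z := fun x hx =>
    (hZ.notMem_iff_infDist_pos hZne).1 (by rintro ⟨k, rfl⟩; exact hx ⟨k, rfl⟩)
  have hends : ∀ t ∈ Icc (0 : ℝ) 1, t ∉ T → ∀ s ∈ T, 0 < dist (w t) (w s) := by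
    intro t ht htT s hs
    rw [dist_pos]
    intro h
    obtain ⟨i, k, hk⟩ := (hT s (hT' s hs)).1 hs
    exact htT ((hT t ht).2 ⟨i, k, by rw [h, hk]⟩)
  have e1 : ∀ᶠ r in 𝓝[>] (0 : ℝ), ∀ s ∈ T, ∀ t ∈ T, w s ≠ w t → 2 * r ≤ dist (w s) (w t) := by
    rw [Filter.eventually_all_finset]; intro s _
    rw [Filter.eventually_all_finset]; intro t _
    by_cases h : w s = w t
    · exact Filter.Eventually.of_forall fun r hr => absurd h hr
    · exact (hev _ (dist_pos.2 h)).mono fun r hr _ => hr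
  have e2 : ∀ᶠ r in 𝓝[>] (0 : ℝ), ∀ s ∈ T, ∀ i, (∃ k : ℤ, w s i = k) ∨
      ∀ k : ℤ, 2 * r ≤ |w s i - k| := by
    rw [Filter.eventually_all_finset]; intro s _
    rw [Filter.eventually_all]; intro i
    by_cases h : ∃ k : ℤ, w s i = k
    · exact Filter.Eventually.of_forall fun r => Or.inl h
    · exact (hev _ (hZpos _ h)).mono fun r hr => Or.inr fun k => hr.trans (hZle _ k)
  have e3 : ∀ᶠ r in 𝓝[>] (0 : ℝ), ∀ s ∈ T, 2 * r ≤ dist (w 0) (w s) ∧ 2 * r ≤ dist (w 1) (w s) := by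
    rw [Filter.eventually_all_finset]; intro s hs
    exact (hev _ (hends 0 ⟨le_rfl, zero_le_one⟩ h0 s hs)).and
      (hev _ (hends 1 ⟨zero_le_one, le_rfl⟩ h1 s hs))
  have e4 : ∀ᶠ r in 𝓝[>] (0 : ℝ), r ∈ Ioo 0 ρ₀ := Ioo_mem_nhdsGT hρ₀
  obtain ⟨ρ, ⟨⟨c1, c2⟩, c3⟩, hρ, hρρ₀⟩ := (((e1.and e2).and e3).and e4).exists
  let K : Set ℝ := {t ∈ Icc (0 : ℝ) 1 | ∀ s ∈ T, ρ / 2 ≤ dist (w t) (w s)}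
  have hK : IsCompact K := by
    refine isCompact_Icc.of_isClosed_subset ?_ fun t ht => ht.1
    have hset : K = Icc 0 1 ∩ ⋂ s ∈ T, (Icc 0 1 ∩ (fun t => dist (w t) (w s)) ⁻¹' Ici (ρ / 2)) := by
      ext t
      simp only [K, mem_ofPred_eq, mem_inter_iff, mem_iInter, mem_preimage, mem_Ici]
      exact ⟨fun h => ⟨h.1, fun s hs => ⟨h.1, h.2 s hs⟩⟩, fun h => ⟨h.1, fun s hs => (h.2 s hs).2⟩⟩
    rw [hset]
    exact isClosed_Icc.inter (isClosed_biInter fun s _ =>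
      ((continuous_id.dist continuous_const).comp_continuousOn hw).preimage_isClosed_of_isClosed
        isClosed_Icc isClosed_Ici)
  have hKT : ∀ t ∈ K, t ∉ T := fun t ht htT => by
    have := ht.2 t htT
    rw [dist_self] at this
    linarith
  have hm : ∀ i : Fin 2, ∃ m, 0 < m ∧ ∀ t ∈ K, m ≤ Metric.infDist (w t i) Z := by
    intro i
    refine hK.exists_forall_le' (f := fun t => Metric.infDist (w t i) Z) ?_ ?_
    · refine (Metric.continuous_infDist_pt Z).comp_continuousOn ?_
      have : Continuous fun z : Plane => z i := by fun_prop
      exact this.comp_continuousOn (hw.mono fun t ht => ht.1)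
    · intro t ht
      exact hZpos _ fun h => hKT t ht ((hT t ht.1).2 ⟨i, h⟩)
  choose m hm0 hm using hm
  refine ⟨ρ, min ρ (min (m 0) (m 1)), lt_min hρ (lt_min (hm0 0) (hm0 1)), min_le_left _ _,
    hρρ₀.le, c1, c2, c3, ?_⟩
  intro t ht hfar i k
  refine le_trans ?_ ((hm i t ⟨ht, hfar⟩).trans (hZle _ k))
  fin_cases i
  · exact (min_le_right _ _).trans (min_le_left _ _)
  · exact (min_le_right _ _).trans (min_le_right _ _)

theorem lineMap_coord (x y : Plane) (c : ℝ) (i : Fin 2) :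
    (AffineMap.lineMap x y c : Plane) i = (1 - c) * x i + c * y i := by
  simp [AffineMap.lineMap_apply]; ring

/-- An excursion that leaves the region `U` away from the grid crosses a grid line. -/
theorem isCrossing_of_notMem {φ ψ w : ℝ → Plane} {T : Finset ℝ} {N : Set ℝ} {U : Set Plane}
    {m ρ α β t : ℝ} {P : Plane} {i : Fin 2} {k : ℤ} (hm : 0 < m) (hmρ : m ≤ ρ) (hρ16 : ρ ≤ 1 / 16)
    (hfar : ∀ z : Plane, (∀ i, ∀ k : ℤ, m / 2 ≤ |z i - k|) → z ∈ U)
    (hnear : ∀ z : Plane, ∀ i, ∀ k : ℤ, |z i - k| ≤ m / 4 → z ∉ U) (hα : α ∈ N) (hβ : β ∈ N)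
    (hφα : ∀ i, ∀ k : ℤ, m / 2 ≤ |φ α i - k|) (hφβ : ∀ i, ∀ k : ℤ, m / 2 ≤ |φ β i - k|)
    (g5 : ∀ s ∈ Ioo α β, s ∉ N) (hψ : IsChordal N φ ψ) (hψc : ContinuousOn ψ (Icc α β))
    (hw : ContinuousOn w (Icc α β)) (m2 : ∀ s ∈ Icc α β, ψ s ∈ Metric.closedBall P ρ)
    (hPi : P i = k) (hother : ∀ j, j ≠ i → ∀ k : ℤ, 2 * ρ ≤ |P j - k|)
    (hclose : ∀ s ∈ Icc α β, dist (φ s) (w s) < m / 2)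
    (hT : ∀ s ∈ Icc α β, ∀ i, ∀ k : ℤ, w s i = k → s ∈ T) (ht : t ∈ Ioo α β) (htD : ψ t ∉ U) :
    IsCrossing N T U ψ ρ α β := by
  obtain ⟨g1, g2⟩ := ht
  have hαβ : α < β := g1.trans g2
  have hαI : α ∈ Icc α β := ⟨le_rfl, hαβ.le⟩
  have hβI : β ∈ Icc α β := ⟨hαβ.le, le_rfl⟩
  have hcoord : ∀ s ∈ Icc α β, ∀ j, |ψ s j - P j| ≤ ρ := fun s hs j =>
    (abs_coord_sub_le _ _ j).trans (Metric.mem_closedBall.1 (m2 s hs))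
  have hψα : ψ α = φ α := hψ.eq_on α hα
  have hψβ : ψ β = φ β := hψ.eq_on β hβ
  have hxα := hφα i k
  have hxβ := hφβ i k
  -- The sign ε expresses that φ α and φ β lie on opposite sides of the line on which coordinate i
  -- equals k. If they were on the same side, their chord would keep distance m / 2 from this line;
  -- being confined to the ρ-ball around P it is far from all other grid lines, so ψ t would lie in
  -- U.
  obtain ⟨ε, hε, hεα, hεβ⟩ : ∃ ε : ℝ, (ε = 1 ∨ ε = -1) ∧ ε * (φ α i - k) ≤ -(m / 2) ∧
      m / 2 ≤ ε * (φ β i - k) := by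
    by_contra! hcon
    have p1 := hcon 1 (Or.inl rfl)
    have p2 := hcon (-1) (Or.inr rfl)
    refine htD (hfar _ fun j k' => ?_)
    by_cases hj : j = i
    · subst hj
      by_cases hk : k' = k
      · subst hk
        rw [hψ.gap α hα β hβ hαβ g5 t ⟨g1.le, g2.le⟩, lineMap_coord]
        set c := (t - α) / (β - α)
        have hc0 : 0 ≤ c := div_nonneg (by linarith) (by linarith)
        have hc1 : c ≤ 1 := div_le_one_of_le₀ (by linarith) (by linarith)
        rcases le_abs'.1 hxα with q1 | q1
        · have q2 : φ β j - k' ≤ -(m / 2) := by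
            rcases le_abs'.1 hxβ with q | q
            · exact q
            · linarith [p1 (by linarith)]
          rw [le_abs']; left; nlinarith
        · have q2 : m / 2 ≤ φ β j - k' := by
            rcases le_abs'.1 hxβ with q | q
            · linarith [p2 (by linarith)]
            · exact q
          rw [le_abs']; right; nlinarith
      · have h1 := hcoord t ⟨g1.le, g2.le⟩ j
        rw [hPi] at h1
        have h2 : (1 : ℝ) ≤ |(k : ℝ) - k'| := by
          have : 1 ≤ |k - k'| := Int.one_le_abs (sub_ne_zero.2 (Ne.symm hk))
          exact_mod_cast this
        have h3 := abs_sub_abs_le_abs_sub ((k : ℝ) - k') (k - ψ t j)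
        rw [show (k : ℝ) - k' - (k - ψ t j) = ψ t j - k' by ring, abs_sub_comm (k : ℝ)] at h3
        rw [abs_sub_comm (k : ℝ) (ψ t j)] at h3
        rw [abs_sub_comm] at h2
        linarith
    · have h1 := hcoord t ⟨g1.le, g2.le⟩ j
      have h2 := hother j hj k'
      have h3 := abs_sub_abs_le_abs_sub (P j - k') (P j - ψ t j)
      rw [show P j - k' - (P j - ψ t j) = ψ t j - k' by ring,
        abs_sub_comm (P j) (ψ t j)] at h3
      linarith
  have hεabs : ∀ x : ℝ, |ε * x| = |x| := by
    intro x; rcases hε with rfl | rfl <;> simp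
  have hε0 : ε ≠ 0 := by rcases hε with rfl | rfl <;> norm_num
  have hci : Continuous fun z : Plane => ε * (z i - k) := by fun_prop
  refine ⟨hα, hβ, hαβ, g5, ?_, ?_, ?_, ?_⟩
  · intro s hs
    rw [hψα, hψβ]
    exact hψ.gap α hα β hβ hαβ g5 s hs
  · intro s hs s' hs'
    have b1 := Metric.mem_closedBall.1 (m2 s hs)
    have b2 := Metric.mem_closedBall.1 (m2 s' hs')
    linarith [dist_triangle_right (ψ s) (ψ s') P]
  -- Being closer than m / 2 to φ at both ends, w changes sides as well and meets the line at a time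
  -- of T.
  · have hwc : ∀ s ∈ Icc α β, |ε * (w s i - k) - ε * (φ s i - k)| < m / 2 := by
      intro s hs
      rw [← mul_sub, sub_sub_sub_cancel_right, hεabs, abs_sub_comm]
      exact (abs_coord_sub_le _ _ i).trans_lt (hclose s hs)
    have w1 := abs_lt.1 (hwc α hαI)
    have w2 := abs_lt.1 (hwc β hβI)
    obtain ⟨s, hs, hs0⟩ := intermediate_value_Ioo hαβ.le
      (hci.comp_continuousOn hw) (show (0 : ℝ) ∈ Ioo _ _ from
        ⟨by simp only [Function.comp_apply]; linarith,
          by simp only [Function.comp_apply]; linarith⟩)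
    refine ⟨s, hT s (Ioo_subset_Icc_self hs) i k ?_, hs⟩
    have := (mul_eq_zero.1 hs0).resolve_left hε0
    linarith
  · obtain ⟨x, hx, hx0⟩ := intermediate_value_Ioo hαβ.le
      (hci.comp_continuousOn hψc) (show (0 : ℝ) ∈ Ioo _ _ from
        ⟨by simp only [Function.comp_apply, hψα]; linarith,
          by simp only [Function.comp_apply, hψβ]; linarith⟩)
    -- A second point outside U, at distance m / 8 beyond the line, is what makes the short side of
    -- the polygon nondegenerate.
    obtain ⟨y, hy, hy0⟩ := intermediate_value_Ioo hx.2.le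
      (hci.comp_continuousOn (hψc.mono (Icc_subset_Icc hx.1.le le_rfl)))
      (show (m / 8 : ℝ) ∈ Ioo _ _ from
        ⟨by rw [hx0]; linarith, by simp only [Function.comp_apply, hψβ]; linarith⟩)
    refine ⟨x, y, hx.1, hy.1, hy.2, hnear _ i k ?_, hnear _ i k ?_⟩
    · rw [← hεabs]
      simp only [Function.comp_apply] at hx0
      rw [hx0, abs_zero]; linarith
    · rw [← hεabs]
      simp only [Function.comp_apply] at hy0
      rw [hy0, abs_of_nonneg (by linarith)]; linarith

/-- Straightening on the unit grid: an injective curve close to `w`, where `w` meets the grid lines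
at finitely many times only, can be replaced by a simple polygonal line. -/
theorem exists_polygonalModel_of_injOn {w : ℝ → Plane} (hw : ContinuousOn w (Icc 0 1))
    {T : Finset ℝ} (h0 : (0 : ℝ) ∉ T) (h1 : (1 : ℝ) ∉ T)
    (hT : ∀ t ∈ Icc (0 : ℝ) 1, t ∈ T ↔ ∃ i, ∃ k : ℤ, w t i = k) (hT' : ∀ t ∈ T, t ∈ Icc (0 : ℝ) 1)
    (hT2 : ∀ t ∈ T, ¬ ∀ i, ∃ k : ℤ, w t i = k) {ρ₀ : ℝ} (hρ₀ : 0 < ρ₀) :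
    ∃ δ > 0, ∀ φ : ℝ → Plane, ContinuousOn φ (Icc 0 1) → InjOn φ (Icc 0 1) →
      (∀ t ∈ Icc (0 : ℝ) 1, dist (φ t) (w t) < δ) →
      (∀ s ∈ Icc (0 : ℝ) 1, ∀ t ∈ Icc (0 : ℝ) 1, dist (w s) (w t) ≤ 4) ∨
        Nonempty (PolygonalModel w T ρ₀ 4) := by
  obtain ⟨ρ, m, hm, hmρ, hρρ₀, c1, c2, c3, c4⟩ := exists_grid_constants hw h0 h1 hT hT'
    (ρ₀ := min (ρ₀ / 5) (1 / 16)) (by positivity)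
  have hρ16 : ρ ≤ 1 / 16 := hρρ₀.trans (min_le_right _ _)
  have hρ5 : 5 * ρ ≤ ρ₀ := by linarith [hρρ₀.trans (min_le_left _ _)]
  have hρ : 0 < ρ := hm.trans_le hmρ
  refine ⟨m / 2, half_pos hm, fun φ hφ hinj hclose => ?_⟩
  obtain ⟨D, hDr, hDd, hDin, hDout⟩ := exists_cells (a := 1 / 2 - m / 4) (b := 1 / 2 - m / 2)
    (by linarith) (by linarith) (by linarith)
  -- points away from the grid lie in the cells, points near the grid do not
  have hfar : ∀ z : Plane, (∀ i, ∀ k : ℤ, m / 2 ≤ |z i - k|) → z ∈ ⋃ n, D n := by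
    intro z hz
    refine mem_iUnion.2 ⟨fun i => ⌊z i⌋, hDin _ _ fun i => ?_⟩
    have a1 := hz i ⌊z i⌋
    have a2 := hz i (⌊z i⌋ + 1)
    push_cast at a2
    rw [abs_of_nonneg (by linarith [Int.floor_le (z i)])] at a1
    rw [abs_of_nonpos (by linarith [Int.lt_floor_add_one (z i)])] at a2
    rw [abs_le]
    constructor <;> linarith
  have hnear : ∀ z : Plane, ∀ i, ∀ k : ℤ, |z i - k| ≤ m / 4 → z ∉ ⋃ n, D n := by
    intro z i k hk hz
    obtain ⟨n, hn⟩ := mem_iUnion.1 hz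
    have a1 := abs_lt.1 (hDout n z hn i)
    rw [abs_le] at hk
    rcases le_or_gt k (n i) with h | h
    · have : (k : ℝ) ≤ n i := by exact_mod_cast h
      linarith
    · have : (n i : ℝ) + 1 ≤ k := by exact_mod_cast h
      linarith
  let C : {P // P ∈ T.image w} → Set Plane := fun P => Metric.ball P.1 ρ
  have hCd : Pairwise (Function.onFun Disjoint C) := by
    rintro ⟨P, hP⟩ ⟨P', hP'⟩ hne
    obtain ⟨s, hs, rfl⟩ := Finset.mem_image.1 hP
    obtain ⟨t, ht, rfl⟩ := Finset.mem_image.1 hP'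
    apply Metric.ball_disjoint_ball
    have := c1 s hs t ht (fun h => hne (Subtype.ext h))
    linarith
  have hout : ∀ t ∈ Icc (0 : ℝ) 1, (∀ s ∈ T, ρ ≤ dist (φ t) (w s)) → φ t ∉ ⋃ P, C P := by
    intro t ht h hmem
    obtain ⟨⟨P, hP⟩, hmem⟩ := mem_iUnion.1 hmem
    obtain ⟨s, hs, rfl⟩ := Finset.mem_image.1 hP
    exact absurd (Metric.mem_ball.1 hmem) (not_lt.2 (h s hs))
  have hend : ∀ t ∈ Icc (0 : ℝ) 1, (∀ s ∈ T, 2 * ρ ≤ dist (w t) (w s)) → φ t ∉ ⋃ P, C P := by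
    intro t ht h
    refine hout t ht fun s hs => ?_
    have a1 := h s hs
    have a2 := hclose t ht
    have a3 := dist_triangle_left (w t) (w s) (φ t)
    linarith
  -- First straightening, in the ρ-balls around w(T). Outside them φ keeps distance m / 2 from the
  -- grid, so ψ can leave the cells only along a chord inside a ball. The second straightening, in
  -- the cells, takes place in `exists_polygonalModel`.
  obtain ⟨ψ, hψc, hψi, hψ, hNcl⟩ := exists_straightening (C := C)
    (fun P => isRound_ball P.1 hρ) hCd zero_le_one hφ hinj
    (hend 0 ⟨le_rfl, zero_le_one⟩ fun s hs => (c3 s hs).1)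
    (hend 1 ⟨zero_le_one, le_rfl⟩ fun s hs => (c3 s hs).2)
  set N := {t ∈ Icc (0 : ℝ) 1 | φ t ∉ ⋃ P, C P} with hN
  have hN0 : (0 : ℝ) ∈ N := ⟨⟨le_rfl, zero_le_one⟩,
    hend 0 ⟨le_rfl, zero_le_one⟩ fun s hs => (c3 s hs).1⟩
  have hN1 : (1 : ℝ) ∈ N := ⟨⟨zero_le_one, le_rfl⟩,
    hend 1 ⟨zero_le_one, le_rfl⟩ fun s hs => (c3 s hs).2⟩
  have hNfar : ∀ t ∈ N, ∀ i, ∀ k : ℤ, m / 2 ≤ |φ t i - k| := by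
    intro t ht i k
    have hwt : ∀ s ∈ T, ρ / 2 ≤ dist (w t) (w s) := by
      intro s hs
      have : ρ ≤ dist (φ t) (w s) := by
        by_contra! hcon
        exact ht.2 (mem_iUnion.2 ⟨⟨w s, Finset.mem_image_of_mem w hs⟩, hcon⟩)
      have a2 := hclose t ht.1
      have a3 := dist_triangle (φ t) (w t) (w s)
      linarith
    have b1 := c4 t ht.1 hwt i k
    have b2 := abs_coord_sub_le (φ t) (w t) i
    have b3 := hclose t ht.1
    have b4 := abs_sub_abs_le_abs_sub (w t i - k) (φ t i - k)
    rw [sub_sub_sub_cancel_right, abs_sub_comm (w t i) (φ t i)] at b4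
    linarith
  -- the excursions into the small balls
  have hgap : ∀ t ∈ Icc (0 : ℝ) 1, t ∉ N → ∃ α ∈ N, ∃ β ∈ N, α < t ∧ t < β ∧
      (∀ s ∈ Ioo α β, s ∉ N) ∧ ∃ s₀ ∈ T, (∀ s ∈ Icc α β, φ s ∈ Metric.closedBall (w s₀) ρ) ∧
      ∀ s ∈ Icc α β, ψ s ∈ Metric.closedBall (w s₀) ρ := by
    intro t ht htN
    obtain ⟨α, hα, β, hβ, g1, g2, g3, g4, g5⟩ := exists_gap hNcl hN0 hN1 ht.1 ht.2 htN
    have hsub : Icc α β ⊆ Icc 0 1 := Icc_subset_Icc g3 g4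
    obtain ⟨⟨P, hP⟩, hcl⟩ := exists_forall_mem_closure (C := C) (fun P => Metric.isOpen_ball) hCd
      (g1.trans g2) (hφ.mono hsub) fun s hs => by
        by_contra hcon
        exact g5 s hs ⟨hsub (Ioo_subset_Icc_self hs), hcon⟩
    obtain ⟨s₀, hs₀, rfl⟩ := Finset.mem_image.1 hP
    have hcl' : ∀ s ∈ Icc α β, φ s ∈ Metric.closedBall (w s₀) ρ := fun s hs =>
      Metric.closure_ball_subset_closedBall (hcl s hs)
    refine ⟨α, hα, β, hβ, g1, g2, g5, s₀, hs₀, hcl', fun s hs => ?_⟩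
    rw [hψ.gap α hα β hβ (g1.trans g2) g5 s hs]
    exact lineMap_mem_of_mem_Icc (convex_closedBall _ _) (hcl' α ⟨le_rfl, (g1.trans g2).le⟩)
      (hcl' β ⟨(g1.trans g2).le, le_rfl⟩) hs
  have hψw : ∀ t ∈ Icc (0 : ℝ) 1, dist (ψ t) (w t) ≤ 3 * ρ := by
    intro t ht
    have a1 := hclose t ht
    by_cases htN : t ∈ N
    · rw [hψ.eq_on t htN]; linarith
    · obtain ⟨α, hα, β, hβ, g1, g2, g5, s₀, hs₀, m1, m2⟩ := hgap t ht htN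
      have b1 := Metric.mem_closedBall.1 (m1 t ⟨g1.le, g2.le⟩)
      have b2 := Metric.mem_closedBall.1 (m2 t ⟨g1.le, g2.le⟩)
      have b3 := dist_triangle4_right (ψ t) (w t) (w s₀) (φ t)
      have b4 := dist_triangle_right (ψ t) (φ t) (w s₀)
      have b5 := dist_triangle (ψ t) (φ t) (w t)
      linarith
  have hcross : ∀ t ∈ Icc (0 : ℝ) 1, ψ t ∉ ⋃ n, D n → ∃ α β, t ∈ Ioo α β ∧
      IsCrossing N T (⋃ n, D n) ψ ρ α β := by
    intro t ht htD
    have htN : t ∉ N := fun h => htD (by rw [hψ.eq_on t h]; exact hfar _ (hNfar t h))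
    obtain ⟨α, hα, β, hβ, g1, g2, g5, s₀, hs₀, m1, m2⟩ := hgap t ht htN
    have hαβ := g1.trans g2
    have hsub : Icc α β ⊆ Icc 0 1 := Icc_subset_Icc hα.1.1 hβ.1.2
    obtain ⟨i, k, hik⟩ := (hT s₀ (hT' s₀ hs₀)).1 hs₀
    -- Since w s₀ is not a lattice vertex, its other coordinate keeps distance 2ρ from ℤ and the
    -- ball meets a single grid line.
    have hother : ∀ j, j ≠ i → ∀ k : ℤ, 2 * ρ ≤ |w s₀ j - k| := by
      intro j hj
      refine (c2 s₀ hs₀ j).resolve_left fun hcon => hT2 s₀ hs₀ fun i' => ?_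
      have : i' = i ∨ i' = j := by omega
      rcases this with rfl | rfl
      · exact ⟨k, hik⟩
      · exact hcon
    exact ⟨α, β, ⟨g1, g2⟩, isCrossing_of_notMem hm hmρ hρ16 hfar hnear hα hβ (hNfar α hα)
      (hNfar β hβ) g5 hψ (hψc.mono hsub) (hw.mono hsub) m2 hik hother
      (fun s hs => hclose s (hsub hs)) (fun s hs j l h => (hT s (hsub hs)).2 ⟨j, l, h⟩)
      ⟨g1, g2⟩ htD⟩
  have hdiam : ∀ n, ∀ x ∈ D n, ∀ y ∈ D n, dist x y ≤ 3 / 2 := by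
    intro n x hx y hy
    rw [EuclideanSpace.dist_eq, Real.sqrt_le_left (by norm_num), Fin.sum_univ_two,
      Real.dist_eq, Real.dist_eq, sq_abs, sq_abs]
    have a0 := abs_lt.1 (hDout n x hx 0)
    have a1 := abs_lt.1 (hDout n x hx 1)
    have b0 := abs_lt.1 (hDout n y hy 0)
    have b1 := abs_lt.1 (hDout n y hy 1)
    have s0 : (x 0 - y 0) ^ 2 ≤ 1 := by
      rw [sq_le_one_iff_abs_le_one, abs_le]; constructor <;> linarith
    have s1 : (x 1 - y 1) ^ 2 ≤ 1 := by
      rw [sq_le_one_iff_abs_le_one, abs_le]; constructor <;> linarith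
    linarith
  rcases exists_polygonalModel hDr hDd hdiam hψc hψi (fun t ht => ht.1)
    (fun t ht => by rw [hψ.eq_on t ht]; exact hfar _ (hNfar t ht)) hρ hρ16 hψw hcross with h | hM
  · exact Or.inl h
  · obtain ⟨M⟩ := hM
    exact Or.inr (Nonempty.intro { M with
      near_l := fun k hk => (M.near_l k hk).trans hρ5
      near_r := fun k hk => (M.near_r k hk).trans hρ5 })

end PlanarRod

/-! ### Generic grids and the Banach indicatrix -/

namespace PlanarRod

/-- Almost every value of a continuous function of bounded variation is attained finitely often
on `[0,1]`. -/
theorem ae_finite_preimage {f g : ℝ → ℝ} (hf : Continuous f) (hg : Integrable g)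
    (hfg : ∀ s t, s ≤ t → |f t - f s| ≤ ∫ x in s..t, g x) (hg0 : ∀ x, 0 ≤ g x) :
    ∀ᵐ c, {t ∈ Icc (0 : ℝ) 1 | f t = c}.Finite := by
  let x : ℕ → ℕ → ℝ := fun n i => i / (n + 1 : ℝ)
  have hx : ∀ n i, x n i ≤ x n (i + 1) := fun n i => by
    simp only [x]; gcongr; simp
  let A : ℕ → ℕ → Set ℝ := fun n i => f '' Icc (x n i) (x n (i + 1))
  have hA : ∀ n i, MeasurableSet (A n i) := fun n i =>
    (isCompact_Icc.image hf).isClosed.measurableSet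
  have hAv : ∀ n i, volume (A n i) ≤ ENNReal.ofReal (2 * ∫ y in x n i..x n (i + 1), g y) := by
    intro n i
    have hsub : A n i ⊆ Metric.closedBall (f (x n i)) (∫ y in x n i..x n (i + 1), g y) := by
      rintro _ ⟨t, ht, rfl⟩
      rw [Metric.mem_closedBall, Real.dist_eq]
      refine (hfg _ _ ht.1).trans (intervalIntegral.integral_mono_interval le_rfl ht.1 ht.2
        (Eventually.of_forall hg0) hg.intervalIntegrable)
    exact (measure_mono hsub).trans (Real.volume_closedBall _ _).le
  -- F n c counts the intervals of length 1/(n+1) on which f takes the value c. Each image has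
  -- measure at most twice the integral of g over its interval, so the integrals of F n are bounded
  -- and, by Fatou, the lower limit is finite almost everywhere. But m distinct preimages eventually
  -- lie in m distinct intervals. Taking n + 2 intervals accommodates t = 1, whose index is n + 1.
  let F : ℕ → ℝ → ℝ≥0∞ := fun n c => ∑ i ∈ Finset.range (n + 2), (A n i).indicator 1 c
  have hFm : ∀ n, Measurable (F n) := fun n =>
    Finset.measurable_fun_sum _ fun i _ => measurable_one.indicator (hA n i)
  have hFint : ∀ n, ∫⁻ c, F n c ≤ ENNReal.ofReal (2 * ∫ y, g y) := by
    intro n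
    rw [lintegral_finsetSum _ fun i _ => measurable_one.indicator (hA n i)]
    have h1 : ∀ i, ∫⁻ c, (A n i).indicator 1 c ≤
        ENNReal.ofReal (2 * ∫ y in x n i..x n (i + 1), g y) := fun i => by
      rw [lintegral_indicator_one (hA n i)]; exact hAv n i
    refine (Finset.sum_le_sum fun i _ => h1 i).trans ?_
    rw [← ENNReal.ofReal_sum_of_nonneg]
    · apply ENNReal.ofReal_le_ofReal
      rw [← Finset.mul_sum, intervalIntegral.sum_integral_adjacent_intervals
        (fun k _ => hg.intervalIntegrable)]
      have : x n 0 ≤ x n (n + 2) := by simp only [x]; gcongr; simp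
      rw [intervalIntegral.integral_of_le this]
      exact mul_le_mul_of_nonneg_left
        (setIntegral_le_integral hg (Eventually.of_forall hg0)) zero_le_two
    · intro i _
      exact mul_nonneg zero_le_two (intervalIntegral.integral_nonneg (hx n i) fun y _ => hg0 y)
  have hlim : ∫⁻ c, liminf (fun n => F n c) atTop ≤ ENNReal.ofReal (2 * ∫ y, g y) := by
    refine (lintegral_liminf_le hFm).trans ?_
    exact liminf_le_of_le (by isBoundedDefault) fun b hb => by
      obtain ⟨n, hn⟩ := hb.exists
      exact hn.trans (hFint n)
  filter_upwards [ae_lt_top (Measurable.liminf hFm) (hlim.trans_lt ENNReal.ofReal_lt_top).ne]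
    with c hc
  by_contra hinf
  refine hc.ne (ENNReal.eq_top_of_forall_nnreal_le fun r => ?_)
  obtain ⟨m, hm⟩ := exists_nat_ge r
  refine le_trans (by exact_mod_cast hm : (r : ℝ≥0∞) ≤ (m : ℝ≥0∞)) ?_
  obtain ⟨S, hS, hScard⟩ := Set.Infinite.exists_subset_card_eq hinf m
  have hev : ∀ᶠ n : ℕ in atTop, ∀ s ∈ S, ∀ t ∈ S, s < t → ⌊s * (n + 1)⌋₊ ≠ ⌊t * (n + 1)⌋₊ := by
    rw [Filter.eventually_all_finset]; intro s hs
    rw [Filter.eventually_all_finset]; intro t ht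
    by_cases hst : s < t
    · obtain ⟨n₀, hn₀⟩ := exists_nat_gt (1 / (t - s))
      filter_upwards [eventually_ge_atTop n₀] with n hn _ heq
      have h0 : 0 ≤ s := (hS hs).1.1
      have h1 := Nat.floor_le (show 0 ≤ s * ((n : ℝ) + 1) by positivity)
      have h2 := Nat.lt_floor_add_one (t * ((n : ℝ) + 1))
      rw [← heq] at h2
      have h3 : (n₀ : ℝ) ≤ n := by exact_mod_cast hn
      have h4 : 1 < n₀ * (t - s) := by rwa [div_lt_iff₀ (sub_pos.2 hst)] at hn₀
      nlinarith [sub_pos.2 hst]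
    · exact Eventually.of_forall fun n h => absurd h hst
  refine le_liminf_of_le (by isBoundedDefault) ?_
  filter_upwards [hev] with n hn
  have hinjS : Set.InjOn (fun t : ℝ => ⌊t * ((n : ℝ) + 1)⌋₊) S := by
    intro s hs t ht hst
    rcases lt_trichotomy s t with h | h | h
    · exact (hn s hs t ht h hst).elim
    · exact h
    · exact (hn t ht s hs h hst.symm).elim
  rw [← hScard, ← Finset.card_image_of_injOn hinjS]
  have hn1 : (0 : ℝ) < n + 1 := by positivity
  have hsub : S.image (fun t : ℝ => ⌊t * ((n : ℝ) + 1)⌋₊) ⊆ Finset.range (n + 2) := by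
    intro i hi
    obtain ⟨t, ht, rfl⟩ := Finset.mem_image.1 hi
    rw [Finset.mem_range, Nat.floor_lt (mul_nonneg (hS ht).1.1 hn1.le)]
    push_cast
    nlinarith [(hS ht).1.2]
  calc ((S.image fun t : ℝ => ⌊t * ((n : ℝ) + 1)⌋₊).card : ℝ≥0∞)
      = ∑ i ∈ S.image (fun t : ℝ => ⌊t * ((n : ℝ) + 1)⌋₊), (1 : ℝ≥0∞) := by simp
    _ = ∑ i ∈ S.image (fun t : ℝ => ⌊t * ((n : ℝ) + 1)⌋₊), (A n i).indicator 1 c := by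
        refine Finset.sum_congr rfl fun i hi => ?_
        obtain ⟨t, ht, rfl⟩ := Finset.mem_image.1 hi
        rw [indicator_of_mem, Pi.one_apply]
        refine ⟨t, ⟨?_, ?_⟩, (hS ht).2⟩
        · simp only [x]
          rw [div_le_iff₀ hn1]
          exact Nat.floor_le (mul_nonneg (hS ht).1.1 hn1.le)
        · simp only [x]
          rw [le_div_iff₀ hn1]
          push_cast
          exact (Nat.lt_floor_add_one _).le
    _ ≤ F n c := Finset.sum_le_sum_of_subset hsub

/-- The level statement is translated by η k for each integer k; since f is bounded on [0,1], only
finitely many k occur. -/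
theorem ae_grid_finite {f g : ℝ → ℝ} (hf : Continuous f) (hg : Integrable g)
    (hfg : ∀ s t, s ≤ t → |f t - f s| ≤ ∫ x in s..t, g x) (hg0 : ∀ x, 0 ≤ g x)
    {η : ℝ} (hη : 0 < η) :
    ∀ᵐ c, {t ∈ Icc (0 : ℝ) 1 | ∃ k : ℤ, η⁻¹ * (f t - c) = k}.Finite := by
  have h1 : ∀ᵐ c, ∀ k : ℤ, {t ∈ Icc (0 : ℝ) 1 | f t = c + η * k}.Finite := by
    rw [ae_all_iff]
    intro k
    exact (measurePreserving_add_right volume (η * (k : ℝ))).quasiMeasurePreserving.ae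
      (ae_finite_preimage hf hg hfg hg0)
  filter_upwards [h1] with c hc
  obtain ⟨B, hB⟩ := isCompact_Icc.exists_bound_of_continuousOn (s := Icc (0 : ℝ) 1)
    (f := fun t => η⁻¹ * (f t - c)) (by fun_prop)
  obtain ⟨K, hK⟩ := exists_nat_ge B
  refine ((Set.finite_Icc (-(K : ℤ)) K).biUnion fun k _ => hc k).subset ?_
  rintro t ⟨ht, k, hk⟩
  have hb := hB t ht
  rw [hk, Real.norm_eq_abs] at hb
  have hb' := abs_le.1 (hb.trans hK)
  refine mem_iUnion₂.2 ⟨k, ⟨by exact_mod_cast hb'.1, by exact_mod_cast hb'.2⟩, ht, ?_⟩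
  rw [← hk]; field_simp; ring

theorem ae_grid_avoid (A : Set ℝ) (hA : A.Countable) {η : ℝ} (hη : 0 < η) :
    ∀ᵐ c : ℝ, ∀ x ∈ A, ¬ ∃ k : ℤ, η⁻¹ * (x - c) = k := by
  have hcount : (⋃ x ∈ A, ⋃ k : ℤ, {x - η * k} : Set ℝ).Countable :=
    hA.biUnion fun x _ => countable_iUnion fun k => countable_singleton _
  filter_upwards [hcount.ae_notMem volume] with c hc x hx
  rintro ⟨k, hk⟩
  refine hc (mem_iUnion₂.2 ⟨x, hx, mem_iUnion.2 ⟨k, ?_⟩⟩)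
  rw [mem_singleton_iff, ← hk]; field_simp; ring

/-- The offset of the vertical lines is chosen first; u meets them at finitely many times. The
offset of the horizontal lines then avoids the second coordinates of u at these times, so no lattice
vertex is hit. -/
theorem exists_generic_grid {u : ℝ → Plane} {g : ℝ → ℝ} (hu : Continuous u) (hg : Integrable g)
    (hug : ∀ s t, s ≤ t → dist (u t) (u s) ≤ ∫ x in s..t, g x) (hg0 : ∀ x, 0 ≤ g x)
    {η : ℝ} (hη : 0 < η) :
    ∃ (c : Plane) (T : Finset ℝ), (0 : ℝ) ∉ T ∧ (1 : ℝ) ∉ T ∧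
      (∀ t ∈ Icc (0 : ℝ) 1, t ∈ T ↔ ∃ i, ∃ k : ℤ, (η⁻¹ • (u t - c)) i = k) ∧
      (∀ t ∈ T, t ∈ Icc (0 : ℝ) 1) ∧ ∀ t ∈ T, ¬ ∀ i, ∃ k : ℤ, (η⁻¹ • (u t - c)) i = k := by
  have hcoord : ∀ i : Fin 2, Continuous fun t => u t i := fun i => by fun_prop
  have hdist : ∀ i : Fin 2, ∀ s t, s ≤ t → |u t i - u s i| ≤ ∫ x in s..t, g x :=
    fun i s t hst => (abs_coord_sub_le _ _ i).trans (hug s t hst)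
  obtain ⟨c₀, h1, h2⟩ := ((ae_grid_finite (hcoord 0) hg (hdist 0) hg0 hη).and
    (ae_grid_avoid {u 0 0, u 1 0} (by simp) hη)).exists
  obtain ⟨c₁, h3, h4⟩ := ((ae_grid_finite (hcoord 1) hg (hdist 1) hg0 hη).and
    (ae_grid_avoid ({u 0 1, u 1 1} ∪ (fun t => u t 1) ''
      {t ∈ Icc (0 : ℝ) 1 | ∃ k : ℤ, η⁻¹ * (u t 0 - c₀) = k})
      (((by simp : ({u 0 1, u 1 1} : Set ℝ).Countable)).union
        (h1.countable.image _)) hη)).exists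
  have hT : ∀ t, t ∈ (h1.union h3).toFinset ↔ t ∈ Icc (0 : ℝ) 1 ∧
      ∃ i, ∃ k : ℤ, (η⁻¹ • (u t - !₂[c₀, c₁])) i = k := by
    intro t
    rw [Set.Finite.mem_toFinset]
    constructor
    · rintro (⟨ht, h⟩ | ⟨ht, h⟩)
      · exact ⟨ht, 0, by simpa using h⟩
      · exact ⟨ht, 1, by simpa using h⟩
    · rintro ⟨ht, i, h⟩
      fin_cases i
      · left; exact ⟨ht, by simpa using h⟩
      · right; exact ⟨ht, by simpa using h⟩
  have key : ∀ t, (u t 0 ∈ ({u 0 0, u 1 0} : Set ℝ)) → u t 1 ∈ ({u 0 1, u 1 1} : Set ℝ) →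
      t ∉ (h1.union h3).toFinset := by
    intro t ht ht' hmem
    obtain ⟨-, i, h⟩ := (hT t).1 hmem
    fin_cases i
    · exact h2 _ ht (by simpa using h)
    · exact h4 _ (Or.inl ht') (by simpa using h)
  refine ⟨!₂[c₀, c₁], (h1.union h3).toFinset, key 0 (by simp) (by simp), key 1 (by simp) (by simp),
    fun t ht => ⟨fun h => ((hT t).1 h).2, fun h => (hT t).2 ⟨ht, h⟩⟩, fun t ht => ((hT t).1 ht).1,
    fun t ht hall => ?_⟩
  have a0 := hall 0
  have a1 := hall 1
  exact h4 (u t 1) (Or.inr ⟨t, ⟨((hT t).1 ht).1, by simpa using a0⟩, rfl⟩) (by simpa using a1)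

/-- The image of a polygonal model under a homothety. -/
def PolygonalModel.homothety {w u : ℝ → Plane} {T : Finset ℝ} {ρ κ η : ℝ} {c : Plane}
    (M : PolygonalModel w T ρ κ) (hη : 0 < η) (hu : ∀ t, u t = c + η • w t) :
    PolygonalModel u T (η * ρ) (η * κ) where
  m := M.m
  σ := M.σ
  l := M.l
  r := M.r
  χ t := c + η • M.χ t
  mem := M.mem
  lt := M.lt
  l_lt := M.l_lt
  r_lt := M.r_lt
  inj s hs t ht hst := M.inj hs ht
    (smul_right_injective Plane hη.ne' (add_left_cancel hst))
  affine_l k hk t ht := by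
    rw [M.affine_l k hk t ht]
    simp only [AffineMap.lineMap_apply, vsub_eq_sub, vadd_eq_add]
    module
  affine_r k hk t ht := by
    rw [M.affine_r k hk t ht]
    simp only [AffineMap.lineMap_apply, vsub_eq_sub, vadd_eq_add]
    module
  near_l k hk := by
    rw [hu, dist_add_left, dist_smul₀, Real.norm_of_nonneg hη.le]
    exact mul_le_mul_of_nonneg_left (M.near_l k hk) hη.le
  near_r k hk := by
    rw [hu, dist_add_left, dist_smul₀, Real.norm_of_nonneg hη.le]
    exact mul_le_mul_of_nonneg_left (M.near_r k hk) hη.le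
  osc k hk s hs t ht := by
    rw [hu, hu, dist_add_left, dist_smul₀, Real.norm_of_nonneg hη.le]
    exact mul_le_mul_of_nonneg_left (M.osc k hk s hs t ht) hη.le
  osc_left s hs t ht := by
    rw [hu, hu, dist_add_left, dist_smul₀, Real.norm_of_nonneg hη.le]
    exact mul_le_mul_of_nonneg_left (M.osc_left s hs t ht) hη.le
  osc_right s hs t ht := by
    rw [hu, hu, dist_add_left, dist_smul₀, Real.norm_of_nonneg hη.le]
    exact mul_le_mul_of_nonneg_left (M.osc_right s hs t ht) hη.le

/-- The order of the quantifiers is essential: T depends on η alone, so the accuracy ρ can later be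
taken small relative to the spacing of T. -/
theorem exists_polygonalModel_of_limit {u : ℝ → Plane} {g : ℝ → ℝ} (hu : Continuous u)
    (hg : Integrable g) (hug : ∀ s t, s ≤ t → dist (u t) (u s) ≤ ∫ x in s..t, g x)
    (hg0 : ∀ x, 0 ≤ g x) (hlim : ∀ δ > 0, ∃ φ : ℝ → Plane, ContinuousOn φ (Icc 0 1) ∧
      InjOn φ (Icc 0 1) ∧ ∀ t ∈ Icc (0 : ℝ) 1, dist (φ t) (u t) < δ) {η : ℝ} (hη : 0 < η) :
    ∃ T : Finset ℝ, (∀ t ∈ T, t ∈ Ioo (0 : ℝ) 1) ∧ ∀ ρ > 0,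
      (∀ s ∈ Icc (0 : ℝ) 1, ∀ t ∈ Icc (0 : ℝ) 1, dist (u s) (u t) ≤ η * 4) ∨
        Nonempty (PolygonalModel u T ρ (η * 4)) := by
  obtain ⟨c, T, h0, h1, hT, hT', hT2⟩ := exists_generic_grid hu hg hug hg0 hη
  refine ⟨T, fun t ht => ⟨lt_of_le_of_ne (hT' t ht).1 ?_, lt_of_le_of_ne (hT' t ht).2 ?_⟩,
    fun ρ hρ => ?_⟩
  · rintro rfl; exact h0 ht
  · rintro rfl; exact h1 ht
  set w : ℝ → Plane := fun t => η⁻¹ • (u t - c) with hw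
  have huw : ∀ t, u t = c + η • w t := fun t => by
    simp only [hw, smul_smul, mul_inv_cancel₀ hη.ne', one_smul]; abel
  have hwc : Continuous w := by fun_prop
  obtain ⟨δ, hδ, hmodel⟩ := exists_polygonalModel_of_injOn hwc.continuousOn h0 h1 hT hT' hT2
    (ρ₀ := ρ / η) (by positivity)
  obtain ⟨φ, hφc, hφi, hφu⟩ := hlim (δ * η) (by positivity)
  have hdw : ∀ x y : Plane, dist (η⁻¹ • (x - c)) (η⁻¹ • (y - c)) = η⁻¹ * dist x y := fun x y => by
    rw [dist_smul₀, dist_sub_right, Real.norm_of_nonneg (inv_nonneg.2 hη.le)]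
  rcases hmodel (fun t => η⁻¹ • (φ t - c)) (by fun_prop)
    (fun s hs t ht hst => hφi hs ht (sub_left_injective
      (smul_right_injective Plane (inv_ne_zero hη.ne') hst))) (fun t ht => by
        rw [hdw, inv_mul_lt_iff₀ hη, mul_comm]; exact hφu t ht) with h | hM
  · left
    intro s hs t ht
    have := h s hs t ht
    rwa [hdw, inv_mul_le_iff₀ hη] at this
  · right
    obtain ⟨M⟩ := hM
    have M' := M.homothety hη huw
    rw [mul_div_cancel₀ _ hη.ne'] at M'
    exact ⟨M'⟩

end PlanarRod

/-! ### Sobolev functions as primitives -/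

noncomputable section
namespace PlanarRod

/-- Extension by zero from `(0,1)` to the real line. -/
def zeroExt (v : ℝ → Plane) : ℝ → Plane := (Ioo (0 : ℝ) 1).indicator v

/-- The primitive on the real line, with value `c` at `0`, of the extension of `v` by zero. -/
def primitive (c : Plane) (v : ℝ → Plane) (x : ℝ) : Plane := c + ∫ t in (0 : ℝ)..x, zeroExt v t

variable {v : ℝ → Plane} {c : Plane}

theorem integrable_zeroExt (hv : Integrable v μ01) : Integrable (zeroExt v) :=
  (integrable_indicator_iff measurableSet_Ioo).2 hv

theorem primitive_sub (hv : Integrable v μ01) (s t : ℝ) :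
    primitive c v t - primitive c v s = ∫ x in s..t, zeroExt v x := by
  have h := integrable_zeroExt hv
  rw [primitive, primitive, add_sub_add_left_eq_sub,
    intervalIntegral.integral_interval_sub_left h.intervalIntegrable h.intervalIntegrable]

theorem dist_primitive_le (hv : Integrable v μ01) {s t : ℝ} (hst : s ≤ t) :
    dist (primitive c v t) (primitive c v s) ≤ ∫ x in s..t, ‖zeroExt v x‖ := by
  rw [dist_eq_norm, primitive_sub hv]
  exact intervalIntegral.norm_integral_le_integral_norm hst

theorem continuous_primitive (hv : Integrable v μ01) : Continuous (primitive c v) :=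
  continuous_const.add (intervalIntegral.continuous_primitive
    (fun _ _ => (integrable_zeroExt hv).intervalIntegrable) 0)

theorem setIntegral_Ioo_eq_intervalIntegral {E : Type*} [NormedAddCommGroup E] [NormedSpace ℝ E]
    (f : ℝ → E) : ∫ x, f x ∂μ01 = ∫ x in (0 : ℝ)..1, f x := by
  rw [intervalIntegral.integral_of_le zero_le_one, integral_Ioc_eq_integral_Ioo]

theorem IsTestFunction.eq_zero {φ : ℝ → ℝ} (h : IsTestFunction φ) {x : ℝ}
    (hx : x ∉ Ioo (0 : ℝ) 1) : φ x = 0 :=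
  image_eq_zero_of_notMem_tsupport fun hx' => hx (h.support hx')

theorem IsTestFunction.integrable_smul {ψ : ℝ → ℝ} (hc : Continuous ψ) (hs : HasCompactSupport ψ)
    (hv : Integrable v μ01) : Integrable (fun x => ψ x • v x) μ01 := by
  obtain ⟨C, hC⟩ := hs.exists_bound_of_continuous hc
  exact hv.bdd_smul C hc.aestronglyMeasurable (Filter.Eventually.of_forall hC)

theorem integrable_of_continuous {f : ℝ → Plane} (hf : Continuous f) : Integrable f μ01 :=
  (hf.continuousOn.integrableOn_compact isCompact_Icc).mono_set Ioo_subset_Icc_self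

/-- Integration by parts: the primitive has the expected weak derivative. -/
theorem hasWeakDeriv_primitive (hv : Integrable v μ01) : HasWeakDeriv (primitive c v) v := by
  intro φ hφ
  have hV := integrable_zeroExt hv
  have i1 : Integrable (fun x => deriv φ x • primitive c v x) μ01 :=
    IsTestFunction.integrable_smul hφ.continuous_deriv hφ.compact.deriv
      (integrable_of_continuous (continuous_primitive hv))
  have i2 : Integrable (fun x => φ x • v x) μ01 :=
    IsTestFunction.integrable_smul hφ.smooth.continuous hφ.compact hv
  ext i
  have e1 : (∫ x, deriv φ x • primitive c v x ∂μ01) i =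
      ∫ x, deriv φ x * primitive c v x i ∂μ01 :=
    ((EuclideanSpace.proj (𝕜 := ℝ) i).integral_comp_comm i1).symm
  have e2 : (-∫ x, φ x • v x ∂μ01) i = -∫ x, φ x * v x i ∂μ01 := by
    rw [PiLp.neg_apply]
    exact congrArg Neg.neg ((EuclideanSpace.proj (𝕜 := ℝ) i).integral_comp_comm i2).symm
  rw [e1, e2]
  have hVi : Integrable (fun x => zeroExt v x i) :=
    (EuclideanSpace.proj (𝕜 := ℝ) i).integrable_comp hV
  have hprim : ∀ x, primitive c v x i = c i + ∫ t in (0 : ℝ)..x, zeroExt v t i := by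
    intro x
    rw [primitive, PiLp.add_apply]
    congr 1
    exact ((EuclideanSpace.proj (𝕜 := ℝ) i).intervalIntegral_comp_comm
      hV.intervalIntegrable).symm
  have hφac : AbsolutelyContinuousOnInterval φ 0 1 :=
    ContDiffOn.absolutelyContinuousOnInterval ((hφ.smooth.of_le (by simp)).contDiffOn)
  have hPac : AbsolutelyContinuousOnInterval (fun x => primitive c v x i) 0 1 := by
    have h1 := IntervalIntegrable.absolutelyContinuousOnInterval_intervalIntegral
      (hVi.intervalIntegrable (a := 0) (b := 1)) (c := 0) (by simp)
    have h2 : AbsolutelyContinuousOnInterval (fun _ : ℝ => c i) 0 1 :=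
      ContDiffOn.absolutelyContinuousOnInterval contDiffOn_const
    simp only [hprim]
    exact h2.fun_add h1
  -- Integration by parts for absolutely continuous functions, in each coordinate; φ vanishes at 0
  -- and 1.
  have hparts := hPac.integral_mul_deriv_eq_deriv_mul hφac
  rw [hφ.eq_zero (x := 1) (by simp), hφ.eq_zero (x := 0) (by simp), mul_zero, mul_zero, sub_zero,
    zero_sub] at hparts
  rw [setIntegral_Ioo_eq_intervalIntegral]
  calc ∫ x in (0 : ℝ)..1, deriv φ x * primitive c v x i
      = ∫ x in (0 : ℝ)..1, primitive c v x i * deriv φ x := by simp only [mul_comm]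
    _ = -∫ x in (0 : ℝ)..1, deriv (fun x => primitive c v x i) x * φ x := hparts
    _ = -∫ x, φ x * v x i ∂μ01 := by
      rw [← setIntegral_Ioo_eq_intervalIntegral]
      congr 1
      refine integral_congr_ae ?_
      filter_upwards [ae_restrict_of_ae
        (_root_.LocallyIntegrable.ae_hasDerivAt_integral hVi.locallyIntegrable),
        ae_restrict_mem measurableSet_Ioo] with x hx hx01
      have : deriv (fun x => primitive c v x i) x = zeroExt v x i := by
        simp only [hprim]
        exact ((hx 0).const_add (c i)).deriv
      rw [this, zeroExt, indicator_of_mem hx01, mul_comm]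

/-- A smooth function with zero mean and compact support in `(0,1)` is the derivative of a test
function. -/
theorem IsTestFunction.exists_deriv_eq {θ : ℝ → ℝ} (hθ : IsTestFunction θ)
    (hmean : ∫ x, θ x ∂μ01 = 0) : ∃ φ, IsTestFunction φ ∧ deriv φ = θ := by
  let φ : ℝ → ℝ := fun x => ∫ t in (0 : ℝ)..x, θ t
  have hcont := hθ.smooth.continuous
  have hderiv : ∀ x, HasDerivAt φ (θ x) x := fun x =>
    intervalIntegral.integral_hasDerivAt_right (hcont.intervalIntegrable _ _)
      hcont.stronglyMeasurable.stronglyMeasurableAtFilter hcont.continuousAt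
  have hd : deriv φ = θ := funext fun x => (hderiv x).deriv
  obtain ⟨a, b, ha, hb, hab⟩ : ∃ a b : ℝ, 0 < a ∧ b < 1 ∧ tsupport θ ⊆ Icc a b := by
    -- Inserting 1/2 keeps the set nonempty when θ is zero, so that its infimum and supremum are
    -- attained inside (0,1).
    have hK : IsCompact (insert (1 / 2) (tsupport θ)) := hθ.compact.insert _
    have hne : (insert (1 / 2) (tsupport θ)).Nonempty := insert_nonempty _ _
    have hsub : insert (1 / 2) (tsupport θ) ⊆ Ioo (0 : ℝ) 1 :=
      insert_subset (by norm_num) hθ.support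
    exact ⟨_, _, (hsub (hK.sInf_mem hne)).1, (hsub (hK.sSup_mem hne)).2, fun x hx =>
      ⟨csInf_le hK.bddBelow (mem_insert_of_mem _ hx),
        le_csSup hK.bddAbove (mem_insert_of_mem _ hx)⟩⟩
  have hz : ∀ x, x ∉ Icc a b → θ x = 0 := fun x hx =>
    image_eq_zero_of_notMem_tsupport fun h => hx (hab h)
  have hleft : ∀ x, x < a → φ x = 0 := by
    intro x hx
    rw [← intervalIntegral.integral_zero (a := 0) (b := x) (μ := volume)]
    refine intervalIntegral.integral_congr fun t ht => hz t fun h => ?_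
    rw [mem_uIcc] at ht
    rcases ht with ht | ht <;> linarith [h.1, ht.2]
  have hright : ∀ x, b < x → φ x = 0 := by
    intro x hx
    have h1 : φ x - φ 1 = 0 := by
      rw [intervalIntegral.integral_interval_sub_left (hcont.intervalIntegrable _ _)
        (hcont.intervalIntegrable _ _), ← intervalIntegral.integral_zero (a := 1) (b := x)
        (μ := volume)]
      refine intervalIntegral.integral_congr fun t ht => hz t fun h => ?_
      rw [mem_uIcc] at ht
      rcases ht with ht | ht <;> linarith [h.2, ht.1]
    rw [sub_eq_zero.1 h1]
    rwa [setIntegral_Ioo_eq_intervalIntegral] at hmean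
  have hsupp : tsupport φ ⊆ Icc a b := closure_minimal (fun x hx => by
    by_contra hcon
    rw [mem_Icc, not_and_or, not_le, not_le] at hcon
    exact hx (hcon.elim (hleft x) (hright x))) isClosed_Icc
  refine ⟨φ, ⟨?_, isCompact_Icc.of_isClosed_subset (isClosed_tsupport _) hsupp,
    hsupp.trans fun x hx => ⟨ha.trans_le hx.1, hx.2.trans_lt hb⟩⟩, hd⟩
  rw [contDiff_infty_iff_deriv, hd]
  exact ⟨fun x => (hderiv x).differentiableAt, hθ.smooth⟩

theorem exists_testFunction_integral_eq_one : ∃ χ, IsTestFunction χ ∧ ∫ x, χ x ∂μ01 = 1 := by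
  let f : ContDiffBump (1 / 2 : ℝ) := ⟨1 / 8, 1 / 4, by norm_num, by norm_num⟩
  have hts : tsupport (f.normed volume) ⊆ Ioo (0 : ℝ) 1 := by
    rw [f.tsupport_normed_eq, Real.closedBall_eq_Icc]
    intro x hx
    simp only [f] at hx
    constructor <;> linarith [hx.1, hx.2]
  refine ⟨f.normed volume, ⟨f.contDiff_normed, f.hasCompactSupport_normed, hts⟩, ?_⟩
  rw [setIntegral_eq_integral_of_forall_compl_eq_zero, f.integral_normed]
  exact fun x hx => image_eq_zero_of_notMem_tsupport fun h => hx (hts h)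

/-- A function with vanishing weak derivative is constant. -/
theorem exists_ae_eq_const {w : ℝ → Plane} (hw : Integrable w μ01)
    (h : ∀ φ, IsTestFunction φ → ∫ x, deriv φ x • w x ∂μ01 = 0) : ∃ c, w =ᵐ[μ01] fun _ => c := by
  obtain ⟨χ, hχ, hχ1⟩ := exists_testFunction_integral_eq_one
  refine ⟨∫ x, χ x • w x ∂μ01, ?_⟩
  set c := ∫ x, χ x • w x ∂μ01 with hc
  have key := (isOpen_Ioo (a := (0 : ℝ)) (b := 1)).ae_eq_zero_of_integral_contDiff_smul_eq_zero
    (μ := μ01) (f := fun x => w x - c)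
    ((hw.sub (integrable_const c)).integrableOn.locallyIntegrableOn)
    ?_
  · filter_upwards [key, ae_restrict_mem measurableSet_Ioo] with x hx hx01
    exact sub_eq_zero.1 (hx hx01)
  intro ψ hψs hψc hψt
  have hψ : IsTestFunction ψ := ⟨hψs, hψc, hψt⟩
  have hint : ∀ {η : ℝ → ℝ}, IsTestFunction η → Integrable η μ01 := fun hη =>
    (hη.smooth.continuous.integrable_of_hasCompactSupport hη.compact).integrableOn
  set a := ∫ x, ψ x ∂μ01 with ha
  -- Du Bois-Reymond: subtracting the multiple of χ with the same mean leaves the derivative of a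
  -- test function, which w annihilates. Thus ψ pairs with w as it does with the constant c.
  have hθ : IsTestFunction (fun x => ψ x - a * χ x) := by
    have hsub : tsupport (fun x => ψ x - a * χ x) ⊆ tsupport ψ ∪ tsupport χ := by
      refine closure_minimal (fun x hx => ?_) ((isClosed_tsupport _).union (isClosed_tsupport _))
      by_contra hcon
      rw [mem_union, not_or] at hcon
      apply hx
      simp [image_eq_zero_of_notMem_tsupport hcon.1, image_eq_zero_of_notMem_tsupport hcon.2]
    exact ⟨hψs.sub (contDiff_const.mul hχ.smooth), (hψc.union hχ.compact).of_isClosed_subset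
      (isClosed_tsupport _) hsub, hsub.trans (union_subset hψt hχ.support)⟩
  obtain ⟨φ, hφ, hφd⟩ := hθ.exists_deriv_eq (by
    rw [integral_sub (hint hψ) ((hint hχ).const_mul a), integral_const_mul, hχ1, ← ha]; ring)
  have h0 := h φ hφ
  have i1 : Integrable (fun x => ψ x • w x) μ01 :=
    IsTestFunction.integrable_smul hψs.continuous hψc hw
  have i2 : Integrable (fun x => χ x • w x) μ01 :=
    IsTestFunction.integrable_smul hχ.smooth.continuous hχ.compact hw
  have e1 : ∫ x, deriv φ x • w x ∂μ01 = (∫ x, ψ x • w x ∂μ01) - a • c := by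
    have i3 : Integrable (fun x => a • χ x • w x) μ01 := i2.smul a
    rw [hφd, hc, ← integral_smul, ← integral_sub i1 i3]
    refine integral_congr_ae (Eventually.of_forall fun x => ?_)
    simp only [sub_smul, mul_smul]
  have e2 : ∫ x, ψ x • (w x - c) ∂μ01 = (∫ x, ψ x • w x ∂μ01) - a • c := by
    simp only [smul_sub]
    rw [integral_sub i1 ((hint hψ).smul_const c), integral_smul_const, ← ha]
  rw [e2, ← e1, h0]

section

variable {p : ℝ≥0∞} [Fact (1 ≤ p)]

theorem integrable_coe (v : Lp Plane p μ01) : Integrable v μ01 :=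
  (Lp.memLp v).integrable Fact.out

/-- Sobolev functions are represented by primitives of their weak derivatives. -/
theorem exists_isContRep_primitive (y : W1p p) :
    ∃ c, IsContRep y (primitive c y.1.snd) := by
  have hv := integrable_coe y.1.snd
  have hf := integrable_coe y.1.fst
  have hU : Integrable (primitive 0 y.1.snd) μ01 :=
    integrable_of_continuous (continuous_primitive hv)
  obtain ⟨c, hc⟩ := exists_ae_eq_const (hf.sub hU) fun φ hφ => by
    have i1 := IsTestFunction.integrable_smul hφ.continuous_deriv hφ.compact.deriv hf
    have i2 := IsTestFunction.integrable_smul hφ.continuous_deriv hφ.compact.deriv hU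
    simp only [Pi.sub_apply, smul_sub]
    rw [integral_sub i1 i2, hasWeakDeriv_primitive hv φ hφ, y.2 φ hφ, sub_self]
  refine ⟨c, (continuous_primitive hv).continuousOn, ?_⟩
  filter_upwards [hc] with x hx
  rw [Pi.sub_apply, sub_eq_iff_eq_add] at hx
  rw [hx, primitive, primitive, zero_add]

/-- Every `L^p` function is the weak derivative of a Sobolev function with prescribed initial
value. -/
theorem exists_W1p_primitive (c : Plane) (v : Lp Plane p μ01) :
    ∃ y : W1p p, y.1.snd = v ∧ IsContRep y (primitive c v) := by
  have hv := integrable_coe v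
  have hcont := continuous_primitive (c := c) hv
  obtain ⟨C, hC⟩ := isCompact_Icc.exists_bound_of_continuousOn (s := Icc (0 : ℝ) 1)
    hcont.continuousOn
  have hmem : MemLp (primitive c v) p μ01 := MemLp.of_bound hcont.aestronglyMeasurable C (by
    filter_upwards [ae_restrict_mem measurableSet_Ioo] with x hx
    exact hC x (Ioo_subset_Icc_self hx))
  refine ⟨⟨WithLp.toLp p (hmem.toLp _, v), ?_⟩, rfl, hcont.continuousOn, hmem.coeFn_toLp.symm⟩
  intro φ hφ
  refine Eq.trans (integral_congr_ae ?_) (hasWeakDeriv_primitive (c := c) hv φ hφ)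
  filter_upwards [hmem.coeFn_toLp] with x hx
  exact congrArg _ hx

theorem IsContRep.eqOn {y : W1p p} {u u' : ℝ → Plane} (h : IsContRep y u) (h' : IsContRep y u') :
    EqOn u u' (Ioo 0 1) :=
  Measure.eqOn_open_of_ae_eq (μ := volume) (h.2.trans h'.2.symm) isOpen_Ioo h.1 h'.1

end

end PlanarRod
end

/-! ### Vitali–Hahn–Saks -/

noncomputable section
namespace PlanarRod

section

variable {X E : Type*} [MeasurableSpace X] {μ : Measure X} [NormedAddCommGroup E] [NormedSpace ℝ E]

/-- Truncation of a real number to `[0,1]`. -/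
def clip (t : ℝ) : ℝ := max 0 (min t 1)

theorem continuous_clip : Continuous clip :=
  continuous_const.max (continuous_id.min continuous_const)

theorem norm_clip_le (t : ℝ) : ‖clip t‖ ≤ 1 := by
  rw [clip, Real.norm_of_nonneg (le_max_left _ _)]
  exact max_le zero_le_one (min_le_right _ _)

theorem clip_zero : clip 0 = 0 := by simp [clip]

theorem clip_one : clip 1 = 1 := by simp [clip]

theorem integrable_clip_smul {f : X → E} (hf : Integrable f μ) {g : X → ℝ}
    (hg : AEStronglyMeasurable g μ) : Integrable (fun x => clip (g x) • f x) μ :=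
  hf.bdd_smul 1 (continuous_clip.comp_aestronglyMeasurable hg)
    (Eventually.of_forall fun _ => norm_clip_le _)

/-- Along an L¹-convergent sequence every subsequence has a further one converging almost
everywhere, and clipping provides the dominating function ‖f‖. -/
theorem continuous_integral_clip_smul {f : X → E} (hf : Integrable f μ) :
    Continuous fun g : Lp ℝ 1 μ => ∫ x, clip (g x) • f x ∂μ := by
  rw [continuous_iff_seqContinuous]
  intro gs g hgs
  refine tendsto_of_subseq_tendsto fun ns hns => ?_
  obtain ⟨ms, -, hms⟩ := (tendstoInMeasure_of_tendsto_Lp (hgs.comp hns)).exists_seq_tendsto_ae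
  refine ⟨ms, tendsto_integral_of_dominated_convergence (fun x => ‖f x‖)
    (fun n => (integrable_clip_smul hf (Lp.aestronglyMeasurable _)).aestronglyMeasurable) hf.norm
    (fun n => Eventually.of_forall fun x => ?_) ?_⟩
  · rw [norm_smul]
    exact mul_le_of_le_one_left (norm_nonneg _) (norm_clip_le _)
  · filter_upwards [hms] with x hx
    exact ((continuous_clip.tendsto _).comp hx).smul_const _

/-- The Vitali–Hahn–Saks theorem for weakly null sequences of integrable functions. -/
theorem exists_forall_norm_setIntegral_le [IsFiniteMeasure μ] {f : ℕ → X → E}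
    (hf : ∀ k, Integrable (f k) μ)
    (hlim : ∀ g : X → ℝ, AEStronglyMeasurable g μ → (∀ x, ‖g x‖ ≤ 1) →
      Tendsto (fun k => ∫ x, g x • f k x ∂μ) atTop (𝓝 0)) {ε : ℝ} (hε : 0 < ε) :
    ∃ δ > 0, ∀ k, ∀ A, MeasurableSet A → μ A < δ → ‖∫ x in A, f k x ∂μ‖ ≤ ε := by
  -- Through clipping, the Banach space L¹ parametrizes test functions with values in [0,1], so
  -- Baire applies: for some N the bound for all k ≥ N holds on a whole ball of L¹.
  let S : ℕ → Set (Lp ℝ 1 μ) := fun N => ⋂ k ≥ N, {g | ‖∫ x, clip (g x) • f k x ∂μ‖ ≤ ε / 2}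
  have hS : ∀ N, IsClosed (S N) := fun N => isClosed_biInter fun k _ =>
    isClosed_le (continuous_integral_clip_smul (hf k)).norm continuous_const
  have hcover : ⋃ N, S N = univ := by
    refine eq_univ_of_forall fun g => ?_
    have h := hlim (fun x => clip (g x))
      (continuous_clip.comp_aestronglyMeasurable (Lp.aestronglyMeasurable _))
      fun _ => norm_clip_le _
    obtain ⟨N, hN⟩ := eventually_atTop.1 (h.norm.eventually_le_const (u := ε / 2) (by simpa))
    exact mem_iUnion.2 ⟨N, mem_iInter₂.2 fun k hk => hN k hk⟩
  obtain ⟨N, g, hg⟩ := nonempty_interior_of_iUnion_of_closed hS hcover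
  obtain ⟨r, hr, hball⟩ := EMetric.mem_nhds_iff.1 (mem_interior_iff_mem_nhds.1 hg)
  have hgi : Integrable g μ := L1.integrable_coeFn g
  obtain ⟨δ₀, hδ₀, h₀⟩ := exists_pos_setLIntegral_lt_of_measure_lt (μ := μ)
    (f := fun x => 1 + ‖g x‖ₑ) (by
      rw [lintegral_add_left measurable_const]
      exact ENNReal.add_ne_top.2 ⟨by simp, hgi.2.ne⟩) hr.ne'
  have htail : ∀ k ≥ N, ∀ A, MeasurableSet A → μ A < δ₀ → ‖∫ x in A, f k x ∂μ‖ ≤ ε := by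
    intro k hk A hA hμA
    -- For small μ A, redefining the centre g on A to be 0 or 1 stays inside the ball. The
    -- difference of the two clipped integrals is the integral of f k over A.
    have main : ∀ c : ℝ, ‖c‖ₑ ≤ 1 → ∃ g' : Lp ℝ 1 μ, ‖∫ x, clip (g' x) • f k x ∂μ‖ ≤ ε / 2 ∧
        ∀ᵐ x ∂μ, (x ∈ A → g' x = c) ∧ (x ∉ A → g' x = g x) := by
      intro c hc
      have hi : Integrable (A.indicator fun x => c - g x) μ :=
        ((integrable_const c).sub hgi).indicator hA
      refine ⟨g + hi.toL1 _, ?_, ?_⟩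
      · refine mem_iInter₂.1 (hball (?_ : g + hi.toL1 _ ∈ Metric.eball g r)) k hk
        rw [Metric.mem_eball, edist_eq_enorm_sub, add_sub_cancel_left, Integrable.enorm_toL1]
        refine lt_of_le_of_lt ?_ (h₀ A hμA)
        rw [← lintegral_indicator hA]
        refine lintegral_mono fun x => ?_
        by_cases hxA : x ∈ A
        · rw [indicator_of_mem hxA, indicator_of_mem hxA]
          exact enorm_sub_le.trans (add_le_add_left hc _)
        · rw [indicator_of_notMem hxA, indicator_of_notMem hxA, enorm_zero]
      · filter_upwards [Lp.coeFn_add g (hi.toL1 _), hi.coeFn_toL1] with x hx hx'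
        rw [hx, Pi.add_apply, hx']
        exact ⟨fun h => by rw [indicator_of_mem h]; ring,
          fun h => by rw [indicator_of_notMem h]; ring⟩
    obtain ⟨g₀, hg₀, hg₀'⟩ := main 0 (by simp)
    obtain ⟨g₁, hg₁, hg₁'⟩ := main 1 (by simp)
    have : ∫ x in A, f k x ∂μ =
        (∫ x, clip (g₁ x) • f k x ∂μ) - ∫ x, clip (g₀ x) • f k x ∂μ := by
      rw [← integral_sub (integrable_clip_smul (hf k) (Lp.aestronglyMeasurable _))
        (integrable_clip_smul (hf k) (Lp.aestronglyMeasurable _)), ← integral_indicator hA]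
      refine integral_congr_ae ?_
      filter_upwards [hg₀', hg₁'] with x hx₀ hx₁
      by_cases hxA : x ∈ A
      · rw [indicator_of_mem hxA, hx₀.1 hxA, hx₁.1 hxA, clip_zero, clip_one, one_smul, zero_smul,
          sub_zero]
      · rw [indicator_of_notMem hxA, hx₀.2 hxA, hx₁.2 hxA, sub_self]
    rw [this]
    exact (norm_sub_le _ _).trans (by linarith)
  -- The finitely many indices below N only need absolute continuity of each integral.
  have hind : ∀ k, ∃ δ > 0, ∀ A, MeasurableSet A → μ A < δ → ‖∫ x in A, f k x ∂μ‖ ≤ ε := by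
    intro k
    obtain ⟨δ, hδ, h⟩ := exists_pos_setLIntegral_lt_of_measure_lt (μ := μ)
      (f := fun x => ‖f k x‖ₑ) (hf k).2.ne (ENNReal.ofReal_pos.2 hε).ne'
    refine ⟨δ, hδ, fun A _ hμA => ?_⟩
    have := (enorm_integral_le_lintegral_enorm _).trans (h A hμA).le
    rwa [← ofReal_norm, ENNReal.ofReal_le_ofReal_iff hε.le] at this
  choose δ hδ hind using hind
  refine ⟨min δ₀ ((Finset.range N).inf δ), lt_min hδ₀ ?_, fun k A hA hμA => ?_⟩
  · rw [Finset.lt_inf_iff (by simp)]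
    exact fun k _ => hδ k
  · rcases le_or_gt N k with hk | hk
    · exact htail k hk A hA (hμA.trans_le (min_le_left _ _))
    · exact hind k A hA (hμA.trans_le
        ((min_le_right _ _).trans (Finset.inf_le (Finset.mem_range.2 hk))))

end

end PlanarRod
end

/-! ### Weak convergence implies uniform convergence -/

noncomputable section
namespace PlanarRod

variable {p : ℝ≥0∞} [Fact (1 ≤ p)]

instance : IsProbabilityMeasure μ01 := ⟨by simp⟩

theorem integral_norm_le_norm (v : Lp Plane p μ01) : ∫ x, ‖v x‖ ∂μ01 ≤ ‖v‖ := by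
  rw [integral_norm_eq_lintegral_enorm (Lp.aestronglyMeasurable v), Lp.norm_def,
    ← eLpNorm_one_eq_lintegral_enorm]
  exact ENNReal.toReal_mono (Lp.eLpNorm_ne_top v)
    (eLpNorm_le_eLpNorm_of_exponent_le Fact.out (Lp.aestronglyMeasurable v))

theorem integrable_bounded_smul {g : ℝ → ℝ} (hg : AEStronglyMeasurable g μ01)
    (hg1 : ∀ x, ‖g x‖ ≤ 1) {f : ℝ → Plane} (hf : Integrable f μ01) :
    Integrable (fun x => g x • f x) μ01 :=
  hf.bdd_smul 1 hg (Eventually.of_forall hg1)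

/-- Integration against a bounded function, as a continuous linear map on `L^p`. -/
theorem exists_clm_integral_smul {g : ℝ → ℝ} (hg : AEStronglyMeasurable g μ01)
    (hg1 : ∀ x, ‖g x‖ ≤ 1) :
    ∃ L : Lp Plane p μ01 →L[ℝ] Plane, ∀ v, L v = ∫ x, g x • v x ∂μ01 := by
  have hi : ∀ v : Lp Plane p μ01, Integrable (fun x => g x • v x) μ01 := fun v =>
    integrable_bounded_smul hg hg1 (integrable_coe v)
  refine ⟨LinearMap.mkContinuous
    { toFun := fun v => ∫ x, g x • v x ∂μ01
      map_add' := fun v w => ?_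
      map_smul' := fun c v => ?_ } 1 fun v => ?_, fun v => rfl⟩
  · rw [← integral_add (hi v) (hi w)]
    refine integral_congr_ae ?_
    filter_upwards [Lp.coeFn_add v w] with x hx
    rw [hx, Pi.add_apply, smul_add]
  · rw [RingHom.id_apply, ← integral_smul]
    refine integral_congr_ae ?_
    filter_upwards [Lp.coeFn_smul c v] with x hx
    rw [hx, Pi.smul_apply, smul_comm]
  · rw [one_mul]
    refine le_trans ?_ (integral_norm_le_norm v)
    refine norm_integral_le_of_norm_le (integrable_coe v).norm (Eventually.of_forall fun x => ?_)
    rw [norm_smul]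
    exact mul_le_of_le_one_left (norm_nonneg _) (hg1 x)

theorem TendstoWeak.tendsto_clm {yk : ℕ → W1p p} {y : W1p p} (h : TendstoWeak yk y)
    (L : W1p p →L[ℝ] Plane) : Tendsto (fun k => L (yk k)) atTop (𝓝 (L y)) := by
  rw [(PiLp.homeomorph 2 _).isInducing.tendsto_nhds_iff, tendsto_pi_nhds]
  intro i
  let ℓ : W1p p →L[ℝ] ℝ := (EuclideanSpace.proj i).comp L
  exact ((WeakBilin.eval_continuous _ ℓ).tendsto _).comp h

theorem TendstoWeak.tendsto_integral_snd {yk : ℕ → W1p p} {y : W1p p} (h : TendstoWeak yk y)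
    {g : ℝ → ℝ} (hg : AEStronglyMeasurable g μ01) (hg1 : ∀ x, ‖g x‖ ≤ 1) :
    Tendsto (fun k => ∫ x, g x • (yk k).1.snd x ∂μ01) atTop (𝓝 (∫ x, g x • y.1.snd x ∂μ01)) := by
  obtain ⟨L, hL⟩ := exists_clm_integral_smul (p := p) hg hg1
  simp only [← hL]
  exact h.tendsto_clm (L.comp ((ContinuousLinearMap.snd ℝ _ _).comp
    ((WithLp.prodContinuousLinearEquiv p ℝ _ _).toContinuousLinearMap.comp (W1p p).subtypeL)))

theorem TendstoWeak.tendsto_integral_fst {yk : ℕ → W1p p} {y : W1p p} (h : TendstoWeak yk y) :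
    Tendsto (fun k => ∫ x, (yk k).1.fst x ∂μ01) atTop (𝓝 (∫ x, y.1.fst x ∂μ01)) := by
  obtain ⟨L, hL⟩ := exists_clm_integral_smul (p := p) (g := fun _ => 1)
    aestronglyMeasurable_const (by simp)
  simp only [one_smul] at hL
  simp only [← hL]
  exact h.tendsto_clm (L.comp ((ContinuousLinearMap.fst ℝ _ _).comp
    ((WithLp.prodContinuousLinearEquiv p ℝ _ _).toContinuousLinearMap.comp (W1p p).subtypeL)))

theorem primitive_sub_primitive {c c' : Plane} {v v' : ℝ → Plane} (hv : Integrable v μ01)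
    (hv' : Integrable v' μ01) (t : ℝ) :
    primitive c v t - primitive c' v' t = primitive (c - c') (fun x => v x - v' x) t := by
  have e : zeroExt (fun x => v x - v' x) = fun x => zeroExt v x - zeroExt v' x :=
    indicator_sub _ _ _
  rw [primitive, primitive, primitive, e, intervalIntegral.integral_sub
    (integrable_zeroExt hv).intervalIntegrable (integrable_zeroExt hv').intervalIntegrable]
  abel

theorem intervalIntegral_zeroExt {v : ℝ → Plane} {s t : ℝ} (hst : s ≤ t) :
    ∫ x in s..t, zeroExt v x = ∫ x in Ioc s t, v x ∂μ01 := by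
  rw [intervalIntegral.integral_of_le hst, zeroExt, setIntegral_indicator measurableSet_Ioo,
    Measure.restrict_restrict measurableSet_Ioc]

/-- Primitives of a weakly null sequence are equicontinuous. -/
theorem exists_forall_dist_primitive_le {d : ℕ → ℝ → Plane} (hd : ∀ k, Integrable (d k) μ01)
    (hlim : ∀ g : ℝ → ℝ, AEStronglyMeasurable g μ01 → (∀ x, ‖g x‖ ≤ 1) →
      Tendsto (fun k => ∫ x, g x • d k x ∂μ01) atTop (𝓝 0)) {ε : ℝ} (hε : 0 < ε) :
    ∃ δ > 0, ∀ (a : ℕ → Plane) k s t, dist s t < δ →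
      dist (primitive (a k) (d k) s) (primitive (a k) (d k) t) ≤ ε := by
  obtain ⟨δ, hδ, h⟩ := exists_forall_norm_setIntegral_le hd hlim hε
  obtain ⟨r, hr, hrδ⟩ := ENNReal.lt_iff_exists_nnreal_btwn.1 hδ
  have key : ∀ (a : ℕ → Plane) k s t, s ≤ t → dist s t < r →
      dist (primitive (a k) (d k) s) (primitive (a k) (d k) t) ≤ ε := by
    intro a k s t hst hd'
    rw [dist_comm, dist_eq_norm, primitive_sub (hd k), intervalIntegral_zeroExt hst]
    refine h k _ measurableSet_Ioc (lt_of_le_of_lt ?_ hrδ)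
    refine (Measure.restrict_apply_le _ _).trans ?_
    rw [Real.volume_Ioc, ← ENNReal.ofReal_coe_nnreal]
    refine ENNReal.ofReal_le_ofReal ?_
    rw [dist_comm, Real.dist_eq, abs_of_nonneg (sub_nonneg.2 hst)] at hd'
    exact hd'.le
  refine ⟨r, by exact_mod_cast hr, fun a k s t hst => ?_⟩
  rcases le_total s t with h' | h'
  · exact key a k s t h' hst
  · rw [dist_comm]
    exact key a k t s h' (by rwa [dist_comm])

/-- Primitives of a weakly null sequence converge uniformly to zero if their means do. -/
theorem eventually_forall_norm_primitive_le {d : ℕ → ℝ → Plane} (hd : ∀ k, Integrable (d k) μ01)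
    (hlim : ∀ g : ℝ → ℝ, AEStronglyMeasurable g μ01 → (∀ x, ‖g x‖ ≤ 1) →
      Tendsto (fun k => ∫ x, g x • d k x ∂μ01) atTop (𝓝 0)) {a : ℕ → Plane}
    (hmean : Tendsto (fun k => ∫ x, primitive (a k) (d k) x ∂μ01) atTop (𝓝 0))
    {ε : ℝ} (hε : 0 < ε) :
    ∀ᶠ k in atTop, ∀ t ∈ Icc (0 : ℝ) 1, ‖primitive (a k) (d k) t‖ ≤ ε := by
  obtain ⟨δ, hδ, h⟩ := exists_forall_dist_primitive_le hd hlim (show 0 < ε / 5 by positivity)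
  -- Increments from 0 tend to zero at the nodes i/(n+1) with i ≤ n, and equicontinuity carries this
  -- to all of [0,1]; the point 1 is within δ of the node with i = n.
  obtain ⟨n, hn⟩ := exists_nat_one_div_lt hδ
  have hn0 : (0 : ℝ) < n + 1 := by positivity
  have hpt : ∀ t : ℝ, 0 ≤ t → ∀ᶠ k in atTop,
      dist (primitive (a k) (d k) t) (primitive (a k) (d k) 0) ≤ ε / 5 := by
    intro t ht
    have h1 := hlim ((Ioc 0 t).indicator fun _ => 1)
      (aestronglyMeasurable_const.indicator measurableSet_Ioc) (fun x => by
        rw [norm_indicator_eq_indicator_norm]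
        exact indicator_le_self' (fun _ _ => by simp) x |>.trans (by simp))
    filter_upwards [h1.norm.eventually_le_const (u := ε / 5) (by simp; positivity)] with k hk
    rw [dist_eq_norm, primitive_sub (hd k), intervalIntegral_zeroExt ht,
      ← integral_indicator measurableSet_Ioc]
    refine le_trans (le_of_eq ?_) hk
    congr 2
    ext1 x
    by_cases hx : x ∈ Ioc 0 t <;> simp [hx]
  have hall := (Finset.range (n + 1)).eventually_all.2
    fun i _ => hpt (i / (n + 1 : ℝ)) (by positivity)
  filter_upwards [hall, hmean.norm.eventually_le_const (u := ε / 5) (by simp; positivity)]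
    with k hk hm
  have hosc : ∀ t ∈ Icc (0 : ℝ) 1,
      dist (primitive (a k) (d k) t) (primitive (a k) (d k) 0) ≤ 2 * (ε / 5) := by
    intro t ht
    obtain ⟨i, hi, hit⟩ : ∃ i : ℕ, i < n + 1 ∧ dist t (i / (n + 1 : ℝ)) < δ := by
      rcases ht.2.lt_or_eq with ht1 | rfl
      · refine ⟨⌊t * (n + 1)⌋₊, ?_, ?_⟩
        · rw [Nat.floor_lt (by have := ht.1; positivity)]
          push_cast
          nlinarith
        · have h1 := Nat.floor_le (show 0 ≤ t * (n + 1) by have := ht.1; positivity)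
          have h2 := Nat.lt_floor_add_one (t * (n + 1))
          have h3 : (⌊t * (n + 1)⌋₊ : ℝ) / (n + 1) ≤ t := by rwa [div_le_iff₀ hn0]
          have h4 : t < ⌊t * (n + 1)⌋₊ / (n + 1) + 1 / (n + 1) := by
            rw [← add_div, lt_div_iff₀ hn0]; exact h2
          rw [Real.dist_eq, abs_of_nonneg (by linarith)]
          linarith
      · refine ⟨n, n.lt_succ_self, ?_⟩
        have : (1 : ℝ) - n / (n + 1) = 1 / (n + 1) := by field_simp; ring
        rw [Real.dist_eq, this, abs_of_pos (by positivity)]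
        exact hn
    have h1 := h a k _ _ hit
    have h2 := hk i (Finset.mem_range.2 hi)
    linarith [dist_triangle (primitive (a k) (d k) t) (primitive (a k) (d k) (i / (n + 1 : ℝ)))
      (primitive (a k) (d k) 0)]
  -- The mean differs from the value at 0 by at most the oscillation, so a small mean makes that
  -- value small.
  have h0 : ‖primitive (a k) (d k) 0‖ ≤ 3 * (ε / 5) := by
    have hi := integrable_of_continuous (continuous_primitive (c := a k) (hd k))
    have h1 : ‖∫ x, (primitive (a k) (d k) x - primitive (a k) (d k) 0) ∂μ01‖ ≤ 2 * (ε / 5) := by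
      refine (norm_integral_le_of_norm_le_const (C := 2 * (ε / 5)) ?_).trans (by simp)
      filter_upwards [ae_restrict_mem measurableSet_Ioo] with x hx
      rw [← dist_eq_norm]
      exact hosc x (Ioo_subset_Icc_self hx)
    rw [integral_sub hi (integrable_const _), integral_const, probReal_univ, one_smul] at h1
    have h2 := norm_sub_norm_le (primitive (a k) (d k) 0) (∫ x, primitive (a k) (d k) x ∂μ01)
    rw [norm_sub_rev] at h2
    linarith
  intro t ht
  have h1 := hosc t ht
  rw [dist_eq_norm] at h1
  have h2 := norm_sub_norm_le (primitive (a k) (d k) t) (primitive (a k) (d k) 0)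
  linarith

/-- Differences of representatives are primitives of differences of derivatives. The latter are null
against bounded functions, since these define continuous functionals on W^{1,p}; the two preceding
estimates apply. Adding the uniformly continuous representative of y gives equicontinuity of the
sequence itself. -/
theorem TendstoWeak.tendstoC0_and_isEquicont {yk : ℕ → W1p p} {y : W1p p} (h : TendstoWeak yk y) :
    TendstoC0 yk y ∧ IsEquicont yk := by
  choose c hc using fun k => exists_isContRep_primitive (yk k)
  obtain ⟨b, hb⟩ := exists_isContRep_primitive y
  have hv := fun k => integrable_coe (yk k).1.snd
  have hv' := integrable_coe y.1.snd
  set d : ℕ → ℝ → Plane := fun k x => (yk k).1.snd x - y.1.snd x with hd_def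
  have hd : ∀ k, Integrable (d k) μ01 := fun k => (hv k).sub hv'
  have hdiff : ∀ k t, primitive (c k) (yk k).1.snd t - primitive b y.1.snd t =
      primitive (c k - b) (d k) t := fun k t => primitive_sub_primitive (hv k) hv' t
  have hlim : ∀ g : ℝ → ℝ, AEStronglyMeasurable g μ01 → (∀ x, ‖g x‖ ≤ 1) →
      Tendsto (fun k => ∫ x, g x • d k x ∂μ01) atTop (𝓝 0) := by
    intro g hg hg1
    have h1 := (h.tendsto_integral_snd hg hg1).sub_const (∫ x, g x • y.1.snd x ∂μ01)
    rw [sub_self] at h1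
    refine h1.congr fun k => ?_
    simp only [hd_def, smul_sub]
    rw [integral_sub (integrable_bounded_smul hg hg1 (hv k))
      (integrable_bounded_smul hg hg1 hv')]
  have hmean : Tendsto (fun k => ∫ x, primitive (c k - b) (d k) x ∂μ01) atTop (𝓝 0) := by
    have h1 := h.tendsto_integral_fst.sub_const (∫ x, y.1.fst x ∂μ01)
    rw [sub_self] at h1
    refine h1.congr fun k => ?_
    simp only [← hdiff]
    rw [integral_sub (integrable_of_continuous (continuous_primitive (hv k)))
      (integrable_of_continuous (continuous_primitive hv')), integral_congr_ae (hc k).2,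
      integral_congr_ae hb.2]
  refine ⟨⟨_, _, hc, hb, ?_⟩, _, hc, ?_⟩
  · rw [Metric.tendstoUniformlyOn_iff]
    intro ε hε
    filter_upwards [eventually_forall_norm_primitive_le hd hlim hmean (half_pos hε)] with k hk t ht
    rw [dist_comm, dist_eq_norm, hdiff]
    exact (hk t (Ioo_subset_Icc_self ht)).trans_lt (half_lt_self hε)
  · intro U hU
    obtain ⟨ε, hε, hεU⟩ := Metric.mem_uniformity_dist.1 hU
    obtain ⟨δ, hδ, h1⟩ := exists_forall_dist_primitive_le hd hlim (show 0 < ε / 3 by positivity)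
    obtain ⟨δ', hδ', h2⟩ := Metric.uniformContinuousOn_iff.1
      (isCompact_Icc.uniformContinuousOn_of_continuous (s := Icc (0 : ℝ) 1)
        (continuous_primitive (c := b) hv').continuousOn) (ε / 3) (by positivity)
    rw [eventually_inf_principal]
    filter_upwards [Metric.dist_mem_uniformity (lt_min hδ hδ')]
    rintro ⟨s, t⟩ hst ⟨hs, ht⟩ k
    simp only at hst hs ht ⊢
    apply hεU
    have e1 := h1 (fun k => c k - b) k s t (hst.trans_le (min_le_left _ _))
    have e2 := h2 s (Ioo_subset_Icc_self hs) t (Ioo_subset_Icc_self ht)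
      (hst.trans_le (min_le_right _ _))
    have e3 : ∀ t, primitive (c k) (yk k).1.snd t =
        primitive (c k - b) (d k) t + primitive b y.1.snd t := fun t => by
      rw [← hdiff, sub_add_cancel]
    rw [e3, e3]
    linarith [dist_add_add_le (primitive (c k - b) (d k) s) (primitive b y.1.snd s)
      (primitive (c k - b) (d k) t) (primitive b y.1.snd t)]

end PlanarRod
end

/-! ### L^p convergence and averages over partitions -/

noncomputable section
namespace PlanarRod

section

variable {X E : Type*} [MeasurableSpace X] {μ : Measure X} [NormedAddCommGroup E]

/-- Almost everywhere convergence together with an upper bound on the norms by the norm of the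
limit implies convergence in `L^p`. -/
theorem tendsto_eLpNorm_sub_of_tendsto_ae {p : ℝ≥0∞} (hp1 : 1 ≤ p) (hp : p ≠ ⊤) {f : ℕ → X → E}
    {g : X → E} (hf : ∀ n, AEStronglyMeasurable (f n) μ) (hg : MemLp g p μ)
    (hle : ∀ n, eLpNorm (f n) p μ ≤ eLpNorm g p μ)
    (hlim : ∀ᵐ x ∂μ, Tendsto (fun n => f n x) atTop (𝓝 (g x))) :
    Tendsto (fun n => eLpNorm (f n - g) p μ) atTop (𝓝 0) := by
  have hp0 : p ≠ 0 := (zero_lt_one.trans_le hp1).ne'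
  set q := p.toReal with hq
  have hq1 : 1 ≤ q := by
    rw [hq, ← ENNReal.toReal_one]
    exact ENNReal.toReal_mono hp hp1
  have hq0 : 0 < q := zero_lt_one.trans_le hq1
  have hpow : ∀ h : X → E, eLpNorm h p μ = (∫⁻ x, ‖h x‖ₑ ^ q ∂μ) ^ (1 / q) := fun h =>
    eLpNorm_eq_lintegral_rpow_enorm_toReal hp0 hp
  set C : ℝ≥0∞ := 2 ^ (q - 1) with hC
  have hC_top : C ≠ ⊤ := ENNReal.rpow_ne_top_of_nonneg (by linarith) (by simp)
  set I := ∫⁻ x, ‖g x‖ₑ ^ q ∂μ with hI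
  have hI_top : I ≠ ⊤ := by
    have := hg.2
    rw [hpow] at this
    exact ((ENNReal.rpow_lt_top_iff_of_pos (by positivity)).1 this).ne
  have hIf : ∀ n, ∫⁻ x, ‖f n x‖ₑ ^ q ∂μ ≤ I := fun n => by
    have := hle n
    rw [hpow, hpow] at this
    exact (ENNReal.rpow_le_rpow_iff (by positivity)).1 this
  set B := C * (I + I) with hB
  have hB_top : B ≠ ⊤ := ENNReal.mul_ne_top hC_top (ENNReal.add_ne_top.2 ⟨hI_top, hI_top⟩)
  have mf : ∀ n, AEMeasurable (fun x => ‖f n x‖ₑ ^ q) μ := fun n => (hf n).enorm.pow_const q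
  have mg : AEMeasurable (fun x => ‖g x‖ₑ ^ q) μ := hg.1.enorm.pow_const q
  have md : ∀ n, AEMeasurable (fun x => ‖f n x - g x‖ₑ ^ q) μ := fun n =>
    ((hf n).sub hg.1).enorm.pow_const q
  have hle' : ∀ n x, ‖f n x - g x‖ₑ ^ q ≤ C * (‖f n x‖ₑ ^ q + ‖g x‖ₑ ^ q) := fun n x =>
    (ENNReal.rpow_le_rpow enorm_sub_le hq0.le).trans
      (ENNReal.rpow_add_le_mul_rpow_add_rpow _ _ hq1)
  set e : ℕ → ℝ≥0∞ := fun n => ∫⁻ x, ‖f n x - g x‖ₑ ^ q ∂μ with he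
  -- Fatou is applied to h, where the truncated subtraction is exact by hle'. The integral of h n
  -- plus e n is at most B, while the lower limit of the integrals of h n is already at least B,
  -- which forces e n to zero.
  set h : ℕ → X → ℝ≥0∞ := fun n x => C * (‖f n x‖ₑ ^ q + ‖g x‖ₑ ^ q) - ‖f n x - g x‖ₑ ^ q with hh
  have mh : ∀ n, AEMeasurable (h n) μ := fun n => (((mf n).add mg).const_mul C).sub (md n)
  have hsum : ∀ n, ∫⁻ x, h n x ∂μ + e n ≤ B := by
    intro n
    rw [he, ← lintegral_add_right' _ (md n)]
    simp only [hh, tsub_add_cancel_of_le (hle' n _)]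
    rw [lintegral_const_mul' _ _ hC_top, lintegral_add_left' (mf n)]
    exact mul_le_mul' le_rfl (add_le_add (hIf n) le_rfl)
  have hliminf : B ≤ liminf (fun n => ∫⁻ x, h n x ∂μ) atTop := by
    refine le_trans (le_of_eq ?_) (lintegral_liminf_le' mh)
    rw [hB, hI, ← lintegral_add_left' mg, ← lintegral_const_mul' _ _ hC_top]
    refine lintegral_congr_ae ?_
    filter_upwards [hlim] with x hx
    have hgx : ‖g x‖ₑ ^ q ≠ ⊤ := ENNReal.rpow_ne_top_of_nonneg hq0.le enorm_ne_top
    have t1 : Tendsto (fun n => ‖f n x‖ₑ ^ q) atTop (𝓝 (‖g x‖ₑ ^ q)) :=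
      (ENNReal.continuous_rpow_const.tendsto _).comp hx.enorm
    have t2 : Tendsto (fun n => ‖f n x - g x‖ₑ ^ q) atTop (𝓝 0) := by
      have := (ENNReal.continuous_rpow_const (y := q)).tendsto _ |>.comp (hx.sub_const (g x)).enorm
      simpa [Function.comp_def, hq0] using this
    have t3 := ENNReal.Tendsto.sub (ENNReal.Tendsto.const_mul (a := C) (t1.add_const (‖g x‖ₑ ^ q))
      (Or.inr hC_top)) t2 (Or.inl (ENNReal.mul_ne_top hC_top (ENNReal.add_ne_top.2 ⟨hgx, hgx⟩)))
    rw [tsub_zero] at t3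
    exact t3.liminf_eq.symm
  have he0 : Tendsto e atTop (𝓝 0) := by
    rw [ENNReal.tendsto_nhds_zero]
    intro ε hε
    rcases le_or_gt B ε with hBε | hBε
    · exact Eventually.of_forall fun n => (le_add_self.trans (hsum n)).trans hBε
    · have hb : B - ε < B := ENNReal.sub_lt_self hB_top (hε.trans hBε).ne' hε.ne'
      filter_upwards [eventually_lt_of_lt_liminf (hb.trans_le hliminf)] with n hn
      have h1 : e n ≤ B - ∫⁻ x, h n x ∂μ :=
        ENNReal.le_sub_of_add_le_left
          (ne_top_of_le_ne_top hB_top (le_self_add.trans (hsum n))) (hsum n)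
      refine h1.trans ((tsub_le_tsub_left hn.le _).trans ?_)
      exact tsub_tsub_le
  have := (ENNReal.continuous_rpow_const (y := 1 / q)).tendsto _ |>.comp he0
  rw [ENNReal.zero_rpow_of_pos (by positivity)] at this
  exact this.congr fun n => (hpow _).symm

/-- Jensen's inequality for the average of a function. -/
theorem eLpNorm_const_average_le [NormedSpace ℝ E] {p : ℝ≥0∞} (hp1 : 1 ≤ p)
    [IsFiniteMeasure μ] {f : X → E} (hf : AEStronglyMeasurable f μ) {a : E}
    (ha : μ.real univ • a = ∫ x, f x ∂μ) : eLpNorm (fun _ => a) p μ ≤ eLpNorm f p μ := by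
  rcases eq_or_ne μ 0 with rfl | hμ
  · simp
  have hp0 : p ≠ 0 := (zero_lt_one.trans_le hp1).ne'
  have h0 : μ univ ≠ 0 := by simpa using hμ
  have ht : μ univ ≠ ⊤ := measure_ne_top _ _
  rw [eLpNorm_const _ hp0 hμ]
  have h1 : μ univ * ‖a‖ₑ ≤ eLpNorm f p μ * μ univ ^ (1 - 1 / p.toReal) := by
    calc μ univ * ‖a‖ₑ = ‖μ.real univ • a‖ₑ := by
          rw [enorm_smul, Real.enorm_of_nonneg measureReal_nonneg, ofReal_measureReal]
      _ ≤ eLpNorm f 1 μ := by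
          rw [ha, eLpNorm_one_eq_lintegral_enorm]; exact enorm_integral_le_lintegral_enorm _
      _ ≤ _ := by
          simpa using eLpNorm_le_eLpNorm_mul_rpow_measure_univ hp1 hf
  have h2 : μ univ ^ (1 - 1 / p.toReal) ≠ 0 := (ENNReal.rpow_pos h0.bot_lt ht).ne'
  have h3 : μ univ ^ (1 - 1 / p.toReal) ≠ ⊤ := by
    rw [ne_eq, ENNReal.rpow_eq_top_iff]
    simp [h0, ht]
  rw [← ENNReal.mul_le_mul_iff_left h2 h3]
  calc ‖a‖ₑ * μ univ ^ (1 / p.toReal) * μ univ ^ (1 - 1 / p.toReal)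
      = μ univ * ‖a‖ₑ := by
        rw [mul_assoc, ← ENNReal.rpow_add _ _ h0 ht, add_sub_cancel, ENNReal.rpow_one, mul_comm]
    _ ≤ _ := h1

end

section

variable {E : Type*} [NormedAddCommGroup E] {N : ℕ} {τ : ℕ → ℝ} {a : ℕ → E}

/-- The step function with value `a i` on `[τ i, τ (i + 1))` for `i < N`, and zero elsewhere. -/
def stepFun (N : ℕ) (τ : ℕ → ℝ) (a : ℕ → E) (t : ℝ) : E :=
  ∑ i ∈ Finset.range N, (Ico (τ i) (τ (i + 1))).indicator (fun _ => a i) t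

theorem le_of_forall_lt_succ (hτ : ∀ i < N, τ i < τ (i + 1)) {i j : ℕ} (hij : i ≤ j) (hj : j ≤ N) :
    τ i ≤ τ j := by
  induction j, hij using Nat.le_induction with
  | base => exact le_rfl
  | succ j _ ih => exact (ih (by omega)).trans (hτ j (by omega)).le

theorem exists_mem_Ico (n : ℕ) {t : ℝ} (ht : t ∈ Ico (τ 0) (τ n)) :
    ∃ i < n, t ∈ Ico (τ i) (τ (i + 1)) := by
  induction n with
  | zero => exact absurd ht.2 (not_lt.2 ht.1)
  | succ n ih =>
    rcases lt_or_ge t (τ n) with h | h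
    · obtain ⟨i, hi, hti⟩ := ih ⟨ht.1, h⟩
      exact ⟨i, by omega, hti⟩
    · exact ⟨n, by omega, h, ht.2⟩

theorem stepFun_eq (hτ : ∀ i < N, τ i < τ (i + 1)) {i : ℕ} (hi : i < N) {t : ℝ}
    (ht : t ∈ Ico (τ i) (τ (i + 1))) : stepFun N τ a t = a i := by
  rw [stepFun, Finset.sum_eq_single_of_mem i (Finset.mem_range.2 hi), indicator_of_mem ht]
  intro j hj hji
  rw [Finset.mem_range] at hj
  refine indicator_of_notMem (fun h => ?_) _
  rcases lt_or_gt_of_ne hji with h' | h'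
  · exact absurd (h.2.trans_le (le_of_forall_lt_succ hτ h' hi.le)) (not_lt.2 ht.1)
  · exact absurd (ht.2.trans_le (le_of_forall_lt_succ hτ h' hj.le)) (not_lt.2 h.1)

theorem stepFun_eq_zero (hτ : ∀ i < N, τ i < τ (i + 1)) {t : ℝ} (ht : t ∉ Ico (τ 0) (τ N)) :
    stepFun N τ a t = 0 := by
  refine Finset.sum_eq_zero fun i hi => indicator_of_notMem (fun h => ht ⟨?_, ?_⟩) _
  · exact (le_of_forall_lt_succ hτ (Nat.zero_le i) (Finset.mem_range.1 hi).le).trans h.1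
  · exact h.2.trans_le (le_of_forall_lt_succ hτ (Finset.mem_range.1 hi) le_rfl)

theorem stronglyMeasurable_stepFun : StronglyMeasurable (stepFun N τ a) :=
  Finset.stronglyMeasurable_fun_sum _ fun _ _ =>
    stronglyMeasurable_const.indicator measurableSet_Ico

theorem norm_stepFun_le (hτ : ∀ i < N, τ i < τ (i + 1)) {K : ℝ} (hK0 : 0 ≤ K)
    (hK : ∀ i < N, ‖a i‖ ≤ K) (t : ℝ) : ‖stepFun N τ a t‖ ≤ K := by
  by_cases ht : t ∈ Ico (τ 0) (τ N)
  · obtain ⟨i, hi, hti⟩ := exists_mem_Ico N ht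
    rw [stepFun_eq hτ hi hti]
    exact hK i hi
  · rwa [stepFun_eq_zero hτ ht, norm_zero]

theorem integrable_stepFun : Integrable (stepFun N τ a) :=
  integrable_finsetSum _ fun _ _ =>
    (integrable_indicator_iff measurableSet_Ico).2 (integrableOn_const (by simp))

theorem integral_stepFun [NormedSpace ℝ E] [CompleteSpace E] (hτ : ∀ i < N, τ i < τ (i + 1))
    {i : ℕ} (hi : i < N) {t : ℝ} (ht : t ∈ Icc (τ i) (τ (i + 1))) :
    ∫ x in (τ i)..t, stepFun N τ a x = (t - τ i) • a i := by
  rw [← intervalIntegral.integral_const]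
  refine intervalIntegral.integral_congr_ae ?_
  filter_upwards [compl_mem_ae_iff.2 (measure_singleton (τ (i + 1)))] with x hx hx'
  rw [uIoc_of_le ht.1] at hx'
  exact stepFun_eq hτ hi ⟨hx'.1.le, lt_of_le_of_ne (hx'.2.trans ht.2) hx⟩

/-- Averaging over the intervals of a partition does not increase the `L^p` norm. -/
theorem eLpNorm_stepFun_le [NormedSpace ℝ E] {p : ℝ≥0∞} (hp1 : 1 ≤ p) (hp : p ≠ ⊤)
    (hτ : ∀ i < N, τ i < τ (i + 1)) {f : ℝ → E} (hf : AEStronglyMeasurable f)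
    (ha : ∀ i < N, (τ (i + 1) - τ i) • a i = ∫ x in (τ i)..(τ (i + 1)), f x) :
    eLpNorm (stepFun N τ a) p volume ≤ eLpNorm f p volume := by
  have hp0 : p ≠ 0 := (zero_lt_one.trans_le hp1).ne'
  have hq0 : 0 < p.toReal := ENNReal.toReal_pos hp0 hp
  have hpow : ∀ (μ : Measure ℝ) (h : ℝ → E),
      eLpNorm h p μ = (∫⁻ x, ‖h x‖ₑ ^ p.toReal ∂μ) ^ (1 / p.toReal) := fun μ h =>
    eLpNorm_eq_lintegral_rpow_enorm_toReal hp0 hp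
  rw [hpow, hpow]
  refine ENNReal.rpow_le_rpow ?_ (by positivity)
  have hpiece : ∀ i < N, ∫⁻ x in Ico (τ i) (τ (i + 1)), ‖stepFun N τ a x‖ₑ ^ p.toReal ≤
      ∫⁻ x in Ico (τ i) (τ (i + 1)), ‖f x‖ₑ ^ p.toReal := by
    intro i hi
    have h1 := eLpNorm_const_average_le (μ := volume.restrict (Ico (τ i) (τ (i + 1)))) hp1
      hf.restrict (a := a i) (by
        rw [measureReal_restrict_apply_univ, Real.volume_real_Ico_of_le (hτ i hi).le, ha i hi,
          intervalIntegral.integral_of_le (hτ i hi).le, integral_Ico_eq_integral_Ioc])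
    rw [hpow, hpow, ENNReal.rpow_le_rpow_iff (by positivity)] at h1
    refine le_trans (le_of_eq ?_) h1
    refine setLIntegral_congr_fun measurableSet_Ico fun x hx => ?_
    simp only [stepFun_eq hτ hi hx]
  have hind : ∀ n ≤ N, ∫⁻ x in Ico (τ 0) (τ n), ‖stepFun N τ a x‖ₑ ^ p.toReal ≤
      ∫⁻ x in Ico (τ 0) (τ n), ‖f x‖ₑ ^ p.toReal := by
    intro n hn
    induction n with
    | zero => simp
    | succ n ih =>
      rw [← Ico_union_Ico_eq_Ico (le_of_forall_lt_succ hτ (Nat.zero_le n) (by omega))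
        (hτ n (by omega)).le, lintegral_union measurableSet_Ico (Ico_disjoint_Ico_same ..),
        lintegral_union measurableSet_Ico (Ico_disjoint_Ico_same ..)]
      exact add_le_add (ih (by omega)) (hpiece n (by omega))
  calc ∫⁻ x, ‖stepFun N τ a x‖ₑ ^ p.toReal
      = ∫⁻ x in Ico (τ 0) (τ N), ‖stepFun N τ a x‖ₑ ^ p.toReal := by
        rw [← lintegral_indicator measurableSet_Ico]
        refine lintegral_congr fun x => ?_
        by_cases hx : x ∈ Ico (τ 0) (τ N)
        · rw [indicator_of_mem hx]
        · rw [indicator_of_notMem hx, stepFun_eq_zero hτ hx, enorm_zero,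
            ENNReal.zero_rpow_of_pos hq0]
    _ ≤ _ := (hind N le_rfl).trans (setLIntegral_le_lintegral _ _)

end

end PlanarRod
end

/-! ### Difference quotients over intervals of small oscillation -/

noncomputable section
namespace PlanarRod

section

variable {E : Type*} [NormedAddCommGroup E] [NormedSpace ℝ E] {u : ℝ → E} {v : E} {t : ℝ}

theorem exists_forall_norm_sub_le (h : HasDerivAt u v t) {ε : ℝ} (hε : 0 < ε) :
    ∃ δ > 0, ∀ s, |s - t| ≤ δ → ‖u s - u t - (s - t) • v‖ ≤ ε * |s - t| := by
  have h1 := (hasDerivAt_iff_isLittleO.1 h).def hε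
  obtain ⟨δ, hδ, hball⟩ := Metric.eventually_nhds_iff.1 h1
  refine ⟨δ / 2, half_pos hδ, fun s hs => ?_⟩
  exact hball (by rw [Real.dist_eq]; linarith)

/-- If the oscillation on a long interval is small then so is the derivative. -/
theorem exists_forall_norm_deriv_le (h : HasDerivAt u v t) {ε ℓ : ℝ} (hε : 0 < ε) (hℓ : 0 < ℓ) :
    ∃ η > 0, ∀ a b, a ≤ t → t ≤ b → ℓ ≤ b - a →
      (∀ s ∈ Icc a b, ∀ s' ∈ Icc a b, dist (u s) (u s') ≤ η) → ‖v‖ ≤ ε := by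
  obtain ⟨δ, hδ, hd⟩ := exists_forall_norm_sub_le h (half_pos hε)
  -- Small enough for the linearization at t, and for a point at distance exactly d from t to fit
  -- into [a, b].
  set d := min δ (ℓ / 2) with hd'
  have hd0 : 0 < d := lt_min hδ (by positivity)
  refine ⟨ε / 2 * d, by positivity, fun a b hat htb hab hosc => ?_⟩
  obtain ⟨s, hs, hst⟩ : ∃ s ∈ Icc a b, |s - t| = d := by
    have := min_le_right δ (ℓ / 2)
    rcases le_or_gt (t + d) b with h1 | h1
    · exact ⟨t + d, ⟨by linarith, h1⟩, by rw [add_sub_cancel_left, abs_of_pos hd0]⟩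
    · exact ⟨t - d, ⟨by linarith, by linarith⟩, by
        rw [sub_sub_cancel_left, abs_neg, abs_of_pos hd0]⟩
  have h1 := hd s (hst.trans_le (min_le_left _ _))
  have h2 := hosc s hs t ⟨hat, htb⟩
  rw [dist_eq_norm] at h2
  have h3 : ‖(s - t) • v‖ ≤ ‖u s - u t‖ + ‖u s - u t - (s - t) • v‖ := by
    have := norm_sub_le (u s - u t) (u s - u t - (s - t) • v)
    rwa [sub_sub_cancel] at this
  rw [norm_smul, Real.norm_eq_abs, hst] at h3
  rw [hst] at h1
  nlinarith

/-- Difference quotients over intervals with small oscillation approximate the derivative. -/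
theorem exists_forall_norm_slope_sub_le (h : HasDerivAt u v t) {ε : ℝ} (hε : 0 < ε) :
    ∃ η > 0, ∀ a b, a ≤ t → t ≤ b → a < b →
      (∀ s ∈ Icc a b, ∀ s' ∈ Icc a b, dist (u s) (u s') ≤ η) →
      ‖(b - a)⁻¹ • (u b - u a) - v‖ ≤ ε := by
  obtain ⟨δ, hδ, hd⟩ := exists_forall_norm_sub_le h hε
  obtain ⟨η, hη, hlong⟩ := exists_forall_norm_deriv_le h (half_pos hε) hδ
  refine ⟨min η (ε / 2 * δ), lt_min hη (by positivity), fun a b hat htb hab hosc => ?_⟩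
  have hba : 0 < b - a := sub_pos.2 hab
  -- A short interval is governed by differentiability at t. On a long one the derivative is small
  -- by `exists_forall_norm_deriv_le`, and so is the quotient.
  rcases le_or_gt (b - a) δ with hshort | hlen
  · have h1 := hd a (by rw [abs_of_nonpos] <;> linarith)
    have h2 := hd b (by rw [abs_of_nonneg] <;> linarith)
    rw [abs_of_nonpos (by linarith)] at h1
    rw [abs_of_nonneg (by linarith)] at h2
    have h3 : (b - a)⁻¹ • (u b - u a) - v =
        (b - a)⁻¹ • ((u b - u t - (b - t) • v) - (u a - u t - (a - t) • v)) := by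
      have : (u b - u t - (b - t) • v) - (u a - u t - (a - t) • v) =
          (u b - u a) - (b - a) • v := by module
      rw [this, smul_sub _ (u b - u a), smul_smul, inv_mul_cancel₀ hba.ne', one_smul]
    rw [h3, norm_smul, norm_inv, Real.norm_of_nonneg hba.le, inv_mul_le_iff₀ hba]
    refine (norm_sub_le _ _).trans ?_
    linarith
  · have h1 := hlong a b hat htb hlen.le fun s hs s' hs' =>
      (hosc s hs s' hs').trans (min_le_left _ _)
    have h2 := (hosc b (right_mem_Icc.2 hab.le) a (left_mem_Icc.2 hab.le)).trans (min_le_right _ _)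
    rw [dist_eq_norm] at h2
    have h3 : ‖(b - a)⁻¹ • (u b - u a)‖ ≤ ε / 2 := by
      rw [norm_smul, norm_inv, Real.norm_of_nonneg hba.le, inv_mul_le_iff₀ hba]
      nlinarith
    linarith [norm_sub_le ((b - a)⁻¹ • (u b - u a)) v]

/-- `A` is, at each point of `(0,1)`, a difference quotient of `u` over an interval on which `u`
oscillates by at most `η`, or zero if that interval reaches the boundary. -/
def IsSlopeApprox (u : ℝ → E) (η : ℝ) (A : ℝ → E) : Prop :=
  ∀ t ∈ Ioo (0 : ℝ) 1, ∃ a b, a ≤ t ∧ t ≤ b ∧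
    (∀ s ∈ Icc a b, ∀ s' ∈ Icc a b, dist (u s) (u s') ≤ η) ∧
    (a < b ∧ A t = (b - a)⁻¹ • (u b - u a) ∨ A t = 0 ∧ (a = 0 ∨ b = 1))

/-- Only the oscillation on the intervals has to shrink, not their length. A boundary interval
around t has length at least min t (1 - t), so the derivative at t is small there, in agreement with
the value 0. -/
theorem tendsto_of_isSlopeApprox (h : HasDerivAt u v t) (ht : t ∈ Ioo (0 : ℝ) 1) {η : ℕ → ℝ}
    (hη : Tendsto η atTop (𝓝 0)) {A : ℕ → ℝ → E} (hA : ∀ n, IsSlopeApprox u (η n) (A n)) :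
    Tendsto (fun n => A n t) atTop (𝓝 v) := by
  rw [Metric.tendsto_nhds]
  intro ε hε
  obtain ⟨η₁, hη₁, h₁⟩ := exists_forall_norm_slope_sub_le h (half_pos hε)
  obtain ⟨η₂, hη₂, h₂⟩ := exists_forall_norm_deriv_le h (half_pos hε)
    (show 0 < min t (1 - t) from lt_min ht.1 (sub_pos.2 ht.2))
  filter_upwards [hη.eventually_le_const hη₁, hη.eventually_le_const hη₂] with n hn₁ hn₂
  rw [dist_eq_norm]
  refine lt_of_le_of_lt ?_ (half_lt_self hε)
  obtain ⟨a, b, hat, htb, hosc, ⟨hab, hAt⟩ | ⟨hAt, hend⟩⟩ := hA n t ht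
  · rw [hAt]
    exact h₁ a b hat htb hab fun s hs s' hs' => (hosc s hs s' hs').trans hn₁
  · rw [hAt, zero_sub, norm_neg]
    refine h₂ a b hat htb ?_ fun s hs s' hs' => (hosc s hs s' hs').trans hn₂
    rcases hend with rfl | rfl
    · exact (min_le_left _ _).trans (by linarith)
    · exact (min_le_right _ _).trans (by linarith)

/-- The primitive of the step function interpolating the vertices of an injective polygonal curve
is a reparametrization of that curve. -/
theorem injOn_integral_stepFun [CompleteSpace E] {N : ℕ} {τ ξ : ℕ → ℝ} {χ : ℝ → E} {a : ℕ → E}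
    (hN : 0 < N) (hτ : ∀ i < N, τ i < τ (i + 1)) (hξ : ∀ i < N, ξ i < ξ (i + 1))
    (hinj : InjOn χ (Icc (ξ 0) (ξ N)))
    (haff : ∀ i < N, ∀ t ∈ Icc (ξ i) (ξ (i + 1)), χ t =
      AffineMap.lineMap (χ (ξ i)) (χ (ξ (i + 1))) ((t - ξ i) / (ξ (i + 1) - ξ i)))
    (ha : ∀ i < N, a i = (τ (i + 1) - τ i)⁻¹ • (χ (ξ (i + 1)) - χ (ξ i))) :
    InjOn (fun t => χ (ξ 0) + ∫ x in (τ 0)..t, stepFun N τ a x) (Icc (τ 0) (τ N)) := by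
  set ψ : ℝ → E := fun t => χ (ξ 0) + ∫ x in (τ 0)..t, stepFun N τ a x with hψ
  have hii : ∀ s t : ℝ, IntervalIntegrable (stepFun N τ a) volume s t := fun s t =>
    integrable_stepFun.intervalIntegrable
  have hstep : ∀ i < N, ∀ t ∈ Icc (τ i) (τ (i + 1)), ψ t = ψ (τ i) + (t - τ i) • a i := by
    intro i hi t ht
    rw [← integral_stepFun hτ hi ht]
    simp only [hψ]
    rw [add_assoc, intervalIntegral.integral_add_adjacent_intervals (hii _ _) (hii _ _)]
  have hnode : ∀ i ≤ N, ψ (τ i) = χ (ξ i) := by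
    intro i hi
    induction i with
    | zero => simp [hψ]
    | succ i ih =>
      rw [hstep i (by omega) _ (right_mem_Icc.2 (hτ i (by omega)).le), ih (by omega),
        ha i (by omega), smul_smul, mul_inv_cancel₀ (sub_pos.2 (hτ i (by omega))).ne', one_smul,
        add_sub_cancel]
  -- The increasing affine map of the i-th interval of τ onto that of ξ; on that interval ψ is χ
  -- composed with it.
  let H : ℕ → ℝ → ℝ := fun i t => ξ i + (t - τ i) / (τ (i + 1) - τ i) * (ξ (i + 1) - ξ i)
  have hHmem : ∀ i < N, ∀ t ∈ Icc (τ i) (τ (i + 1)), H i t ∈ Icc (ξ i) (ξ (i + 1)) := by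
    intro i hi t ht
    have h1 := sub_pos.2 (hτ i hi)
    have h2 := sub_pos.2 (hξ i hi)
    have h3 : 0 ≤ (t - τ i) / (τ (i + 1) - τ i) := div_nonneg (sub_nonneg.2 ht.1) h1.le
    have h4 : (t - τ i) / (τ (i + 1) - τ i) ≤ 1 := by
      rw [div_le_one h1]; linarith [ht.2]
    constructor <;> simp only [H] <;> nlinarith
  have hψH : ∀ i < N, ∀ t ∈ Icc (τ i) (τ (i + 1)), ψ t = χ (H i t) := by
    intro i hi t ht
    have h2 := sub_pos.2 (hξ i hi)
    rw [haff i hi _ (hHmem i hi t ht), hstep i hi t ht, hnode i hi.le, ha i hi]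
    simp only [H, add_sub_cancel_left]
    rw [mul_div_cancel_right₀ _ h2.ne', AffineMap.lineMap_apply_module', smul_smul, div_eq_mul_inv,
      add_comm]
  have hHmono : ∀ i < N, ∀ s t, s < t → H i s < H i t := by
    intro i hi s t hst
    have h1 := sub_pos.2 (hτ i hi)
    have h2 := sub_pos.2 (hξ i hi)
    simp only [H]
    have : (s - τ i) / (τ (i + 1) - τ i) < (t - τ i) / (τ (i + 1) - τ i) :=
      div_lt_div_of_pos_right (by linarith) h1
    nlinarith
  have hmem : ∀ i < N, ∀ x ∈ Icc (ξ i) (ξ (i + 1)), x ∈ Icc (ξ 0) (ξ N) := fun i hi x hx =>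
    ⟨(le_of_forall_lt_succ hξ (Nat.zero_le i) hi.le).trans hx.1,
      hx.2.trans (le_of_forall_lt_succ hξ hi le_rfl)⟩
  have hlt : ∀ s ∈ Icc (τ 0) (τ N), ∀ t ∈ Icc (τ 0) (τ N), s < t → ψ s ≠ ψ t := by
    intro s hs t ht hst heq
    obtain ⟨i, hi, hsi⟩ := exists_mem_Ico N ⟨hs.1, hst.trans_le ht.2⟩
    have hsi' := Ico_subset_Icc_self hsi
    rw [hψH i hi s hsi'] at heq
    rcases le_or_gt t (τ (i + 1)) with hti | hti
    · have hti' : t ∈ Icc (τ i) (τ (i + 1)) := ⟨hsi.1.trans hst.le, hti⟩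
      rw [hψH i hi t hti'] at heq
      exact (hHmono i hi s t hst).ne (hinj (hmem i hi _ (hHmem i hi s hsi'))
        (hmem i hi _ (hHmem i hi t hti')) heq)
    · obtain ⟨j, hj, htj⟩ : ∃ j < N, t ∈ Icc (τ j) (τ (j + 1)) := by
        rcases ht.2.lt_or_eq with h | h
        · obtain ⟨j, hj, htj⟩ := exists_mem_Ico N ⟨ht.1, h⟩
          exact ⟨j, hj, Ico_subset_Icc_self htj⟩
        · obtain ⟨n, rfl⟩ := Nat.exists_eq_succ_of_ne_zero hN.ne'
          exact ⟨n, n.lt_succ_self, by rw [h]; exact right_mem_Icc.2 (hτ n n.lt_succ_self).le⟩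
      have hij : i + 1 ≤ j := by
        by_contra hcon
        have := le_of_forall_lt_succ hτ (show j + 1 ≤ i + 1 by omega) hi
        linarith [htj.2]
      rw [hψH j hj t htj] at heq
      have h1 := hinj (hmem i hi _ (hHmem i hi s hsi')) (hmem j hj _ (hHmem j hj t htj)) heq
      have h2 : H i s < ξ (i + 1) := by
        have h3 := hHmono i hi s _ hsi.2
        have h4 := (hHmem i hi _ (right_mem_Icc.2 (hτ i hi).le)).2
        linarith
      have h5 := (hHmem j hj t htj).1
      have h6 := le_of_forall_lt_succ hξ hij hj.le
      linarith
  intro s hs t ht heq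
  rcases lt_trichotomy s t with h | h | h
  · exact absurd heq (hlt s hs t ht h)
  · exact h
  · exact absurd heq.symm (hlt t ht s hs h)

end

end PlanarRod
end

/-! ### Reparametrizing the polygon -/

noncomputable section
namespace PlanarRod

theorem exists_pos_separation (T : Finset ℝ) (hT : ∀ t ∈ T, t ∈ Ioo (0 : ℝ) 1) :
    ∃ γ > 0, ∀ s ∈ T, γ ≤ s ∧ γ ≤ 1 - s ∧ ∀ t ∈ T, s < t → γ ≤ t - s := by
  have hle : ∀ c : ℝ, 0 < c → ∀ᶠ γ in 𝓝[>] (0 : ℝ), γ ≤ c := fun c hc =>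
    eventually_nhdsWithin_of_eventually_nhds (Iic_mem_nhds hc)
  have h1 : ∀ᶠ γ in 𝓝[>] (0 : ℝ), ∀ s ∈ T, γ ≤ s ∧ γ ≤ 1 - s ∧ ∀ t ∈ T, s < t → γ ≤ t - s := by
    refine (T.eventually_all).2 fun s hs => (hle s (hT s hs).1).and
      ((hle _ (sub_pos.2 (hT s hs).2)).and ((T.eventually_all).2 fun t _ => ?_))
    by_cases hst : s < t
    · filter_upwards [hle _ (sub_pos.2 hst)] with γ hγ _ using hγ
    · exact Eventually.of_forall fun _ h => absurd h hst
  obtain ⟨γ, hγ, hγ0⟩ := (h1.and self_mem_nhdsWithin).exists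
  exact ⟨γ, hγ0, hγ⟩

/-- The `L^p` norm of a bounded function that is small off a neighbourhood of a finite set. -/
theorem eLpNorm_le_of_forall_notMem {p : ℝ≥0∞} [Fact (1 ≤ p)] (hp : p ≠ ⊤) {f : ℝ → Plane}
    (T : Finset ℝ) {ε K θ : ℝ} (hε : 0 ≤ ε) (hK : 0 ≤ K)
    (hsmall : ∀ t ∈ Ioo (0 : ℝ) 1, (∀ s ∈ T, t ∉ Icc (s - θ) (s + θ)) → ‖f t‖ ≤ ε)
    (hbdd : ∀ t ∈ Ioo (0 : ℝ) 1, ‖f t‖ ≤ K) :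
    eLpNorm f p μ01 ≤ ENNReal.ofReal ε +
      ENNReal.ofReal K * ENNReal.ofReal (T.card * (2 * θ)) ^ (1 / p.toReal) := by
  have hp1 : 1 ≤ p := Fact.out
  have hp0 : p ≠ 0 := (zero_lt_one.trans_le hp1).ne'
  set B : Set ℝ := ⋃ s ∈ T, Icc (s - θ) (s + θ) with hB
  have hBm : MeasurableSet B := T.measurableSet_biUnion fun _ _ => measurableSet_Icc
  have hBv : μ01 B ≤ ENNReal.ofReal (T.card * (2 * θ)) := by
    refine (Measure.restrict_apply_le _ _).trans ((measure_biUnion_finset_le _ _).trans ?_)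
    have : ∀ s : ℝ, volume (Icc (s - θ) (s + θ)) = ENNReal.ofReal (2 * θ) := fun s => by
      rw [Real.volume_Icc]; congr 1; ring
    simp only [this, Finset.sum_const, nsmul_eq_mul]
    rw [← ENNReal.ofReal_natCast, ← ENNReal.ofReal_mul (by positivity)]
  have hle : eLpNorm f p μ01 ≤ eLpNorm (fun t => ε + B.indicator (fun _ => K) t) p μ01 := by
    refine eLpNorm_mono_ae_real ?_
    filter_upwards [ae_restrict_mem measurableSet_Ioo] with t ht
    by_cases htB : t ∈ B
    · rw [indicator_of_mem htB]
      linarith [hbdd t ht]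
    · rw [indicator_of_notMem htB, add_zero]
      exact hsmall t ht fun s hs hts => htB (mem_biUnion hs hts)
  refine hle.trans ((eLpNorm_add_le (f := fun _ => ε) (g := B.indicator fun _ => K)
    aestronglyMeasurable_const (aestronglyMeasurable_const.indicator hBm) hp1).trans ?_)
  refine add_le_add ?_ ?_
  · rw [eLpNorm_const _ hp0 (NeZero.ne _), measure_univ, ENNReal.one_rpow, mul_one,
      Real.enorm_of_nonneg hε]
  · rw [eLpNorm_indicator_const hBm hp0 hp, Real.enorm_of_nonneg hK]
    gcongr

/-- Parameters of the polygonal approximation: how much to cut off around the nodes. -/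
theorem exists_cut {p : ℝ≥0∞} [Fact (1 ≤ p)] (hp : p ≠ ⊤) (n : ℕ) {γ K G ε : ℝ} (hγ : 0 < γ)
    (hε : 0 < ε) :
    ∃ θ > 0, 4 * θ < γ ∧ 4 * θ * G ≤ ε * γ ^ 2 ∧
      ENNReal.ofReal K * ENNReal.ofReal (n * (2 * θ)) ^ (1 / p.toReal) ≤ ENNReal.ofReal ε := by
  have hp0 : p ≠ 0 := (zero_lt_one.trans_le Fact.out).ne'
  have hq0 : 0 < p.toReal := ENNReal.toReal_pos hp0 hp
  have c1 : Tendsto (fun θ : ℝ => 4 * θ) (𝓝[>] 0) (𝓝 0) :=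
    ((continuous_const.mul continuous_id).tendsto' 0 0 (by simp)).mono_left nhdsWithin_le_nhds
  have c2 : Tendsto (fun θ : ℝ => 4 * θ * G) (𝓝[>] 0) (𝓝 0) := by simpa using c1.mul_const G
  have c3 : Tendsto (fun θ : ℝ => ENNReal.ofReal K *
      ENNReal.ofReal (n * (2 * θ)) ^ (1 / p.toReal)) (𝓝[>] 0) (𝓝 0) := by
    have h1 : Tendsto (fun θ : ℝ => ENNReal.ofReal (n * (2 * θ))) (𝓝[>] 0) (𝓝 0) := by
      refine Tendsto.mono_left ?_ nhdsWithin_le_nhds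
      exact (ENNReal.continuous_ofReal.comp
        (continuous_const.mul (continuous_const.mul continuous_id))).tendsto' 0 0 (by simp)
    have h2 := (ENNReal.continuous_rpow_const (y := 1 / p.toReal)).tendsto 0 |>.comp h1
    rw [ENNReal.zero_rpow_of_pos (by positivity)] at h2
    simpa using ENNReal.Tendsto.const_mul (a := ENNReal.ofReal K) h2 (Or.inr ENNReal.ofReal_ne_top)
  obtain ⟨θ, ⟨⟨h1, h2⟩, h3⟩, hθ⟩ := (((c1.eventually_lt_const hγ).and
    (c2.eventually_le_const (show 0 < ε * γ ^ 2 by positivity))).and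
    (c3.eventually_le_const (ENNReal.ofReal_pos.2 hε))).and self_mem_nhdsWithin |>.exists
  exact ⟨θ, hθ, h1, h2, h3⟩

namespace PolygonalModel

variable {u : ℝ → Plane} {T : Finset ℝ} {ρ η : ℝ} (M : PolygonalModel u T ρ η)

/-- The vertex parameters of the polygon, in increasing order. -/
def vertex (i : ℕ) : ℝ := if i % 2 = 0 then M.l (i / 2) else M.r (i / 2)

/-- The parameters in `[0,1]` at which the reparametrized polygon passes its vertices. -/
def node (θ : ℝ) (i : ℕ) : ℝ :=
  if i = 0 then 0 else if i = 2 * M.m + 1 then 1 else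
    if i % 2 = 0 then M.σ (i / 2) - θ else M.σ (i / 2) + θ

/-- The slopes of the reparametrized polygon. -/
def slope (θ : ℝ) (i : ℕ) : Plane :=
  (M.node θ (i + 1) - M.node θ i)⁻¹ • (M.χ (M.vertex (i + 1)) - M.χ (M.vertex i))

theorem vertex_even (k : ℕ) : M.vertex (2 * k) = M.l k := by
  rw [vertex, if_pos (by omega)]
  congr 1; omega

theorem vertex_odd (k : ℕ) : M.vertex (2 * k + 1) = M.r k := by
  rw [vertex, if_neg (by omega)]
  congr 1; omega

theorem node_zero (θ : ℝ) : M.node θ 0 = 0 := if_pos rfl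

theorem node_last (θ : ℝ) : M.node θ (2 * M.m + 1) = 1 := by
  rw [node, if_neg (by omega), if_pos rfl]

theorem node_even (θ : ℝ) {k : ℕ} (hk : k ≠ 0) : M.node θ (2 * k) = M.σ k - θ := by
  rw [node, if_neg (by omega), if_neg (by omega), if_pos (by omega)]
  congr 2; omega

theorem node_odd (θ : ℝ) {k : ℕ} (hk : k ≠ M.m) : M.node θ (2 * k + 1) = M.σ k + θ := by
  rw [node, if_neg (by omega), if_neg (by omega), if_neg (by omega)]
  congr 2; omega

theorem vertex_lt : ∀ i < 2 * M.m + 1, M.vertex i < M.vertex (i + 1) := by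
  intro i hi
  obtain ⟨k, rfl | rfl⟩ := i.even_or_odd'
  · rw [vertex_even, vertex_odd]
    exact M.l_lt k (by omega)
  · rw [vertex_odd, show 2 * k + 1 + 1 = 2 * (k + 1) by ring, vertex_even]
    exact M.r_lt k (by omega)

theorem affine_vertex : ∀ i < 2 * M.m + 1, ∀ t ∈ Icc (M.vertex i) (M.vertex (i + 1)),
    M.χ t = AffineMap.lineMap (M.χ (M.vertex i)) (M.χ (M.vertex (i + 1)))
      ((t - M.vertex i) / (M.vertex (i + 1) - M.vertex i)) := by
  intro i hi
  obtain ⟨k, rfl | rfl⟩ := i.even_or_odd'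
  · rw [vertex_even, vertex_odd]
    exact M.affine_l k (by omega)
  · rw [vertex_odd, show 2 * k + 1 + 1 = 2 * (k + 1) by ring, vertex_even]
    exact M.affine_r k (by omega)

variable {γ θ : ℝ}

theorem le_sub (hγ : ∀ s ∈ T, γ ≤ s ∧ γ ≤ 1 - s ∧ ∀ t ∈ T, s < t → γ ≤ t - s) {k : ℕ}
    (hk : k < M.m) : γ ≤ M.σ (k + 1) - M.σ k :=
  (hγ _ (M.mem k hk.le)).2.2 _ (M.mem (k + 1) hk) (M.lt k hk)

/-- The outermost windows are extended to 0 and to 1 instead of stopping at distance θ from the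
time; as θ < γ, this only lengthens them. -/
theorem node_even_add_le
    (hγ : ∀ s ∈ T, γ ≤ s ∧ γ ≤ 1 - s ∧ ∀ t ∈ T, s < t → γ ≤ t - s) (hθ : 0 < θ)
    (hθγ : 4 * θ < γ) {k : ℕ} (hk : k ≤ M.m) :
    M.node θ (2 * k) + 2 * θ ≤ M.node θ (2 * k + 1) := by
  have h1 := hγ _ (M.mem k hk)
  rcases eq_or_ne k M.m with rfl | hkm
  · rw [node_last]
    rcases eq_or_ne M.m 0 with h0 | h0
    · rw [h0, mul_zero, node_zero]
      linarith
    · rw [node_even _ _ h0]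
      linarith
  · rw [node_odd _ _ hkm]
    rcases eq_or_ne k 0 with rfl | h0
    · rw [mul_zero, node_zero]
      linarith
    · rw [node_even _ _ h0]
      linarith

theorem node_lt
    (hγ : ∀ s ∈ T, γ ≤ s ∧ γ ≤ 1 - s ∧ ∀ t ∈ T, s < t → γ ≤ t - s) (hθ : 0 < θ)
    (hθγ : 4 * θ < γ) : ∀ i < 2 * M.m + 1, M.node θ i < M.node θ (i + 1) := by
  intro i hi
  obtain ⟨k, rfl | rfl⟩ := i.even_or_odd'
  · linarith [M.node_even_add_le hγ hθ hθγ (k := k) (by omega)]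
  · rw [node_odd _ _ (by omega), show 2 * k + 1 + 1 = 2 * (k + 1) by ring,
      node_even _ _ (by omega)]
    linarith [M.le_sub hγ (k := k) (by omega)]

/-- A short side has length at most 2ρ and is traversed in time at least 2θ. -/
theorem norm_slope_even_le
    (hγ : ∀ s ∈ T, γ ≤ s ∧ γ ≤ 1 - s ∧ ∀ t ∈ T, s < t → γ ≤ t - s) (hθ : 0 < θ)
    (hθγ : 4 * θ < γ)
    {ε : ℝ} (hρ : ρ ≤ θ * ε) {k : ℕ} (hk : k ≤ M.m) :
    ‖M.slope θ (2 * k)‖ ≤ ε := by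
  have h1 := M.node_even_add_le hγ hθ hθγ hk
  have h0 : 0 < M.node θ (2 * k + 1) - M.node θ (2 * k) := by linarith
  rw [slope, norm_smul, norm_inv, Real.norm_of_nonneg h0.le, inv_mul_le_iff₀ h0, ← dist_eq_norm,
    vertex_even, vertex_odd]
  have h2 := dist_triangle_right (M.χ (M.r k)) (M.χ (M.l k)) (u (M.σ k))
  have h3 := M.near_l k hk
  have h4 := M.near_r k hk
  have h5 : 0 ≤ θ * ε := (dist_nonneg.trans h3).trans hρ
  have h6 : 0 ≤ ε := nonneg_of_mul_nonneg_right h5 hθ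
  nlinarith

/-- There are two errors: the increment along a long side differs from that of u by at most 2ρ, and
the time shrinks from L to L - 2θ, which changes the quotient by a term controlled by θ G. Both are
divided by a remaining time of at least γ / 2. -/
theorem norm_slope_odd_sub_le
    (hγ : ∀ s ∈ T, γ ≤ s ∧ γ ≤ 1 - s ∧ ∀ t ∈ T, s < t → γ ≤ t - s) (hθ : 0 < θ)
    (hθγ : 4 * θ < γ)
    {ε G : ℝ} (hρ : ρ * 4 ≤ ε * γ)
    (hG : ∀ s t, dist (u s) (u t) ≤ G) (hθG : 4 * θ * G ≤ ε * γ ^ 2) {k : ℕ} (hk : k < M.m) :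
    ‖M.slope θ (2 * k + 1) - (M.σ (k + 1) - M.σ k)⁻¹ • (u (M.σ (k + 1)) - u (M.σ k))‖ ≤
      2 * ε := by
  have hL := M.le_sub hγ hk
  set L := M.σ (k + 1) - M.σ k with hLdef
  have hγ0 : 0 < γ := by linarith
  have hL0 : 0 < L := by linarith
  have hL' : γ / 2 ≤ L - 2 * θ := by linarith
  have hL'0 : 0 < L - 2 * θ := by linarith
  have e0 : M.node θ (2 * k + 1 + 1) - M.node θ (2 * k + 1) = L - 2 * θ := by
    rw [node_odd _ _ hk.ne, show 2 * k + 1 + 1 = 2 * (k + 1) by ring, node_even _ _ (by omega)]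
    ring
  have e1 : M.slope θ (2 * k + 1) =
      (L - 2 * θ)⁻¹ • (M.χ (M.l (k + 1)) - M.χ (M.r k)) := by
    rw [slope, e0, vertex_odd, show 2 * k + 1 + 1 = 2 * (k + 1) by ring, vertex_even]
  have hu := hG (M.σ (k + 1)) (M.σ k)
  rw [dist_eq_norm] at hu
  set x := u (M.σ (k + 1)) - u (M.σ k) with hx
  set z := M.χ (M.l (k + 1)) - M.χ (M.r k) with hz
  have hzx : ‖z - x‖ ≤ 2 * ρ := by
    have h1 := M.near_l (k + 1) hk
    have h2 := M.near_r k hk.le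
    have h3 := dist_sub_sub_le (M.χ (M.l (k + 1))) (M.χ (M.r k)) (u (M.σ (k + 1))) (u (M.σ k))
    rw [dist_eq_norm] at h3
    linarith
  have e2 : M.slope θ (2 * k + 1) - L⁻¹ • x =
      (L - 2 * θ)⁻¹ • (z - x) + ((L - 2 * θ)⁻¹ - L⁻¹) • x := by
    rw [e1]; module
  have e3 : (L - 2 * θ)⁻¹ - L⁻¹ = (L - 2 * θ)⁻¹ * (2 * θ / L) := by field_simp; ring
  have hε : 0 ≤ ε := by
    have : 0 ≤ ρ := by
      linarith [norm_nonneg (z - x)]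
    exact nonneg_of_mul_nonneg_left (by linarith : 0 ≤ ε * γ) hγ0
  have hG0 : 0 ≤ G := (norm_nonneg _).trans hu
  rw [e2, e3, mul_smul, ← smul_add, norm_smul, norm_inv, Real.norm_of_nonneg hL'0.le,
    inv_mul_le_iff₀ hL'0]
  have h5 : ‖(2 * θ / L) • x‖ ≤ ε * γ / 2 := by
    rw [norm_smul, Real.norm_of_nonneg (by positivity)]
    calc 2 * θ / L * ‖x‖ ≤ 2 * θ / γ * G := by gcongr
      _ ≤ ε * γ / 2 := by
        rw [div_mul_eq_mul_div, div_le_iff₀ hγ0]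
        nlinarith
  calc ‖(z - x) + (2 * θ / L) • x‖ ≤ 2 * ρ + ε * γ / 2 :=
        (norm_add_le _ _).trans (add_le_add hzx h5)
    _ ≤ (γ / 2) * (2 * ε) := by nlinarith
    _ ≤ _ := by gcongr

end PolygonalModel

end PlanarRod
end

/-! ### Comparing the slopes with difference quotients -/

noncomputable section
namespace PlanarRod

namespace PolygonalModel

variable {u : ℝ → Plane} {T : Finset ℝ} {ρ η : ℝ} (M : PolygonalModel u T ρ η)

/-- The difference quotients of `u` between successive nodes of the model. -/
def quotient (k : ℕ) : Plane := (M.σ (k + 1) - M.σ k)⁻¹ • (u (M.σ (k + 1)) - u (M.σ k))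

theorem isSlopeApprox_stepFun : IsSlopeApprox u η (stepFun M.m M.σ M.quotient) := by
  intro t ht
  rcases lt_or_ge t (M.σ 0) with h0 | h0
  · exact ⟨0, M.σ 0, ht.1.le, h0.le, M.osc_left, Or.inr ⟨stepFun_eq_zero M.lt
      fun h => absurd h.1 (not_le.2 h0), Or.inl rfl⟩⟩
  · rcases le_or_gt (M.σ M.m) t with h1 | h1
    · exact ⟨M.σ M.m, 1, h1, ht.2.le, M.osc_right, Or.inr ⟨stepFun_eq_zero M.lt
        fun h => absurd h.2 (not_lt.2 h1), Or.inr rfl⟩⟩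
    · obtain ⟨k, hk, htk⟩ := exists_mem_Ico M.m ⟨h0, h1⟩
      exact ⟨M.σ k, M.σ (k + 1), htk.1, htk.2.le, M.osc k hk,
        Or.inl ⟨M.lt k hk, stepFun_eq M.lt hk htk⟩⟩

theorem eLpNorm_stepFun_quotient_le {p : ℝ≥0∞} (hp1 : 1 ≤ p) (hp : p ≠ ⊤) {V : ℝ → Plane}
    (hV : AEStronglyMeasurable V) (hu : ∀ s t, u t - u s = ∫ x in s..t, V x) :
    eLpNorm (stepFun M.m M.σ M.quotient) p volume ≤ eLpNorm V p volume := by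
  refine eLpNorm_stepFun_le hp1 hp M.lt hV fun k hk => ?_
  rw [quotient, smul_smul, mul_inv_cancel₀ (sub_pos.2 (M.lt k hk)).ne', one_smul, hu]

variable {γ θ ε G : ℝ}

theorem norm_quotient_le (hγ : ∀ s ∈ T, γ ≤ s ∧ γ ≤ 1 - s ∧ ∀ t ∈ T, s < t → γ ≤ t - s)
    (hγ0 : 0 < γ) (hG : ∀ s t, dist (u s) (u t) ≤ G) {k : ℕ} (hk : k < M.m) :
    ‖M.quotient k‖ ≤ G / γ := by
  have h1 := M.le_sub hγ hk
  have h2 : 0 < M.σ (k + 1) - M.σ k := hγ0.trans_le h1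
  have h3 := hG (M.σ (k + 1)) (M.σ k)
  rw [dist_eq_norm] at h3
  rw [quotient, norm_smul, norm_inv, Real.norm_of_nonneg h2.le, ← div_eq_inv_mul]
  gcongr
  exact (norm_nonneg _).trans h3

/-- Off the windows around T, either t is on a long side and lies between the corresponding σ k and
σ (k + 1), or it is on the first or last short side, outside [σ 0, σ m), where the quotient function
vanishes. -/
theorem norm_stepFun_sub_le_of_notMem
    (hγ : ∀ s ∈ T, γ ≤ s ∧ γ ≤ 1 - s ∧ ∀ t ∈ T, s < t → γ ≤ t - s) (hθ : 0 < θ)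
    (hθγ : 4 * θ < γ) (hε : 0 ≤ ε) (hρ : ρ ≤ θ * ε) (hρ' : ρ * 4 ≤ ε * γ)
    (hG : ∀ s t, dist (u s) (u t) ≤ G) (hθG : 4 * θ * G ≤ ε * γ ^ 2) {t : ℝ}
    (ht : t ∈ Ioo (0 : ℝ) 1) (htT : ∀ s ∈ T, t ∉ Icc (s - θ) (s + θ)) :
    ‖stepFun (2 * M.m + 1) (M.node θ) (M.slope θ) t - stepFun M.m M.σ M.quotient t‖ ≤
      2 * ε := by
  have hτ := M.node_lt hγ hθ hθγ
  have htT' : ∀ k ≤ M.m, t < M.σ k - θ ∨ M.σ k + θ < t := fun k hk => by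
    by_contra hcon
    rw [not_or, not_lt, not_lt] at hcon
    exact htT _ (M.mem k hk) hcon
  obtain ⟨i, hi, hti⟩ := exists_mem_Ico (τ := M.node θ) (2 * M.m + 1) (t := t)
    (by rw [node_zero, node_last]; exact ⟨ht.1.le, ht.2⟩)
  rw [stepFun_eq hτ hi hti]
  obtain ⟨k, rfl | rfl⟩ := i.even_or_odd'
  · rw [stepFun_eq_zero M.lt, sub_zero]
    · exact (M.norm_slope_even_le hγ hθ hθγ hρ (by omega)).trans (by linarith)
    · intro hmem
      have hk0 : k ≠ 0 := by
        rintro rfl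
        rcases eq_or_ne 0 M.m with h | h
        · rw [← h] at hmem
          exact absurd hmem.2 (not_lt.2 hmem.1)
        · rw [node_odd _ _ h] at hti
          rcases htT' 0 (by omega) with h' | h'
          · linarith [hmem.1]
          · linarith [hti.2]
      have hkm : k ≠ M.m := by
        rintro rfl
        rw [node_even _ _ hk0] at hti
        rcases htT' M.m le_rfl with h' | h'
        · linarith [hti.1]
        · linarith [hmem.2]
      rw [node_even _ _ hk0, node_odd _ _ hkm] at hti
      rcases htT' k (by omega) with h' | h'
      · linarith [hti.1]
      · linarith [hti.2]
  · have hk : k < M.m := by omega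
    rw [node_odd _ _ hk.ne, show 2 * k + 1 + 1 = 2 * (k + 1) by ring,
      node_even _ _ (by omega)] at hti
    rw [stepFun_eq M.lt hk ⟨by linarith [hti.1], by linarith [hti.2]⟩]
    exact M.norm_slope_odd_sub_le hγ hθ hθγ hρ' hG hθG hk

theorem norm_stepFun_sub_le
    (hγ : ∀ s ∈ T, γ ≤ s ∧ γ ≤ 1 - s ∧ ∀ t ∈ T, s < t → γ ≤ t - s) (hθ : 0 < θ)
    (hθγ : 4 * θ < γ) (hε : 0 ≤ ε) (hρ : ρ ≤ θ * ε) (hρ' : ρ * 4 ≤ ε * γ)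
    (hG : ∀ s t, dist (u s) (u t) ≤ G) (hθG : 4 * θ * G ≤ ε * γ ^ 2) (t : ℝ) :
    ‖stepFun (2 * M.m + 1) (M.node θ) (M.slope θ) t - stepFun M.m M.σ M.quotient t‖ ≤
      2 * ε + 2 * (G / γ) := by
  have hγ0 : 0 < γ := by linarith
  have hG0 : 0 ≤ G := dist_nonneg.trans (hG 0 0)
  have hGγ : 0 ≤ G / γ := by positivity
  have h1 : ‖stepFun M.m M.σ M.quotient t‖ ≤ G / γ :=
    norm_stepFun_le M.lt hGγ (fun k hk => M.norm_quotient_le hγ hγ0 hG hk) t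
  have h2 : ‖stepFun (2 * M.m + 1) (M.node θ) (M.slope θ) t‖ ≤ 2 * ε + G / γ := by
    refine norm_stepFun_le (M.node_lt hγ hθ hθγ) (by positivity) (fun i hi => ?_) t
    obtain ⟨k, rfl | rfl⟩ := i.even_or_odd'
    · have := M.norm_slope_even_le hγ hθ hθγ hρ (k := k) (by omega)
      linarith
    · have h3 := M.norm_slope_odd_sub_le hγ hθ hθγ hρ' hG hθG (k := k) (by omega)
      have h4 := M.norm_quotient_le hγ hγ0 hG (k := k) (by omega)
      have h5 := norm_sub_norm_le (M.slope θ (2 * k + 1)) (M.quotient k)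
      rw [quotient] at h4 h5
      linarith
  linarith [norm_sub_le (stepFun (2 * M.m + 1) (M.node θ) (M.slope θ) t)
    (stepFun M.m M.σ M.quotient t)]

theorem injOn_reparam (hγ : ∀ s ∈ T, γ ≤ s ∧ γ ≤ 1 - s ∧ ∀ t ∈ T, s < t → γ ≤ t - s)
    (hθ : 0 < θ) (hθγ : 4 * θ < γ) :
    InjOn (fun t => M.χ (M.l 0) +
      ∫ x in (0 : ℝ)..t, stepFun (2 * M.m + 1) (M.node θ) (M.slope θ) x) (Icc 0 1) := by
  have h0 : M.vertex 0 = M.l 0 := M.vertex_even 0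
  have h := injOn_integral_stepFun (by omega) (M.node_lt hγ hθ hθγ) M.vertex_lt
    (by rw [vertex_odd, h0]; exact M.inj) M.affine_vertex (a := M.slope θ) fun i _ => rfl
  rwa [node_zero, node_last, h0] at h

end PolygonalModel

variable {p : ℝ≥0∞} [Fact (1 ≤ p)]

/-- A `C⁰` limit of injective curves with integrable derivative is approximated by injective
polygonal curves whose derivatives are close to averages of the derivative of the limit. -/
theorem exists_injOn_stepFun (hp : p ≠ ⊤) {v : ℝ → Plane} (hv : Integrable v μ01) {c : Plane}
    (hlim : ∀ δ > 0, ∃ φ : ℝ → Plane, ContinuousOn φ (Icc 0 1) ∧ InjOn φ (Icc 0 1) ∧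
      ∀ t ∈ Icc (0 : ℝ) 1, dist (φ t) (primitive c v t) < δ) {η : ℝ} (hη : 0 < η) :
    ∃ (A : ℝ → Plane) (N : ℕ) (τ : ℕ → ℝ) (a : ℕ → Plane) (b : Plane),
      StronglyMeasurable A ∧ IsSlopeApprox (primitive c v) η A ∧
      eLpNorm A p volume ≤ eLpNorm (zeroExt v) p volume ∧
      τ 0 = 0 ∧ τ N = 1 ∧ (∀ i < N, τ i < τ (i + 1)) ∧
      InjOn (fun t => b + ∫ x in (0 : ℝ)..t, stepFun N τ a x) (Icc 0 1) ∧
      dist b (primitive c v 0) ≤ 2 * η ∧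
      eLpNorm (stepFun N τ a - A) p μ01 ≤ ENNReal.ofReal (2 * η) := by
  have hp1 : 1 ≤ p := Fact.out
  have hp0 : p ≠ 0 := (zero_lt_one.trans_le hp1).ne'
  set u := primitive c v with hu_def
  have hV := integrable_zeroExt hv
  obtain ⟨T, hT, hmodel⟩ := exists_polygonalModel_of_limit (u := u) (g := fun x => ‖zeroExt v x‖)
    (continuous_primitive hv) hV.norm (fun s t hst => dist_primitive_le hv hst)
    (fun x => norm_nonneg _) hlim (show 0 < η / 4 by positivity)
  rw [div_mul_cancel₀ η (by norm_num : (4 : ℝ) ≠ 0)] at hmodel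
  obtain ⟨γ, hγ0, hγ⟩ := exists_pos_separation T hT
  set G := ∫ x, ‖zeroExt v x‖ with hGdef
  have hG : ∀ s t, dist (u s) (u t) ≤ G := by
    have key : ∀ s t, s ≤ t → dist (u t) (u s) ≤ G := fun s t hst => by
      refine (dist_primitive_le hv hst).trans ?_
      rw [intervalIntegral.integral_of_le hst]
      exact setIntegral_le_integral hV.norm (Eventually.of_forall fun _ => norm_nonneg _)
    intro s t
    rcases le_total s t with h | h
    · rw [dist_comm]; exact key s t h
    · exact key t s h
  have hG0 : 0 ≤ G := dist_nonneg.trans (hG 0 0)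
  set ε := η / 2 with hε_def
  have hε : 0 < ε := half_pos hη
  -- Order of choices: η fixes T and hence γ, then θ makes the windows negligible in L^p, and ρ
  -- comes last. Its three bounds serve the initial value, the short sides and the long sides.
  obtain ⟨θ, hθ, hθγ, hθG, hθK⟩ := exists_cut (p := p) hp T.card (K := 2 * ε + 2 * (G / γ)) (G := G)
    hγ0 hε
  set ρ := min η (min (θ * ε) (ε * γ / 4)) with hρ_def
  have hρ1 : ρ ≤ η := min_le_left _ _
  have hρ2 : ρ ≤ θ * ε := (min_le_right _ _).trans (min_le_left _ _)
  have hρ3 : ρ * 4 ≤ ε * γ := by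
    have := (min_le_right η (min (θ * ε) (ε * γ / 4))).trans (min_le_right _ _)
    linarith
  rcases hmodel ρ (by positivity) with hosc | hM
  -- If u oscillates by at most η on [0,1], a straight segment of length η will do, compared with A
  -- = 0.
  · refine ⟨fun _ => 0, 1, fun i => (i : ℝ), fun _ => EuclideanSpace.single 0 η, u 0,
      stronglyMeasurable_const,
      fun t ht => ⟨0, 1, ht.1.le, ht.2.le, hosc, Or.inr ⟨rfl, Or.inl rfl⟩⟩,
      ?_, by simp, by simp, by simp, ?_, ?_, ?_⟩
    · rw [eLpNorm_zero']
      exact zero_le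
    · intro s hs t ht hst
      have h1 : ∀ t ∈ Icc (0 : ℝ) 1, ∫ x in (0 : ℝ)..t, stepFun 1 (fun i => (i : ℝ))
          (fun _ => (EuclideanSpace.single 0 η : Plane)) x = t • EuclideanSpace.single 0 η := by
        intro t ht
        have := integral_stepFun (N := 1) (τ := fun i => (i : ℝ))
          (a := fun _ => (EuclideanSpace.single 0 η : Plane)) (by simp) zero_lt_one (t := t)
          (by simpa using ht)
        simpa using this
      simp only [h1 s hs, h1 t ht, add_right_inj] at hst
      have := congrArg (fun z : Plane => z 0) hst
      simpa [hη.ne'] using this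
    · rw [dist_self]; positivity
    · refine (eLpNorm_mono_ae_real (g := fun _ => η) (Eventually.of_forall fun t => ?_)).trans ?_
      · rw [Pi.sub_apply, sub_zero]
        exact norm_stepFun_le (by simp) hη.le (fun _ _ => by simp [abs_of_pos hη]) t
      · rw [eLpNorm_const _ hp0 (NeZero.ne _), measure_univ, ENNReal.one_rpow, mul_one,
          Real.enorm_of_nonneg hη.le]
        exact ENNReal.ofReal_le_ofReal (by linarith)
  · obtain ⟨M⟩ := hM
    refine ⟨stepFun M.m M.σ M.quotient, 2 * M.m + 1, M.node θ, M.slope θ, M.χ (M.l 0),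
      stronglyMeasurable_stepFun, M.isSlopeApprox_stepFun,
      M.eLpNorm_stepFun_quotient_le hp1 hp hV.aestronglyMeasurable
        (fun s t => primitive_sub hv s t),
      M.node_zero θ, M.node_last θ, M.node_lt hγ hθ hθγ, M.injOn_reparam hγ hθ hθγ, ?_, ?_⟩
    · have h0 := (hT _ (M.mem 0 (Nat.zero_le _))).1.le
      have h1 := M.osc_left (M.σ 0) (right_mem_Icc.2 h0) 0 (left_mem_Icc.2 h0)
      have h2 := M.near_l 0 (Nat.zero_le _)
      linarith [dist_triangle (M.χ (M.l 0)) (u (M.σ 0)) (u 0)]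
    · refine (eLpNorm_le_of_forall_notMem hp T (ε := 2 * ε) (K := 2 * ε + 2 * (G / γ)) (θ := θ)
        (by positivity) (by positivity) (fun t ht htT => ?_) fun t _ => ?_).trans ?_
      · exact M.norm_stepFun_sub_le_of_notMem hγ hθ hθγ hε.le hρ2 hρ3 hG hθG ht htT
      · exact M.norm_stepFun_sub_le hγ hθ hθγ hε.le hρ2 hρ3 hG hθG t
      · refine (add_le_add le_rfl hθK).trans ?_
        rw [← ENNReal.ofReal_add (by positivity) hε.le]
        exact ENNReal.ofReal_le_ofReal (by linarith)

end PlanarRod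
end

/-! ### Strong approximation by piecewise affine homeomorphisms -/

noncomputable section
namespace PlanarRod

variable {p : ℝ≥0∞} [Fact (1 ≤ p)]

/-- The given curves are known on the open interval only. Precomposing with an affine contraction of
[0,1] into (0,1) makes them continuous and injective up to the endpoints; uniform continuity of u
absorbs the change of parameter. -/
theorem exists_injOn_near {yk : ℕ → W1p p} {y : W1p p} (hinj : ∀ k, IsContInjective (yk k))
    (hlim : TendstoC0 yk y) {u : ℝ → Plane} (hu : IsContRep y u) (huc : Continuous u) {δ : ℝ}
    (hδ : 0 < δ) :
    ∃ φ : ℝ → Plane, ContinuousOn φ (Icc 0 1) ∧ InjOn φ (Icc 0 1) ∧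
      ∀ t ∈ Icc (0 : ℝ) 1, dist (φ t) (u t) < δ := by
  obtain ⟨uk, u', huk, hu', hunif⟩ := hlim
  obtain ⟨k, hk⟩ := (Metric.tendstoUniformlyOn_iff.1 hunif (δ / 2) (half_pos hδ)).exists
  obtain ⟨w, hw, hwinj⟩ := hinj k
  obtain ⟨δ', hδ', hcont⟩ := Metric.uniformContinuousOn_iff.1
    (isCompact_Icc.uniformContinuousOn_of_continuous (s := Icc (0 : ℝ) 1) huc.continuousOn)
    (δ / 2) (half_pos hδ)
  set e := min (δ' / 2) (1 / 4) with he
  have he0 : 0 < e := by positivity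
  have he1 : e ≤ 1 / 4 := min_le_right _ _
  have he2 : e ≤ δ' / 2 := min_le_left _ _
  have hmaps : MapsTo (fun x : ℝ => e + (1 - 2 * e) * x) (Icc 0 1) (Ioo 0 1) := by
    intro x hx
    constructor <;> nlinarith [hx.1, hx.2]
  refine ⟨fun x => w (e + (1 - 2 * e) * x), hw.1.comp (by fun_prop) hmaps, ?_, fun t ht => ?_⟩
  · intro s hs t ht hst
    have := hwinj (hmaps hs) (hmaps ht) hst
    have h0 : 1 - 2 * e ≠ 0 := by linarith
    exact mul_left_cancel₀ h0 (add_left_cancel this)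
  · have hm := hmaps ht
    have h1 := hk _ hm
    have h2 := hcont _ (Ioo_subset_Icc_self hm) t ht (by
      rw [Real.dist_eq, abs_lt]
      constructor <;> nlinarith [ht.1, ht.2])
    simp only at h1 h2
    rw [← hu.eqOn hu' hm, ← hw.eqOn (huk k) hm] at h1
    rw [dist_comm] at h1
    linarith [dist_triangle (w (e + (1 - 2 * e) * t)) (u (e + (1 - 2 * e) * t)) (u t)]

theorem norm_primitive_le {v : ℝ → Plane} (hv : Integrable v μ01) (c : Plane) {t : ℝ}
    (ht : 0 ≤ t) : ‖primitive c v t‖ ≤ ‖c‖ + ∫ x, ‖v x‖ ∂μ01 := by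
  have h1 := dist_primitive_le (c := c) hv ht
  have h2 : ∫ x in (0 : ℝ)..t, ‖zeroExt v x‖ ≤ ∫ x, ‖v x‖ ∂μ01 := by
    rw [intervalIntegral.integral_of_le ht, ← integral_indicator measurableSet_Ioo]
    have : (Ioo (0 : ℝ) 1).indicator (fun x => ‖v x‖) = fun x => ‖zeroExt v x‖ :=
      funext fun x => (norm_indicator_eq_indicator_norm v x).symm
    rw [this]
    exact setIntegral_le_integral (integrable_zeroExt hv).norm
      (Eventually.of_forall fun _ => norm_nonneg _)
  have h3 : primitive c v 0 = c := by simp [primitive]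
  rw [h3, dist_eq_norm] at h1
  have h4 := norm_sub_norm_le (primitive c v t) c
  linarith

/-- Strong convergence in the Sobolev space follows from convergence of the derivatives and of the
initial values. -/
theorem tendstoStrong_of_tendsto {z : ℕ → W1p p} {y : W1p p} {b : ℕ → Plane} {c : Plane}
    (hz : ∀ n, IsContRep (z n) (primitive (b n) (z n).1.snd))
    (hy : IsContRep y (primitive c y.1.snd)) (hb : Tendsto b atTop (𝓝 c))
    (hsnd : Tendsto (fun n => (z n).1.snd) atTop (𝓝 y.1.snd)) : TendstoStrong z y := by
  have hfst : Tendsto (fun n => (z n).1.fst) atTop (𝓝 y.1.fst) := by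
    rw [tendsto_iff_norm_sub_tendsto_zero]
    have h0 : Tendsto (fun n => ‖b n - c‖ + ‖(z n).1.snd - y.1.snd‖) atTop (𝓝 0) := by
      simpa using (tendsto_iff_norm_sub_tendsto_zero.1 hb).add
        (tendsto_iff_norm_sub_tendsto_zero.1 hsnd)
    refine squeeze_zero (fun _ => norm_nonneg _) (fun n => ?_) h0
    have hv := integrable_coe (z n).1.snd
    have hv' := integrable_coe y.1.snd
    have hbound : ∀ᵐ x ∂μ01, ‖((z n).1.fst - y.1.fst : Lp Plane p μ01) x‖ ≤
        ‖b n - c‖ + ‖(z n).1.snd - y.1.snd‖ := by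
      filter_upwards [Lp.coeFn_sub (z n).1.fst y.1.fst, (hz n).2, hy.2,
        ae_restrict_mem measurableSet_Ioo] with x hx hx1 hx2 hx01
      rw [hx, Pi.sub_apply, ← hx1, ← hx2, primitive_sub_primitive hv hv']
      refine (norm_primitive_le (hv.sub hv') _ hx01.1.le).trans (add_le_add le_rfl ?_)
      refine le_trans (le_of_eq (integral_congr_ae ?_)) (integral_norm_le_norm _)
      filter_upwards [Lp.coeFn_sub (z n).1.snd y.1.snd] with s hs
      rw [hs]
    have := Lp.norm_le_of_ae_bound (by positivity) hbound
    simpa [measureUnivNNReal] using this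
  rw [TendstoStrong, tendsto_subtype_rng]
  exact ((WithLp.prodContinuousLinearEquiv p ℝ (Lp Plane p μ01)
    (Lp Plane p μ01)).symm.continuous.tendsto (y.1.fst, y.1.snd)).comp (hfst.prodMk_nhds hsnd)

section

variable {N : ℕ} {τ : ℕ → ℝ} {a : ℕ → Plane}

theorem memLp_stepFun {q : ℝ≥0∞} (hτ : ∀ i < N, τ i < τ (i + 1)) :
    MemLp (stepFun N τ a) q μ01 := by
  refine MemLp.of_bound stronglyMeasurable_stepFun.aestronglyMeasurable
    (∑ i ∈ Finset.range N, ‖a i‖) (Eventually.of_forall fun t => ?_)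
  exact norm_stepFun_le hτ (by positivity) (fun i hi => Finset.single_le_sum
    (f := fun i => ‖a i‖) (fun _ _ => norm_nonneg _) (Finset.mem_range.2 hi)) t

theorem primitive_toLp_stepFun {q : ℝ≥0∞} (hτ : ∀ i < N, τ i < τ (i + 1)) (b : Plane) {t : ℝ}
    (ht : t ∈ Icc (0 : ℝ) 1) :
    primitive b ((memLp_stepFun (q := q) (a := a) hτ).toLp _) t =
      b + ∫ x in (0 : ℝ)..t, stepFun N τ a x := by
  rw [primitive]
  congr 1
  refine intervalIntegral.integral_congr_ae ?_
  have h := (ae_restrict_iff' measurableSet_Ioo).1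
    (memLp_stepFun (q := q) (a := a) hτ).coeFn_toLp
  filter_upwards [h, compl_mem_ae_iff.2 (measure_singleton (1 : ℝ))] with x hx hx1 hxt
  rw [uIoc_of_le ht.1] at hxt
  have hx01 : x ∈ Ioo (0 : ℝ) 1 := ⟨hxt.1, lt_of_le_of_ne (hxt.2.trans ht.2) hx1⟩
  rw [zeroExt, indicator_of_mem hx01, hx hx01]

/-- Injective primitives of step functions are piecewise affine Sobolev homeomorphisms. -/
theorem exists_W1p_stepFun (h0 : τ 0 = 0) (h1 : τ N = 1) (hτ : ∀ i < N, τ i < τ (i + 1))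
    {b : Plane} (hinj : InjOn (fun t => b + ∫ x in (0 : ℝ)..t, stepFun N τ a x) (Icc 0 1)) :
    ∃ z : W1p p, IsHomeoOntoImage z ∧ IsPiecewiseAffine z ∧
      IsContRep z (primitive b z.1.snd) ∧ z.1.snd = (memLp_stepFun (a := a) hτ).toLp _ := by
  obtain ⟨z, hz, hrep⟩ := exists_W1p_primitive b ((memLp_stepFun (q := p) (a := a) hτ).toLp _)
  have hcont := continuous_primitive (c := b) (integrable_coe
    ((memLp_stepFun (q := p) (a := a) hτ).toLp _))
  have heq : EqOn (primitive b ((memLp_stepFun (q := p) (a := a) hτ).toLp _))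
      (fun t => b + ∫ x in (0 : ℝ)..t, stepFun N τ a x) (Icc 0 1) := fun t ht =>
    primitive_toLp_stepFun hτ b ht
  refine ⟨z, ⟨_, hrep, ?_⟩, ⟨_, hrep, N, τ, h0, h1, hτ, fun i hi => ?_⟩, hz ▸ hrep, hz⟩
  -- Injectivity on the compact interval [0,1] is what gives an embedding, which is then restricted;
  -- a continuous injection of (0,1) alone need not be one.
  · have hI := heq.injOn_iff.2 hinj
    have he : IsClosedEmbedding ((Icc (0 : ℝ) 1).domRestrict
        (primitive b ((memLp_stepFun (q := p) (a := a) hτ).toLp _))) :=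
      Continuous.isClosedEmbedding (hcont.comp continuous_subtype_val) hI.injective
    exact he.isEmbedding.comp (IsEmbedding.inclusion Ioo_subset_Icc_self)
  · have hmem : ∀ x ∈ Icc (τ i) (τ (i + 1)), x ∈ Icc (0 : ℝ) 1 := fun x hx => by
      rw [← h0, ← h1]
      exact ⟨(le_of_forall_lt_succ hτ (Nat.zero_le i) hi.le).trans hx.1,
        hx.2.trans (le_of_forall_lt_succ hτ hi le_rfl)⟩
    refine ⟨b + (∫ x in (0 : ℝ)..(τ i), stepFun N τ a x) - τ i • a i, a i, fun x hx => ?_⟩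
    have hx' := Ioo_subset_Icc_self hx
    rw [heq (hmem x hx')]
    have hii : ∀ s t : ℝ, IntervalIntegrable (stepFun N τ a) volume s t := fun s t =>
      integrable_stepFun.intervalIntegrable
    simp only
    rw [← intervalIntegral.integral_add_adjacent_intervals (hii 0 (τ i)) (hii (τ i) x),
      integral_stepFun hτ hi hx', sub_smul]
    abel

end

/-- A `C⁰` limit of injective Sobolev curves is a strong limit of piecewise affine
homeomorphisms. -/
theorem TendstoC0.exists_piecewiseAffine (hp : p ≠ ⊤) {yk : ℕ → W1p p} {y : W1p p}
    (hlim : TendstoC0 yk y) (hinj : ∀ k, IsContInjective (yk k)) :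
    ∃ z : ℕ → W1p p, (∀ n, IsHomeoOntoImage (z n) ∧ IsPiecewiseAffine (z n)) ∧
      TendstoStrong z y := by
  have hp1 : 1 ≤ p := Fact.out
  obtain ⟨c, hc⟩ := exists_isContRep_primitive y
  have hv := integrable_coe y.1.snd
  have hV := integrable_zeroExt hv
  have hc0 : primitive c y.1.snd 0 = c := by simp [primitive]
  have hη : ∀ n : ℕ, (0 : ℝ) < 1 / (n + 1) := fun n => Nat.one_div_pos_of_nat
  have hη0 := tendsto_one_div_add_atTop_nhds_zero_nat (𝕜 := ℝ)
  choose A N τ a b hAm hA hAle h0 h1 hτ hI hb hD using fun n : ℕ => exists_injOn_stepFun hp hv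
    (fun δ hδ => exists_injOn_near hinj hlim hc (continuous_primitive hv) hδ) (hη n)
  choose z hzh hza hzr hzs using fun n => exists_W1p_stepFun (p := p) (h0 n) (h1 n) (hτ n) (hI n)
  refine ⟨z, fun n => ⟨hzh n, hza n⟩, tendstoStrong_of_tendsto (b := b) (c := c) hzr hc ?_ ?_⟩
  · rw [tendsto_iff_dist_tendsto_zero]
    refine squeeze_zero (fun _ => dist_nonneg) (fun n => ?_)
      (mul_zero (2 : ℝ) ▸ hη0.const_mul (2 : ℝ))
    simpa only [hc0] using hb n
  -- The functions A n converge to y' at almost every point, with L^p norms bounded by that of y',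
  -- hence in L^p. The slopes of z n differ from them by at most 2/(n+1) in norm.
  · have hAlim : Tendsto (fun n => eLpNorm (A n - ⇑y.1.snd) p μ01) atTop (𝓝 0) := by
      refine tendsto_eLpNorm_sub_of_tendsto_ae hp1 hp (fun n => (hAm n).aestronglyMeasurable)
        (Lp.memLp _) (fun n => ?_) ?_
      · refine (eLpNorm_mono_measure _ Measure.restrict_le_self).trans ((hAle n).trans ?_)
        rw [zeroExt, eLpNorm_indicator_eq_eLpNorm_restrict measurableSet_Ioo]
      · filter_upwards [ae_restrict_of_ae
          (_root_.LocallyIntegrable.ae_hasDerivAt_integral hV.locallyIntegrable),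
          ae_restrict_mem measurableSet_Ioo] with t ht ht01
        have h2 := (ht 0).const_add c
        rw [zeroExt, indicator_of_mem ht01] at h2
        exact tendsto_of_isSlopeApprox h2 ht01 hη0 hA
    simp only [hzs]
    rw [Lp.tendsto_Lp_iff_tendsto_eLpNorm']
    have hsum : Tendsto (fun n : ℕ => ENNReal.ofReal (2 * (1 / ((n : ℝ) + 1))) +
        eLpNorm (A n - ⇑y.1.snd) p μ01) atTop (𝓝 0) := by
      have h3 := (ENNReal.continuous_ofReal.tendsto _).comp (hη0.const_mul (2 : ℝ))
      rw [mul_zero, ENNReal.ofReal_zero] at h3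
      simpa using h3.add hAlim
    refine tendsto_of_tendsto_of_tendsto_of_le_of_le tendsto_const_nhds hsum
      (fun _ => zero_le) fun n => ?_
    have hm := memLp_stepFun (q := p) (a := a n) (hτ n)
    have e1 : eLpNorm (⇑(hm.toLp _) - ⇑y.1.snd) p μ01 =
        eLpNorm ((stepFun (N n) (τ n) (a n) - A n) + (A n - ⇑y.1.snd)) p μ01 := by
      refine eLpNorm_congr_ae ?_
      filter_upwards [hm.coeFn_toLp] with x hx
      simp [hx]
    simp only
    rw [e1]
    exact (eLpNorm_add_le (hm.1.sub (hAm n).aestronglyMeasurable)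
      ((hAm n).aestronglyMeasurable.sub (Lp.aestronglyMeasurable _)) hp1).trans
      (add_le_add (hD n) le_rfl)

theorem TendstoStrong.tendstoWeak {yk : ℕ → W1p p} {y : W1p p} (h : TendstoStrong yk y) :
    TendstoWeak yk y :=
  ((toWeakSpaceCLM ℝ (W1p p)).continuous.tendsto y).comp h

theorem TendstoStrong.isBoundedSeq {yk : ℕ → W1p p} {y : W1p p} (h : TendstoStrong yk y) :
    IsBoundedSeq yk := by
  obtain ⟨C, hC⟩ := (Tendsto.norm h).bddAbove_range
  exact ⟨C, fun k => hC (mem_range_self k)⟩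

theorem IsHomeoOntoImage.isContInjective {y : W1p p} (h : IsHomeoOntoImage y) :
    IsContInjective y := by
  obtain ⟨u, hu, he⟩ := h
  exact ⟨u, hu, injOn_iff_injective.2 he.injective⟩

end PlanarRod

end

/-! ### The two cycles of implications -/

theorem theorem3p2 (p : ℝ≥0∞) [Fact (1 ≤ p)] (hp : p < ⊤) (y : PlanarRod.W1p p) :
    -- homeomorphisms onto their images, `1 < p < ∞`
    (1 < p →
      List.TFAE
        [PlanarRod.NonInterpenetrative y,
         ∃ yk : ℕ → PlanarRod.W1p p, PlanarRod.IsBoundedSeq yk ∧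
           (∀ k, PlanarRod.IsHomeoOntoImage (yk k)) ∧ PlanarRod.TendstoWeak yk y,
         ∃ yk : ℕ → PlanarRod.W1p p, PlanarRod.IsBoundedSeq yk ∧
           (∀ k, PlanarRod.IsHomeoOntoImage (yk k)) ∧ PlanarRod.TendstoStrong yk y,
         ∃ yk : ℕ → PlanarRod.W1p p, PlanarRod.IsBoundedSeq yk ∧
           (∀ k, PlanarRod.IsHomeoOntoImage (yk k) ∧ PlanarRod.IsPiecewiseAffine (yk k)) ∧
           PlanarRod.TendstoStrong yk y]) ∧
    -- continuous one-to-one maps, `1 ≤ p < ∞`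
    List.TFAE
      [∃ yk : ℕ → PlanarRod.W1p p,
         (∀ k, PlanarRod.IsContInjective (yk k)) ∧ PlanarRod.TendstoStrong yk y,
       ∃ yk : ℕ → PlanarRod.W1p p,
         (∀ k, PlanarRod.IsContInjective (yk k)) ∧ PlanarRod.TendstoWeak yk y,
       ∃ yk : ℕ → PlanarRod.W1p p,
         (∀ k, PlanarRod.IsContInjective (yk k)) ∧ PlanarRod.IsEquicont yk ∧
           PlanarRod.TendstoC0 yk y,
       ∃ yk : ℕ → PlanarRod.W1p p,
         (∀ k, PlanarRod.IsContInjective (yk k) ∧ PlanarRod.IsPiecewiseAffine (yk k)) ∧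
           PlanarRod.TendstoStrong yk y] := by
  refine ⟨fun _ => ?_, ?_⟩
  · tfae_have 1 → 4 := by
      rintro ⟨yk, -, hh, hlim⟩
      obtain ⟨z, hz, hzy⟩ := hlim.exists_piecewiseAffine hp.ne fun k => (hh k).isContInjective
      exact ⟨z, hzy.isBoundedSeq, hz, hzy⟩
    tfae_have 4 → 3 := fun ⟨z, hb, hz, hzy⟩ => ⟨z, hb, fun k => (hz k).1, hzy⟩
    tfae_have 3 → 2 := fun ⟨z, hb, hz, hzy⟩ => ⟨z, hb, hz, hzy.tendstoWeak⟩
    tfae_have 2 → 1 := fun ⟨z, hb, hz, hzy⟩ => ⟨z, hb, hz, hzy.tendstoC0_and_isEquicont.1⟩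
    tfae_finish
  · tfae_have 1 → 2 := fun ⟨z, hz, hzy⟩ => ⟨z, hz, hzy.tendstoWeak⟩
    tfae_have 2 → 3 := fun ⟨z, hz, hzy⟩ =>
      ⟨z, hz, hzy.tendstoC0_and_isEquicont.2, hzy.tendstoC0_and_isEquicont.1⟩
    tfae_have 3 → 4 := by
      rintro ⟨yk, hh, -, hlim⟩
      obtain ⟨z, hz, hzy⟩ := hlim.exists_piecewiseAffine hp.ne hh
      exact ⟨z, fun k => ⟨(hz k).1.isContInjective, (hz k).2⟩, hzy⟩
    tfae_have 4 → 1 := fun ⟨z, hz, hzy⟩ => ⟨z, fun k => (hz k).1, hzy⟩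
    tfae_finish
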